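/- **Setting.** Let $G$ be a countable discrete group with a sofic approximation $\sigma_k\colon G\to S_{d_k}$ ($d_k\ge 1$): the $\sigma_k$ are maps, not assumed to be homomorphisms, such that, for the normalized Hamming distance $d_{\rm Ham}(p,q)=\frac1{n}|\{j:p(j)\ne q(j)\}|$ on $S_n$, $d_{\rm Ham}(\sigma_k(g)\sigma_k(h),\sigma_k(gh))\to 0$ for all $g,h\in G$ and $d_{\rm Ham}(\sigma_k(g),\sigma_k(h))\to 1$ for all $g\neq h$, as $k\to\infty$. Let $\omega$ be a free ultrafilter on $\mathbb N$. Let $G\curvearrowright X$ be an algebraic action, i.e. an action by continuous automorphisms of a compact metrizable group $X$, and let $\rho$ be a compatible metric on $X$. *Loeb space.* $Z_\omega=\prod_k\{1,\dots,d_k\}/\!\sim$, where $(j_k)\sim(j_k')$ iff $\{k:j_k=j'_k\}\in\omega$. Its $\sigma$-algebra is generated by the internal sets $\prod_{k\to\omega}A_k=\{[(j_k)_k]:\{k:j_k\in A_k\}\in\omega\}$, $A_k\subseteq\{1,\dots,d_k\}$, and $u_\omega$ is the measure on it with $u_\omega(\prod_{k\to\omega}A_k)=\lim_{k\to\omega}|A_k|/d_k$.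 A sequence $(f_k)$ of maps from $\{1,\dots,d_k\}$ to a compact metrizable space defines $(f_k)_{k\to\omega}\colon[(j_k)_k]\mapsto\lim_{k\to\omega}f_k(j_k)$ on $Z_\omega$. *Centralizer.* $\prod_{k\to\omega}S_{d_k}$ is the quotient of $\prod_kS_{d_k}$ by the sequences with $\lim_{k\to\omega}d_{\rm Ham}(\tau_k,1)=0$; it acts on $(Z_\omega,u_\omega)$, modulo null sets, by $[(\tau_k)_k]\cdot[(j_k)_k]=[(\tau_k(j_k))_k]$. $G'_\omega$ is the centralizer in it of $\{[(\sigma_k(g))_k]:g\in G\}$. *Microstates and limits.* Let $E$ be a compact metrizable space with an action of $G$ by homeomorphisms. Measures $\mu_k\in\mathrm{Prob}(E^{d_k})$ are asymptotically supported on topological microstates (as $k\to\omega$) if for all $g\in G$, all open $U\supseteq\{(x,x):x\in E\}$ and all $\varepsilon>0$ $$\lim_{k\to\omega}\mu_k\Big(\Big\{\phi:\tfrac1{d_k}|\{j:(\phi(\sigma_k(g)(j)),g\phi(j))\in U\}|>1-\varepsilon\Big\}\Big)=1.$$ Let $\mu_{k,j}$ be the $j$-th marginal of $\mu_k$. For $m\in\mathrm{Prob}(\mathrm{Prob}(E))$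 write $\mu_k\to^{lw^*}m$ if $\lim_{k\to\omega}\frac1{d_k}\sum_j\delta_{\mu_{k,j}}=m$ weak$^*$. $\mathcal L_\omega$ is the set of (a.e. classes of) measurable maps $Z_\omega\to\mathrm{Prob}(X)$ of the form $(j\mapsto\mu_{k,j})_{k\to\omega}$ with $(\mu_k)$ asymptotically supported on topological microstates of $G\curvearrowright X$. $\mathrm{Sub}(X)$ is the space of closed subgroups of $X$ with the Hausdorff topology, $m_K$ is the Haar probability measure of $K\in\mathrm{Sub}(X)$, and $\mathcal S_\omega$ is the set of (a.e. classes of) measurable $\widetilde Y\colon Z_\omega\to\mathrm{Sub}(X)$ with $(z\mapsto m_{\widetilde Y(z)})\in\mathcal L_\omega$, ordered by almost everywhere inclusion. *Entropy.* Let $\rho$ be a compatible metric on $E$ and $\rho_2(\phi,\psi)=(\frac1n\sum_j\rho(\phi(j),\psi(j))^2)^{1/2}$ on $E^n$; $N_\varepsilon$ denotes the open $\varepsilon$-neighbourhood for $\rho_2$. $S_\varepsilon(A)$ is the least cardinality of $B\subseteq A$ with $A\subseteq N_\varepsilon(B)$, and $S_{\varepsilon,\delta}(\mu)$ is the least cardinality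 of a finite set $B$ with $\mu(N_\varepsilon(B))\ge1-\delta$. Put $$h((\mu_k))=\sup_{\varepsilon,\delta>0}\lim_{k\to\omega}\tfrac1{d_k}\log S_{\varepsilon,\delta}(\mu_k),\qquad h^{lw^*}_\omega(m)=\sup_{(\mu_k)}h((\mu_k)),$$ the last supremum over the $(\mu_k)$ that are asymptotically supported on topological microstates of $G\curvearrowright E$ and satisfy $\mu_k\to^{lw^*}m$. Put $h^{lw^*}_\omega(G\curvearrowright(E,\mu))=h^{lw^*}_\omega(\delta_\mu)$ for $\mu\in\mathrm{Prob}(E)$. With $\mathrm{Map}(F,\delta,\sigma_k)=\{\phi\in E^{d_k}:\rho_2(g\phi,\phi\circ\sigma_k(g))<\delta\ \forall g\in F\}$ let $$h_{\omega,\mathrm{top}}(G\curvearrowright E)=\sup_{\varepsilon>0}\ \inf_{F\subseteq G\text{ finite},\,\delta>0}\ \lim_{k\to\omega}\tfrac1{d_k}\log S_\varepsilon(\mathrm{Map}(F,\delta,\sigma_k)).$$ Values are in $[-\infty,\infty]$, with $\log0=\sup\emptyset=-\infty$. **Theorem.** $\mathcal S_\omega$ has a greatest element. Let $\widetilde Y$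 be this greatest ("maximal") element, $Y=\widetilde Y_*u_\omega$ its distribution, and $m_Y\in\mathrm{Prob}(\mathrm{Prob}(X))$ the image of $Y$ under $K\mapsto m_K$. (i) $Y$ is a $G$-invariant random subgroup of $X$, i.e. a $G$-invariant Borel probability measure on $\mathrm{Sub}(X)$, and $h^{lw^*}_\omega(m_Y)=h_{\omega,\mathrm{top}}(G\curvearrowright X)$. (ii) If $G'_\omega$ acts ergodically on $(Z_\omega,u_\omega)$, then $\widetilde Y$ is almost everywhere equal to a fixed $G$-invariant closed subgroup $K$ of $X$, and $$h^{lw^*}_\omega(\delta_{m_K})=h^{lw^*}_\omega(G\curvearrowright(K,m_K))=h_{\omega,\mathrm{top}}(G\curvearrowright X)=h_{\omega,\mathrm{top}}(G\curvearrowright K),$$ where the first entropy is computed with measures on $X^{d_k}$ and the second with measures on $K^{d_k}$. -/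

import Mathlib

open Filter Topology MeasureTheory
open scoped ENNReal NNReal symmDiff

noncomputable section

namespace LocalWeak

/-! ### Limits along an ultrafilter -/

/-- The limit `lim_{k → ω} f k` in a compact Hausdorff space. -/
def ultralim {T : Type*} [TopologicalSpace T] (ω : Ultrafilter ℕ) (f : ℕ → T) : T :=
  (ω.map f).lim

theorem tendsto_ultralim {T : Type*} [TopologicalSpace T] [CompactSpace T]
    (ω : Ultrafilter ℕ) (f : ℕ → T) : Tendsto f ω (𝓝 (ultralim ω f)) :=
  (ω.map f).le_nhds_lim

theorem ultralim_congr {T : Type*} [TopologicalSpace T] (ω : Ultrafilter ℕ) {f g : ℕ → T}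
    (h : ∀ᶠ k in (ω : Filter ℕ), f k = g k) : ultralim ω f = ultralim ω g := by
  have : ω.map f = ω.map g := Ultrafilter.coe_injective (Filter.map_congr h)
  rw [ultralim, ultralim, this]

theorem ultralim_eq {T : Type*} [TopologicalSpace T] [CompactSpace T] [T2Space T]
    {ω : Ultrafilter ℕ} {f : ℕ → T} {a : T} (h : Tendsto f ω (𝓝 a)) : ultralim ω f = a :=
  tendsto_nhds_unique (tendsto_ultralim ω f) h

/-! ### The Loeb space -/

/-- The ultraproduct of the finite sets `{1, …, d k}`. -/
abbrev LoebSpace (d : ℕ → ℕ) (ω : Ultrafilter ℕ) : Type :=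
  (ω : Filter ℕ).Product (fun k => Fin (d k))

/-- The class of a sequence of points. -/
def LoebSpace.mk {d : ℕ → ℕ} (ω : Ultrafilter ℕ) (j : ∀ k, Fin (d k)) : LoebSpace d ω :=
  Quotient.mk (productSetoid (ω : Filter ℕ) fun k => Fin (d k)) j

theorem LoebSpace.mk_eq {d : ℕ → ℕ} {ω : Ultrafilter ℕ} {i j : ∀ k, Fin (d k)} :
    LoebSpace.mk ω i = LoebSpace.mk ω j ↔ ∀ᶠ k in (ω : Filter ℕ), i k = j k :=
  Quotient.eq (r := productSetoid (ω : Filter ℕ) fun k => Fin (d k))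

/-- The internal set determined by `A k ⊆ {1, …, d k}`: the classes of the sequences with
`j k ∈ A k` for `ω`-almost every `k`. -/
def internal {d : ℕ → ℕ} (ω : Ultrafilter ℕ) (A : ∀ k, Set (Fin (d k))) : Set (LoebSpace d ω) :=
  {z | ∃ j : ∀ k, Fin (d k), (∀ᶠ k in (ω : Filter ℕ), j k ∈ A k) ∧ LoebSpace.mk ω j = z}

theorem mk_mem_internal {d : ℕ → ℕ} {ω : Ultrafilter ℕ} {A : ∀ k, Set (Fin (d k))}
    {j : ∀ k, Fin (d k)} :
    LoebSpace.mk ω j ∈ internal ω A ↔ ∀ᶠ k in (ω : Filter ℕ), j k ∈ A k := by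
  constructor
  · rintro ⟨i, hi, hij⟩
    filter_upwards [hi, LoebSpace.mk_eq.1 hij] with k h1 h2
    rwa [← h2]
  · exact fun h => ⟨j, h, rfl⟩

/-- The `σ`-algebra generated by the internal sets. -/
instance (d : ℕ → ℕ) (ω : Ultrafilter ℕ) : MeasurableSpace (LoebSpace d ω) :=
  MeasurableSpace.generateFrom (Set.range (internal ω))

/-- The uniform probability measure `|A| / n` of a set `A ⊆ {1, …, n}`. -/
def unif {n : ℕ} (A : Set (Fin n)) : ℝ≥0∞ := (A.ncard : ℝ≥0∞) / (n : ℝ≥0∞)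

/-- The infimum of `lim_{k → ω} |A k| / d k` over the internal sets that contain `S`. -/
def loebContent (d : ℕ → ℕ) (ω : Ultrafilter ℕ) (S : Set (LoebSpace d ω)) : ℝ≥0∞ :=
  ⨅ (A : ∀ k, Set (Fin (d k))) (_ : S ⊆ internal ω A), ultralim ω fun k => unif (A k)

theorem unif_mono {n : ℕ} {A B : Set (Fin n)} (h : A ⊆ B) : unif A ≤ unif B := by
  unfold unif
  gcongr
  exact B.toFinite

theorem unif_add_le {n : ℕ} {A B C : Set (Fin n)} (h : Disjoint A B) (hC : A ∪ B ⊆ C) :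
    unif A + unif B ≤ unif C := by
  refine le_trans (le_of_eq ?_) (unif_mono hC)
  rw [unif, unif, unif, Set.ncard_union_eq h A.toFinite B.toFinite, ← ENNReal.add_div]
  push_cast
  rfl

theorem unif_union_le {n : ℕ} (A B : Set (Fin n)) : unif (A ∪ B) ≤ unif A + unif B := by
  rw [unif, unif, unif, ← ENNReal.add_div]
  gcongr
  exact_mod_cast Set.ncard_union_le A B

theorem loebContent_empty (d : ℕ → ℕ) (ω : Ultrafilter ℕ) : loebContent d ω ∅ = 0 := by
  refine le_antisymm ?_ bot_le
  refine (iInf₂_le (fun k => (∅ : Set (Fin (d k)))) (Set.empty_subset _)).trans (le_of_eq ?_)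
  refine ultralim_eq ?_
  simp [unif]

theorem internal_caratheodory (d : ℕ → ℕ) (ω : Ultrafilter ℕ) (B : ∀ k, Set (Fin (d k))) :
    MeasurableSet[(OuterMeasure.ofFunction (loebContent d ω)
      (loebContent_empty d ω)).caratheodory] (internal ω B) := by
  refine OuterMeasure.ofFunction_caratheodory fun t => ?_
  refine le_iInf₂ fun A hA => ?_
  have h1 : loebContent d ω (t ∩ internal ω B) ≤ ultralim ω fun k => unif (A k ∩ B k) := by
    refine iInf₂_le (fun k => A k ∩ B k) ?_
    rintro z ⟨hz, j, hj, rfl⟩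
    rw [mk_mem_internal]
    filter_upwards [hj, mk_mem_internal.1 (hA hz)] with k h1 h2
    exact ⟨h2, h1⟩
  have h2 : loebContent d ω (t \ internal ω B) ≤ ultralim ω fun k => unif (A k \ B k) := by
    refine iInf₂_le (fun k => A k \ B k) ?_
    rintro z ⟨hz, hzB⟩
    obtain ⟨j, hj, rfl⟩ := hA hz
    rw [mk_mem_internal] at hzB ⊢
    rw [← Ultrafilter.eventually_not] at hzB
    filter_upwards [hj, hzB] with k h1 h2
    exact ⟨h1, h2⟩
  refine (add_le_add h1 h2).trans ?_
  refine le_of_tendsto_of_tendsto' ((tendsto_ultralim ω _).add (tendsto_ultralim ω _))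
    (tendsto_ultralim ω _) fun k => ?_
  refine unif_add_le ?_ ?_
  · exact Set.disjoint_sdiff_right.mono_left Set.inter_subset_right
  · exact Set.union_subset Set.inter_subset_left Set.sdiff_subset

/-- The Loeb measure `u_ω`: the Carathéodory extension, to the `σ`-algebra generated by the
internal sets, of `internal A ↦ lim_{k → ω} |A k| / d k`. -/
def loebMeasure (d : ℕ → ℕ) (ω : Ultrafilter ℕ) : Measure (LoebSpace d ω) :=
  (OuterMeasure.ofFunction (loebContent d ω) (loebContent_empty d ω)).toMeasure <|
    MeasurableSpace.generateFrom_le fun s hs => by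
      obtain ⟨B, rfl⟩ := hs
      exact internal_caratheodory d ω B

/-- Countable saturation: a decreasing sequence of internal sets with empty intersection is
eventually empty. -/
theorem internal_saturation {d : ℕ → ℕ} {ω : Ultrafilter ℕ} (hd : ∀ k, 0 < d k)
    (hω : (ω : Filter ℕ) ≤ cofinite)
    (D : ℕ → ∀ k, Set (Fin (d k))) (hD : ∀ n k, D (n + 1) k ⊆ D n k)
    (hempty : ⋂ n, internal ω (D n) = ∅) :
    ∃ n, ∀ᶠ k in (ω : Filter ℕ), D n k = ∅ := by
  classical
  by_contra hcon
  push Not at hcon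
  have hne : ∀ n, ∀ᶠ k in (ω : Filter ℕ), (D n k).Nonempty := hcon
  have hanti : ∀ k, Antitone fun n => D n k := fun k => antitone_nat_of_succ_le fun n => hD n k
  have hpick : ∀ k, ∃ j : Fin (d k), ∀ n ≤ k, (D n k).Nonempty → j ∈ D n k := by
    intro k
    by_cases h0 : ∃ n, n ≤ k ∧ (D n k).Nonempty
    · obtain ⟨n0, hn0⟩ := h0
      obtain ⟨j, hj⟩ := (Nat.findGreatest_spec (P := fun n => (D n k).Nonempty) hn0.1 hn0.2)
      exact ⟨j, fun n hn hne => hanti k (Nat.le_findGreatest hn hne) hj⟩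
    · push Not at h0
      refine ⟨⟨0, hd k⟩, fun n hn hne => ?_⟩
      exact absurd (h0 n hn) hne.ne_empty
  choose j hj using hpick
  have : LoebSpace.mk ω j ∈ ⋂ n, internal ω (D n) := by
    refine Set.mem_iInter.2 fun n => mk_mem_internal.2 ?_
    have hn : ∀ᶠ k in (ω : Filter ℕ), n ≤ k :=
      hω (by rw [Nat.cofinite_eq_atTop]; exact eventually_ge_atTop n)
    filter_upwards [hn, hne n] with k h1 h2
    exact hj k n h1 h2
  rw [hempty] at this
  exact this

/-- The characterizing property of the Loeb measure. -/
theorem loebMeasure_internal {d : ℕ → ℕ} {ω : Ultrafilter ℕ} (hd : ∀ k, 0 < d k)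
    (hω : (ω : Filter ℕ) ≤ cofinite) (A : ∀ k, Set (Fin (d k))) :
    loebMeasure d ω (internal ω A) = ultralim ω fun k => unif (A k) := by
  have hmeas : MeasurableSet (internal ω A) :=
    MeasurableSpace.measurableSet_generateFrom ⟨A, rfl⟩
  rw [loebMeasure, toMeasure_apply _ _ hmeas]
  refine le_antisymm ?_ ?_
  · refine (OuterMeasure.ofFunction_le _).trans ?_
    exact iInf₂_le A Set.Subset.rfl
  · rw [OuterMeasure.ofFunction_apply]
    refine le_iInf₂ fun t ht => ?_
    refine ENNReal.le_of_forall_pos_le_add fun ε hε hfin => ?_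
    obtain ⟨δ, hδ, hδε⟩ := ENNReal.exists_pos_sum_of_countable'
      (ENNReal.coe_ne_zero.2 hε.ne') ℕ
    have hB : ∀ n, ∃ B : ∀ k, Set (Fin (d k)), t n ⊆ internal ω B ∧
        (ultralim ω fun k => unif (B k)) < loebContent d ω (t n) + δ n := by
      intro n
      have hlt : loebContent d ω (t n) < loebContent d ω (t n) + δ n :=
        ENNReal.lt_add_right (ENNReal.ne_top_of_tsum_ne_top hfin.ne n) (hδ n).ne'
      obtain ⟨B, hB⟩ := iInf_lt_iff.1 hlt
      obtain ⟨h1, h2⟩ := iInf_lt_iff.1 hB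
      exact ⟨B, h1, h2⟩
    choose B hBt hBlt using hB
    obtain ⟨N, hN⟩ := internal_saturation hd hω
      (fun n k => A k \ ⋃ i ∈ Finset.range n, B i k)
      (fun n k => Set.sdiff_subset_sdiff_right
        (Set.biUnion_subset_biUnion_left fun i hi =>
          Finset.range_subset_range.2 n.le_succ hi))
      (by
        refine Set.eq_empty_iff_forall_notMem.2 fun z hz => ?_
        have hz' := Set.mem_iInter.1 hz
        obtain ⟨j, hj, rfl⟩ := hz' 0
        have hzA : LoebSpace.mk ω j ∈ internal ω A := mk_mem_internal.2 (by
          filter_upwards [hj] with k hk using hk.1)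
        obtain ⟨n, hn⟩ := Set.mem_iUnion.1 (ht hzA)
        have h1 := mk_mem_internal.1 (hBt n hn)
        have h2 := mk_mem_internal.1 (hz' (n + 1))
        obtain ⟨k, hk1, hk2⟩ := (h1.and h2).exists
        exact hk2.2 (Set.mem_biUnion (Finset.mem_coe.2 (Finset.self_mem_range_succ n)) hk1))
    have hsub : ∀ (n k : ℕ), unif (⋃ i ∈ Finset.range n, B i k)
        ≤ ∑ i ∈ Finset.range n, unif (B i k) := by
      intro n k
      induction n with
      | zero => simp [unif]
      | succ n ih =>
        rw [Finset.sum_range_succ, Finset.range_add_one, Finset.set_biUnion_insert,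
          Set.union_comm]
        exact (unif_union_le _ _).trans (add_le_add ih le_rfl)
    have hle : (ultralim ω fun k => unif (A k))
        ≤ ∑ i ∈ Finset.range N, ultralim ω fun k => unif (B i k) := by
      refine le_of_tendsto_of_tendsto (tendsto_ultralim ω _)
        (tendsto_finsetSum _ fun i _ => tendsto_ultralim ω _) ?_
      filter_upwards [hN] with k hk
      exact (unif_mono (Set.sdiff_eq_empty.1 hk)).trans (hsub N k)
    calc (ultralim ω fun k => unif (A k))
        ≤ ∑ i ∈ Finset.range N, ultralim ω fun k => unif (B i k) := hle
      _ ≤ ∑ i ∈ Finset.range N, (loebContent d ω (t i) + δ i) :=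
          Finset.sum_le_sum fun i _ => (hBlt i).le
      _ ≤ ∑' i, (loebContent d ω (t i) + δ i) := ENNReal.sum_le_tsum _
      _ = ∑' i, loebContent d ω (t i) + ∑' i, δ i := ENNReal.tsum_add
      _ ≤ ∑' i, loebContent d ω (t i) + ε := add_le_add le_rfl hδε.le

theorem isProbabilityMeasure_loebMeasure {d : ℕ → ℕ} {ω : Ultrafilter ℕ} (hd : ∀ k, 0 < d k)
    (hω : (ω : Filter ℕ) ≤ cofinite) : IsProbabilityMeasure (loebMeasure d ω) := by
  constructor
  have h : (Set.univ : Set (LoebSpace d ω)) = internal ω fun _ => Set.univ := by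
    refine (Set.eq_univ_of_forall fun z => ?_).symm
    obtain ⟨j, rfl⟩ := Quotient.exists_rep z
    exact ⟨j, by simp, rfl⟩
  rw [h, loebMeasure_internal hd hω]
  refine ultralim_eq ?_
  refine tendsto_const_nhds.congr fun k => ?_
  have : (d k : ℝ≥0∞) ≠ 0 := by exact_mod_cast (hd k).ne'
  simp [unif, Set.ncard_univ, ENNReal.div_self this (ENNReal.natCast_ne_top _)]

/-! ### Permutations, sofic approximations and the centralizer -/

/-- The normalized Hamming distance on the symmetric group. -/
def hamm {n : ℕ} (p q : Equiv.Perm (Fin n)) : ℝ := (hammingDist ⇑p ⇑q : ℝ) / n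

theorem hamm_nonneg {n : ℕ} (p q : Equiv.Perm (Fin n)) : 0 ≤ hamm p q := by
  unfold hamm; positivity

theorem hamm_comm {n : ℕ} (p q : Equiv.Perm (Fin n)) : hamm p q = hamm q p := by
  rw [hamm, hamm, hammingDist_comm]

theorem hamm_triangle {n : ℕ} (p q r : Equiv.Perm (Fin n)) : hamm p r ≤ hamm p q + hamm q r := by
  rw [hamm, hamm, hamm, ← add_div]
  gcongr
  exact_mod_cast hammingDist_triangle _ _ _

theorem hamm_mul_left {n : ℕ} (r p q : Equiv.Perm (Fin n)) : hamm (r * p) (r * q) = hamm p q := by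
  have : hammingDist ⇑(r * p) ⇑(r * q) = hammingDist ⇑p ⇑q :=
    hammingDist_comp (fun _ => ⇑r) fun _ => r.injective
  rw [hamm, hamm, this]

theorem hamm_mul_right {n : ℕ} (r p q : Equiv.Perm (Fin n)) : hamm (p * r) (q * r) = hamm p q := by
  have : hammingDist ⇑(p * r) ⇑(q * r) = hammingDist ⇑p ⇑q := by
    unfold hammingDist
    refine Finset.card_bij (fun i _ => r i) (fun i hi => ?_) (fun i _ j _ h => r.injective h)
      fun j hj => ⟨r.symm j, ?_, by simp⟩
    · simp only [Finset.mem_filter, Finset.mem_univ, true_and] at hi ⊢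
      exact hi
    · simp only [Finset.mem_filter, Finset.mem_univ, true_and] at hj ⊢
      simpa using hj
  rw [hamm, hamm, this]

/-- A sofic approximation of the group `G`: maps `σ k : G → S_{d k}`, not assumed to be
homomorphisms, that are asymptotically multiplicative and asymptotically free. -/
structure IsSoficApproximation {G : Type*} [Group G] {d : ℕ → ℕ}
    (σ : ∀ k, G → Equiv.Perm (Fin (d k))) : Prop where
  mul : ∀ g h : G, Tendsto (fun k => hamm (σ k g * σ k h) (σ k (g * h))) atTop (𝓝 0)
  free : ∀ g h : G, g ≠ h → Tendsto (fun k => hamm (σ k g) (σ k h)) atTop (𝓝 1)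

/-- The sequences of permutations whose Hamming distance to the identity tends to `0` along
`ω`. -/
def hammNull (d : ℕ → ℕ) (ω : Ultrafilter ℕ) : Subgroup (∀ k, Equiv.Perm (Fin (d k))) where
  carrier := {p | Tendsto (fun k => hamm (p k) 1) ω (𝓝 0)}
  one_mem' := by simp [hamm]
  mul_mem' := by
    intro p q hp hq
    refine squeeze_zero (fun k => hamm_nonneg _ _) (fun k => ?_) (by simpa using hp.add hq)
    refine (hamm_triangle _ (p k * 1) _).trans ?_
    rw [Pi.mul_apply, hamm_mul_left, mul_one, add_comm]
  inv_mem' := by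
    intro p hp
    refine hp.congr fun k => ?_
    rw [Pi.inv_apply, ← hamm_mul_left (p k) (p k)⁻¹ 1, mul_inv_cancel, mul_one, hamm_comm]

instance (d : ℕ → ℕ) (ω : Ultrafilter ℕ) : (hammNull d ω).Normal where
  conj_mem := by
    intro p hp q
    refine hp.congr fun k => ?_
    rw [Pi.mul_apply, Pi.mul_apply, Pi.inv_apply, ← hamm_mul_right (q k) (q k * p k * (q k)⁻¹) 1,
      inv_mul_cancel_right, one_mul, ← hamm_mul_left (q k) (p k) 1, mul_one]

/-- The metric ultraproduct of the symmetric groups `S_{d k}`. -/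
abbrev PermUltraproduct (d : ℕ → ℕ) (ω : Ultrafilter ℕ) : Type :=
  (∀ k, Equiv.Perm (Fin (d k))) ⧸ hammNull d ω

/-- The centralizer of the image of `G` in the metric ultraproduct. -/
def soficCentralizer {G : Type*} {d : ℕ → ℕ} (σ : ∀ k, G → Equiv.Perm (Fin (d k)))
    (ω : Ultrafilter ℕ) : Subgroup (PermUltraproduct d ω) :=
  Subgroup.centralizer (Set.range fun g : G =>
    (QuotientGroup.mk fun k => σ k g : PermUltraproduct d ω))

/-- The transformation of the Loeb space induced by a sequence of permutations. -/
def permAct {d : ℕ → ℕ} (ω : Ultrafilter ℕ) (τ : ∀ k, Equiv.Perm (Fin (d k))) :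
    LoebSpace d ω → LoebSpace d ω :=
  Quotient.map (sa := productSetoid (ω : Filter ℕ) fun k => Fin (d k))
    (sb := productSetoid (ω : Filter ℕ) fun k => Fin (d k))
    (fun j k => τ k (j k)) fun _ _ h => h.mono fun k hk => congrArg (τ k) hk

/-- Ergodicity of the action of the centralizer on the Loeb space: a measurable set that is
invariant up to null sets is null or conull. Sequences of permutations that represent the same
element of the metric ultraproduct act in the same way up to null sets. -/
def CentralizerErgodic {G : Type*} {d : ℕ → ℕ} (σ : ∀ k, G → Equiv.Perm (Fin (d k)))
    (ω : Ultrafilter ℕ) : Prop :=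
  ∀ E : Set (LoebSpace d ω), MeasurableSet E →
    (∀ τ : ∀ k, Equiv.Perm (Fin (d k)),
      (QuotientGroup.mk τ : PermUltraproduct d ω) ∈ soficCentralizer σ ω →
        loebMeasure d ω ((permAct ω τ ⁻¹' E) ∆ E) = 0) →
    loebMeasure d ω E = 0 ∨ loebMeasure d ω Eᶜ = 0

/-! ### Generalized local weak* limits -/

section Limits

variable {G : Type*} {d : ℕ → ℕ}

/-- The function `(f k)_{k → ω}` on the Loeb space, `[j] ↦ lim_{k → ω} f k (j k)`. -/
def ultraFun {T : Type*} [TopologicalSpace T] (ω : Ultrafilter ℕ) (f : ∀ k, Fin (d k) → T) :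
    LoebSpace d ω → T :=
  Quotient.lift (s := productSetoid (ω : Filter ℕ) fun k => Fin (d k))
    (fun j => ultralim ω fun k => f k (j k))
    fun _ _ h => ultralim_congr ω <| h.mono fun k hk => congrArg (f k) hk

/-- The `j`-th marginal of a probability measure on `E ^ n`. -/
def marginal {E : Type*} [MeasurableSpace E] {n : ℕ} (μ : ProbabilityMeasure (Fin n → E))
    (j : Fin n) : ProbabilityMeasure E :=
  μ.map (measurable_pi_apply j).aemeasurable

/-- The sequence `μ k` of probability measures on `E ^ (d k)` is asymptotically supported, along
`ω`, on topological microstates of the action `act` of `G` on `E`. -/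
def AsympSupported {E : Type*} [TopologicalSpace E] [MeasurableSpace E] (act : G → E → E)
    (σ : ∀ k, G → Equiv.Perm (Fin (d k))) (ω : Ultrafilter ℕ)
    (μ : ∀ k, ProbabilityMeasure (Fin (d k) → E)) : Prop :=
  ∀ (g : G) (U : Set (E × E)), IsOpen U → Set.diagonal E ⊆ U → ∀ ε : ℝ, 0 < ε →
    Tendsto (fun k => μ k {φ | 1 - ε < (unif {j | (φ (σ k g j), act g (φ j)) ∈ U}).toReal})
      ω (𝓝 1)

/-- `μ k` converges locally weak* along `ω` to the law `m` on the space of probability measures: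
the averages `(1 / d k) ∑ j, δ_{μ k, j}` over the marginals converge weak* to `m`. -/
def LWTendsto {E : Type*} [TopologicalSpace E] [MeasurableSpace E] [OpensMeasurableSpace E]
    (ω : Ultrafilter ℕ) (μ : ∀ k, ProbabilityMeasure (Fin (d k) → E))
    (m : Measure (ProbabilityMeasure E)) : Prop :=
  ∀ f : C(ProbabilityMeasure E, ℝ),
    Tendsto (fun k => (∑ j, f (marginal (μ k) j)) / (d k : ℝ)) ω (𝓝 (∫ ν, f ν ∂m))

end Limits

/-! ### Entropy -/

section Entropy

variable {G : Type*} {d : ℕ → ℕ} {E : Type*} [MetricSpace E]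

/-- The pseudometric `ρ₂` on `E ^ n`. -/
def rho2 {n : ℕ} (φ ψ : Fin n → E) : ℝ := √((∑ j, dist (φ j) (ψ j) ^ 2) / n)

/-- The maps `φ : {1, …, n} → E` with `ρ₂ (g φ, φ ∘ s g) < δ` for all `g ∈ F`. -/
def MapSet {n : ℕ} (act : G → E → E) (F : Finset G) (δ : ℝ) (s : G → Equiv.Perm (Fin n)) :
    Set (Fin n → E) :=
  {φ | ∀ g ∈ F, rho2 (fun j => act g (φ j)) (φ ∘ s g) < δ}

/-- The `ε`-neighbourhood of a set in `E ^ n` for `ρ₂`. -/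
def nhd {n : ℕ} (ε : ℝ) (B : Set (Fin n → E)) : Set (Fin n → E) :=
  {φ | ∃ ψ ∈ B, rho2 φ ψ < ε}

/-- The minimal cardinality `S_ε (A, ρ₂)` of a subset of `A` whose `ε`-neighbourhood
contains `A`. -/
def coverNum {n : ℕ} (ε : ℝ) (A : Set (Fin n → E)) : ℕ∞ :=
  ⨅ (B : Set (Fin n → E)) (_ : B ⊆ A ∧ A ⊆ nhd ε B), B.encard

/-- The minimal cardinality `S_{ε,δ} (μ, ρ₂)` of a finite set whose `ε`-neighbourhood has
`μ`-measure at least `1 - δ`. -/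
def measCoverNum [MeasurableSpace E] {n : ℕ} (ε δ : ℝ) (μ : ProbabilityMeasure (Fin n → E)) :
    ℕ∞ :=
  ⨅ (B : Finset (Fin n → E)) (_ : 1 - δ ≤ (μ (nhd ε (B : Set (Fin n → E))) : ℝ)),
    (B.card : ℕ∞)

/-- `(1 / n) log N` in `[-∞, ∞]`, where `log 0 = -∞`. -/
def logRate (n : ℕ) (N : ℕ∞) : EReal := ENNReal.log (N : ℝ≥0∞) / ((n : ℝ) : EReal)

/-- The entropy `h ((μ k)_{k → ω})` of a sequence of measures. -/
def seqEntropy [MeasurableSpace E] (ω : Ultrafilter ℕ)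
    (μ : ∀ k, ProbabilityMeasure (Fin (d k) → E)) : EReal :=
  ⨆ (ε : ℝ) (_ : 0 < ε) (δ : ℝ) (_ : 0 < δ),
    ultralim ω fun k => logRate (d k) (measCoverNum ε δ (μ k))

/-- The local weak* entropy of a law `m` on the space of probability measures on `E`; it is `-∞`
if `m` is not a local weak* limit of measures that are asymptotically supported on topological
microstates. -/
def lwEntropy [MeasurableSpace E] [OpensMeasurableSpace E] (act : G → E → E)
    (σ : ∀ k, G → Equiv.Perm (Fin (d k))) (ω : Ultrafilter ℕ)
    (m : Measure (ProbabilityMeasure E)) : EReal :=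
  ⨆ (μ : ∀ k, ProbabilityMeasure (Fin (d k) → E))
    (_ : AsympSupported act σ ω μ ∧ LWTendsto ω μ m), seqEntropy ω μ

/-- The sofic topological entropy along `ω`. -/
def topEntropy (act : G → E → E) (σ : ∀ k, G → Equiv.Perm (Fin (d k))) (ω : Ultrafilter ℕ) :
    EReal :=
  ⨆ (ε : ℝ) (_ : 0 < ε), ⨅ (F : Finset G) (δ : ℝ) (_ : 0 < δ),
    ultralim ω fun k => logRate (d k) (coverNum ε (MapSet act F δ (σ k)))

end Entropy

/-! ### Closed subgroups and their Haar measures -/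

section Subgroups

variable {X : Type*} [Group X] [TopologicalSpace X]

instance [CompactSpace X] (K : ClosedSubgroup X) : CompactSpace K.toSubgroup :=
  isCompact_iff_compactSpace.mp K.isClosed'.isCompact

/-- A closed subgroup of a compact group as a nonempty compact set. -/
def toNonemptyCompacts [CompactSpace X] (K : ClosedSubgroup X) :
    TopologicalSpace.NonemptyCompacts X where
  carrier := K
  isCompact' := K.isClosed'.isCompact
  nonempty' := ⟨1, K.one_mem'⟩

/-- The space `Sub(X)` with the topology of the Hausdorff metric. -/
instance [CompactSpace X] : TopologicalSpace (ClosedSubgroup X) :=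
  .induced toNonemptyCompacts inferInstance

/-- The Borel `σ`-algebra of `Sub(X)`. -/
instance [CompactSpace X] : MeasurableSpace (ClosedSubgroup X) := borel _

instance [CompactSpace X] : BorelSpace (ClosedSubgroup X) := ⟨rfl⟩

/-- The Haar probability measure of a compact group. -/
def haarProb (H : Type*) [Group H] [TopologicalSpace H] [IsTopologicalGroup H] [CompactSpace H]
    [MeasurableSpace H] [BorelSpace H] : ProbabilityMeasure H :=
  ⟨Measure.haarMeasure ⊤, ⟨by
    have := Measure.haarMeasure_self (K₀ := (⊤ : TopologicalSpace.PositiveCompacts H))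
    simpa using this⟩⟩

/-- The Haar probability measure `m_K` of a closed subgroup, as a measure on `X`. -/
def haarOn [IsTopologicalGroup X] [CompactSpace X] [MeasurableSpace X] [BorelSpace X]
    (K : ClosedSubgroup X) : ProbabilityMeasure X :=
  (haarProb K.toSubgroup).map measurable_subtype_coe.aemeasurable

/-- The image `g K` of a closed subgroup under an automorphism that belongs to the action. -/
def translate {G : Type*} [Group G] [MulDistribMulAction G X] [ContinuousConstSMul G X] (g : G)
    (K : ClosedSubgroup X) : ClosedSubgroup X where
  toSubgroup := K.toSubgroup.map (MulDistribMulAction.toMonoidHom X g)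
  isClosed' := (Homeomorph.smul g).isClosedMap _ K.isClosed'

/-- A `G`-invariant random subgroup: a `G`-invariant Borel probability measure on `Sub(X)`. -/
structure IsInvariantRandomSubgroup (G : Type*) [Group G] [CompactSpace X]
    [MulDistribMulAction G X] [ContinuousConstSMul G X] (Y : Measure (ClosedSubgroup X)) :
    Prop where
  prob : IsProbabilityMeasure Y
  invariant : ∀ g : G, Y.map (translate g) = Y

/-! The map `K ↦ m_K` is continuous, so that laws on `Sub(X)` can be pushed forward under it. -/

theorem isOpen_subset [CompactSpace X] {U : Set X} (hU : IsOpen U) :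
    IsOpen {K : ClosedSubgroup X | (K : Set X) ⊆ U} :=
  (TopologicalSpace.NonemptyCompacts.isOpen_subsets_of_isOpen hU).preimage
    (continuous_induced_dom (f := toNonemptyCompacts))

theorem isOpen_inter_nonempty [CompactSpace X] {U : Set X} (hU : IsOpen U) :
    IsOpen {K : ClosedSubgroup X | ((K : Set X) ∩ U).Nonempty} :=
  (TopologicalSpace.NonemptyCompacts.isOpen_inter_nonempty_of_isOpen hU).preimage
    (continuous_induced_dom (f := toNonemptyCompacts))

theorem continuous_translate {G : Type*} [Group G] [CompactSpace X] [MulDistribMulAction G X]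
    [ContinuousConstSMul G X] (g : G) :
    Continuous (translate g : ClosedSubgroup X → ClosedSubgroup X) := by
  refine continuous_induced_rng.2 ?_
  refine continuous_induced_rng.2 ?_
  let : TopologicalSpace (Set X) := .vietoris X
  have := (continuous_const_smul (T := X) g).image_vietoris
  exact (this.comp TopologicalSpace.NonemptyCompacts.continuous_coe).comp
    (continuous_induced_dom (f := toNonemptyCompacts))

instance (H : Type*) [Group H] [TopologicalSpace H] [IsTopologicalGroup H] [CompactSpace H]
    [MeasurableSpace H] [BorelSpace H] : (haarProb H : Measure H).IsMulLeftInvariant :=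
  inferInstanceAs (Measure.haarMeasure ⊤ : Measure H).IsMulLeftInvariant

instance (H : Type*) [Group H] [TopologicalSpace H] [IsTopologicalGroup H] [CompactSpace H]
    [MeasurableSpace H] [BorelSpace H] : (haarProb H : Measure H).IsHaarMeasure :=
  inferInstanceAs (Measure.haarMeasure ⊤ : Measure H).IsHaarMeasure

theorem haarProb_map_mul_right (H : Type*) [Group H] [TopologicalSpace H] [IsTopologicalGroup H]
    [CompactSpace H] [MeasurableSpace H] [BorelSpace H] (h : H) :
    (haarProb H : Measure H).map (· * h) = haarProb H := by
  have : IsProbabilityMeasure ((haarProb H : Measure H).map (· * h)) :=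
    Measure.isProbabilityMeasure_map (measurable_mul_const h).aemeasurable
  exact Measure.isHaarMeasure_eq_of_isProbabilityMeasure _ _

theorem integral_haarOn [IsTopologicalGroup X] [CompactSpace X] [MeasurableSpace X] [BorelSpace X]
    (K : ClosedSubgroup X) (f : C(X, ℝ)) :
    ∫ x, f x ∂(haarOn K : Measure X) = ∫ x, f x ∂(haarProb K.toSubgroup : Measure K.toSubgroup) := by
  have h : (haarOn K : Measure X) = (haarProb K.toSubgroup : Measure K.toSubgroup).map
    (Subtype.val) := rfl
  rw [h]
  exact (MeasurableEmbedding.subtype_coe K.isClosed'.measurableSet).integral_map _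

theorem integral_haarOn_mul_left [IsTopologicalGroup X] [CompactSpace X] [MeasurableSpace X]
    [BorelSpace X] (K : ClosedSubgroup X) (f : C(X, ℝ)) {x : X} (hx : x ∈ K.toSubgroup) :
    ∫ y, f (x * y) ∂(haarOn K : Measure X) = ∫ y, f y ∂(haarOn K : Measure X) := by
  have h1 := integral_haarOn K (f.comp ⟨fun y => x * y, by fun_prop⟩)
  simp only [ContinuousMap.comp_apply, ContinuousMap.coe_mk] at h1
  rw [h1, integral_haarOn K f]
  exact integral_mul_left_eq_self (μ := (haarProb K.toSubgroup : Measure K.toSubgroup))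
    (fun y : K.toSubgroup => f y) ⟨x, hx⟩

theorem integrable_continuousMap {T : Type*} [TopologicalSpace T] [CompactSpace T]
    [MeasurableSpace T] [OpensMeasurableSpace T] (μ : Measure T) [IsFiniteMeasure μ]
    (f : C(T, ℝ)) : Integrable f μ :=
  (BoundedContinuousFunction.mkOfCompact f).integrable μ

theorem haarOn_abs_le [IsTopologicalGroup X] [CompactSpace X] [MeasurableSpace X]
    [BorelSpace X] (K : ClosedSubgroup X) (f : C(X, ℝ)) {ε : ℝ} (h : ∀ x ∈ K.toSubgroup, |f x| ≤ ε) :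
    |∫ y, f y ∂(haarOn K : Measure X)| ≤ ε := by
  rw [integral_haarOn]
  have := norm_integral_le_of_norm_le_const (μ := (haarProb K.toSubgroup : Measure K.toSubgroup))
    (f := fun y => f y) (C := ε) (.of_forall fun y => h y y.2)
  simpa using this

/-- The map `K ↦ m_K` is continuous. -/
theorem continuous_haarOn [IsTopologicalGroup X] [CompactSpace X] [T2Space X]
    [SecondCountableTopology X] [MeasurableSpace X] [BorelSpace X] [HasOuterApproxClosed X] :
    Continuous (haarOn : ClosedSubgroup X → ProbabilityMeasure X) := by
  rw [continuous_iff_ultrafilter]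
  intro K F hF
  obtain ⟨μ, hμ⟩ : ∃ μ, Tendsto haarOn (F : Filter (ClosedSubgroup X)) (𝓝 μ) :=
    ⟨(F.map haarOn).lim, (F.map haarOn).le_nhds_lim⟩
  have hint : ∀ f : C(X, ℝ), Tendsto (fun K' : ClosedSubgroup X => ∫ x, f x ∂(haarOn K' : Measure X)) F
      (𝓝 (∫ x, f x ∂(μ : Measure X))) := fun f =>
    ProbabilityMeasure.tendsto_iff_forall_integral_tendsto.1 hμ
      (BoundedContinuousFunction.mkOfCompact f)
  have hB : ∀ f : C(X, ℝ), (∀ x ∈ K.toSubgroup, f x = 0) → ∫ x, f x ∂(μ : Measure X) = 0 := by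
    intro f hf
    refine abs_eq_zero.1 (le_antisymm (le_of_forall_pos_le_add fun ε hε => ?_) (abs_nonneg _))
    rw [zero_add]
    refine le_of_tendsto (hint f).abs ?_
    have hU : IsOpen {x | |f x| < ε} := isOpen_lt (by fun_prop) continuous_const
    filter_upwards [hF ((isOpen_subset hU).mem_nhds fun x hx => by
      simp [hf x hx, hε])] with K' hK'
    exact haarOn_abs_le K' f fun x hx => (hK' hx).le
  have hA : ∀ f : C(X, ℝ), ∀ x ∈ K.toSubgroup,
      ∫ y, f (x * y) ∂(μ : Measure X) = ∫ y, f y ∂(μ : Measure X) := by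
    intro f x hx
    let c : C(X, C(X, ℝ)) := ContinuousMap.curry ⟨fun p : X × X => f (p.1 * p.2), by fun_prop⟩
    have hc : ∀ x y, c x y = f (x * y) := fun _ _ => rfl
    refine sub_eq_zero.1 (abs_eq_zero.1
      (le_antisymm (le_of_forall_pos_le_add fun ε hε => ?_) (abs_nonneg _)))
    rw [zero_add]
    refine le_of_tendsto ((hint (c x)).sub (hint f)).abs ?_
    have hU : IsOpen {x' | dist (c x) (c x') < ε} := isOpen_lt (by fun_prop) continuous_const
    filter_upwards [hF ((isOpen_inter_nonempty hU).mem_nhds ⟨x, hx, by simpa using hε⟩)]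
      with K' ⟨x', hx', hd⟩
    rw [← integral_haarOn_mul_left K' f hx']
    have : ∫ y, c x y ∂(haarOn K' : Measure X) - ∫ y, f (x' * y) ∂(haarOn K' : Measure X)
        = ∫ y, (c x - c x') y ∂(haarOn K' : Measure X) :=
      (integral_sub (integrable_continuousMap _ (c x)) (integrable_continuousMap _ (c x'))).symm
    rw [this]
    refine haarOn_abs_le K' _ fun y _ => ?_
    rw [ContinuousMap.sub_apply, ← Real.dist_eq]
    exact (ContinuousMap.dist_apply_le_dist y).trans (le_of_lt hd)
  have hμK : μ = haarOn K := by
    have key : ∀ f : C(X, ℝ), ∫ x, f x ∂(μ : Measure X) = ∫ x, f x ∂(haarOn K : Measure X) := by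
      intro f
      have hcont : Continuous fun p : K.toSubgroup × X => f ((p.1 : X) * p.2) := by fun_prop
      have hg : Continuous fun y : X =>
          ∫ x, f ((x : X) * y) ∂(haarProb K.toSubgroup : Measure K.toSubgroup) := by
        have := continuous_parametric_integral_of_continuous
          (μ := (haarProb K.toSubgroup : Measure K.toSubgroup))
          (f := fun (y : X) (x : K.toSubgroup) => f ((x : X) * y))
          (by fun_prop) isCompact_univ
        simpa using this
      have hswap := integral_integral_swap
        (μ := (haarProb K.toSubgroup : Measure K.toSubgroup)) (ν := (μ : Measure X))
        (f := fun x y => f ((x : X) * y)) (integrable_continuousMap _ ⟨_, hcont⟩)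
      have h1 : ∫ x : K.toSubgroup, ∫ y, f ((x : X) * y) ∂(μ : Measure X)
          ∂(haarProb K.toSubgroup : Measure K.toSubgroup) = ∫ y, f y ∂(μ : Measure X) := by
        simp [hA f _ (Subtype.prop _)]
      have h2 := hB (⟨_, hg⟩ - ContinuousMap.const X (∫ x, f x ∂(haarOn K : Measure X)))
        (fun y hy => by
          rw [ContinuousMap.sub_apply, ContinuousMap.const_apply, ContinuousMap.coe_mk,
            integral_haarOn, sub_eq_zero]
          have h3 := haarProb_map_mul_right K.toSubgroup ⟨y, hy⟩
          conv_rhs => rw [← h3]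
          rw [integral_map (by fun_prop) (by
            exact (show Continuous fun x : K.toSubgroup => f x by fun_prop).aestronglyMeasurable)]
          rfl)
      simp only [ContinuousMap.sub_apply, ContinuousMap.const_apply, ContinuousMap.coe_mk] at h2
      have hgi : Integrable (fun y : X =>
          ∫ x, f ((x : X) * y) ∂(haarProb K.toSubgroup : Measure K.toSubgroup)) (μ : Measure X) :=
        integrable_continuousMap _ ⟨_, hg⟩
      rw [integral_sub hgi (integrable_const _)] at h2
      simp only [integral_const, probReal_univ, smul_eq_mul, one_mul] at h2
      rw [← h1, hswap]
      linarith
    have hm : (μ : Measure X) = (haarOn K : Measure X) :=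
      ext_of_forall_integral_eq_of_IsFiniteMeasure fun f => key f.toContinuousMap
    exact Subtype.ext hm
  exact hμK ▸ hμ

/-- The map `K ↦ m_K` is measurable. -/
theorem measurable_haarOn [IsTopologicalGroup X] [CompactSpace X] [T2Space X]
    [SecondCountableTopology X] [MeasurableSpace X] [BorelSpace X] [HasOuterApproxClosed X] :
    Measurable (haarOn : ClosedSubgroup X → ProbabilityMeasure X) := by
  refine Measurable.subtype_mk (f := fun K : ClosedSubgroup X => (haarOn K : Measure X)) ?_
  refine Measurable.measure_of_isPiSystem_of_isProbabilityMeasure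
    (S := {F | IsClosed F}) ?_ isPiSystem_isClosed fun F hF => ?_
  · rw [← borel_eq_generateFrom_isClosed]
    exact BorelSpace.measurable_eq
  · refine measurable_of_tendsto_metrizable
      (f := fun n (K : ClosedSubgroup X) => ∫⁻ x, hF.apprSeq n x ∂(haarOn K : Measure X))
      (fun n => ?_) ?_
    · exact ((ProbabilityMeasure.continuous_lintegral_boundedContinuousFunction _).comp
        continuous_haarOn).measurable
    · refine tendsto_pi_nhds.2 fun K => ?_
      exact HasOuterApproxClosed.tendsto_lintegral_apprSeq hF _

end Subgroups

/-! ### The set `S_ω` and its maximal element -/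

section Max

variable {d : ℕ → ℕ}

/-- `L_ω`: the generalized local weak* limits of sequences of measures that are asymptotically
supported on topological microstates, as measurable maps on the Loeb space. -/
def LSet (G : Type*) (X : Type*) [TopologicalSpace X] [MeasurableSpace X]
    [OpensMeasurableSpace X] [SMul G X]
    (σ : ∀ k, G → Equiv.Perm (Fin (d k))) (ω : Ultrafilter ℕ) :
    Set (LoebSpace d ω → ProbabilityMeasure X) :=
  {Ψ | Measurable Ψ ∧ ∃ μ : ∀ k, ProbabilityMeasure (Fin (d k) → X),
    AsympSupported (fun (g : G) (x : X) => g • x) σ ω μ ∧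
      Ψ =ᵐ[loebMeasure d ω] ultraFun ω fun k => marginal (μ k)}

/-- `S_ω`: the measurable maps `Y` from the Loeb space to `Sub(X)` with `m_Y ∈ L_ω`. -/
def SSet (G : Type*) (X : Type*) [Group X] [TopologicalSpace X] [IsTopologicalGroup X]
    [CompactSpace X] [MeasurableSpace X] [BorelSpace X] [SMul G X]
    (σ : ∀ k, G → Equiv.Perm (Fin (d k))) (ω : Ultrafilter ℕ) :
    Set (LoebSpace d ω → ClosedSubgroup X) :=
  {Y | Measurable Y ∧ (fun z => haarOn (Y z)) ∈ LSet G X σ ω}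

/-- `Y` is the maximal (that is, greatest) element of `S_ω` for almost everywhere inclusion. -/
def IsMaximalElement (G : Type*) (X : Type*) [Group X] [TopologicalSpace X]
    [IsTopologicalGroup X] [CompactSpace X] [MeasurableSpace X] [BorelSpace X] [SMul G X]
    (σ : ∀ k, G → Equiv.Perm (Fin (d k))) (ω : Ultrafilter ℕ)
    (Y : LoebSpace d ω → ClosedSubgroup X) : Prop :=
  Y ∈ SSet G X σ ω ∧ ∀ Y' ∈ SSet G X σ ω, ∀ᵐ z ∂loebMeasure d ω, Y' z ≤ Y z

end Max

end LocalWeak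

end

open LocalWeak

noncomputable section

namespace LocalWeak

/-! ### Averages and domination on compact spaces -/

/-! The engine is that, for an algebraic action, measures asymptotically supported on microstates
are closed under midpoints and, because products of microstates are microstates, under convolution.
Asymptotic support is equivalent to the vanishing along `ω` of mean defects (`asympSupported_iff`),
quantities affine in the measure, so each closure property reduces to one inequality.

Greatest element. For a test function f and a measure ν on X, the L² norm of x ↦ ∫ f(xy) dν(y) does
not increase when ν is replaced by μ * ν, and strict convexity makes it drop at the midpoint of ν
and μ * ν unless the two functions agree. A weighted sum over a dense sequence of test functions
gives the functional J of `exists_strict_functional`. By saturation, the integral of J over the Loeb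
space has a minimizer among sequences asymptotically supported on microstates (`exists_absorbing`).
Mixing the minimizer with its convolution by any other such sequence gives a competitor, so the
limiting marginals satisfy ν_z * μ_z = μ_z almost everywhere. Taking ν = μ makes μ_z idempotent,
hence the Haar measure of its stabilizer Y(z). If m_{Y'} is another limit, absorption says that
m_{Y'(z)} is carried by the stabilizer of m_{Y(z)}, which is Y(z) (`ae_mem_stab`, `stab_haarOn`),
and therefore Y' ≤ Y.

Invariance. Limiting marginals are equivariant for the sofic approximation, which preserves the Loeb
measure, so the law of Y is G-invariant. Relabelling by an element of the centralizer preserves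
microstates; a greatest element is therefore fixed by the centralizer, and ergodicity makes it
constant.

Entropy. The bound by topological entropy holds because such measures concentrate on the sets of
approximately equivariant maps. For the converse, uniform measures on large separated sets of
microstates have the right entropy but uncontrolled marginals. Convolving them with measures that
represent Y repairs the marginals by absorption, and costs no entropy because right translation on X
is uniformly invertible (`mul_card_le_card`). When Y is a constant K, the measures concentrate near
K, and measurable almost-nearest-point maps move them onto K without loss of entropy
(`AsympSupported.exists_of_ae_eq_map`). -/

/-- On a compact space, a continuous function that is nonpositive on the zero set of a nonnegative
continuous function `a` is dominated by multiples of `a`, up to an arbitrarily small constant. -/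
theorem exists_le_add_mul {T : Type*} [TopologicalSpace T] [CompactSpace T] {a b : T → ℝ}
    (ha : Continuous a) (hb : Continuous b) (h0 : ∀ t, 0 ≤ a t) (h : ∀ t, a t = 0 → b t ≤ 0)
    {ε : ℝ} (hε : 0 < ε) : ∃ C, 0 ≤ C ∧ ∀ t, b t ≤ ε + C * a t := by
  have hK : IsCompact {t | ε ≤ b t} := (isClosed_le continuous_const hb).isCompact
  rcases Set.eq_empty_or_nonempty {t | ε ≤ b t} with he | hne
  · refine ⟨0, le_rfl, fun t => ?_⟩
    have : t ∉ {t | ε ≤ b t} := by simp [he]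
    simp only [Set.mem_ofPred_eq, not_le] at this
    linarith
  · obtain ⟨t0, ht0, hmin⟩ := hK.exists_isMinOn hne ha.continuousOn
    obtain ⟨t1, ht1, hmax⟩ := hK.exists_isMaxOn hne hb.continuousOn
    have hpos : 0 < a t0 := by
      refine lt_of_le_of_ne (h0 t0) fun h1 => ?_
      have := h t0 h1.symm
      have h2 : ε ≤ b t0 := ht0
      linarith
    have hb1 : ε ≤ b t1 := ht1
    have hbt : 0 ≤ b t1 := hε.le.trans hb1
    -- On the compact set where b ≥ ε, the constant is the maximum of b over the minimum of a, which
    -- is positive there; off that set ε alone suffices.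
    refine ⟨b t1 / a t0, by positivity, fun t => ?_⟩
    by_cases ht : ε ≤ b t
    · have h1 : a t0 ≤ a t := hmin ht
      have h2 : b t ≤ b t1 := hmax ht
      have h3 : b t1 = b t1 / a t0 * a t0 := by field_simp
      have h4 : b t1 / a t0 * a t0 ≤ b t1 / a t0 * a t := by gcongr
      linarith
    · have : 0 ≤ b t1 / a t0 * a t := mul_nonneg (by positivity) (h0 t)
      linarith

/-- The average of a real function on `{1, …, n}`. -/
def avg {n : ℕ} (f : Fin n → ℝ) : ℝ := (∑ j, f j) / n

theorem avg_mono {n : ℕ} {f g : Fin n → ℝ} (h : ∀ j, f j ≤ g j) : avg f ≤ avg g := by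
  unfold avg
  gcongr with j
  exact h j

theorem avg_nonneg {n : ℕ} {f : Fin n → ℝ} (h : ∀ j, 0 ≤ f j) : 0 ≤ avg f :=
  div_nonneg (Finset.sum_nonneg fun j _ => h j) (Nat.cast_nonneg n)

theorem avg_add {n : ℕ} (f g : Fin n → ℝ) : avg (fun j => f j + g j) = avg f + avg g := by
  rw [avg, Finset.sum_add_distrib, add_div]; rfl

theorem avg_const_mul {n : ℕ} (c : ℝ) (f : Fin n → ℝ) : avg (fun j => c * f j) = c * avg f := by
  rw [avg, ← Finset.mul_sum, mul_div_assoc]; rfl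

theorem avg_const {n : ℕ} (hn : 0 < n) (c : ℝ) : avg (fun _ : Fin n => c) = c := by
  have : (n : ℝ) ≠ 0 := by positivity
  simp [avg, this]

theorem avg_comp_perm {n : ℕ} (τ : Equiv.Perm (Fin n)) (f : Fin n → ℝ) :
    avg (fun j => f (τ j)) = avg f := by
  rw [avg, Equiv.sum_comp τ f]; rfl

theorem avg_sum {n : ℕ} {ι : Type*} (s : Finset ι) (f : ι → Fin n → ℝ) :
    avg (fun j => ∑ i ∈ s, f i j) = ∑ i ∈ s, avg (f i) := by
  simp only [avg]
  rw [Finset.sum_comm, Finset.sum_div]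

theorem avg_indicator {n : ℕ} (A : Set (Fin n)) :
    avg (A.indicator fun _ => 1) = (unif A).toReal := by
  classical
  rw [avg, unif, ENNReal.toReal_div, ENNReal.toReal_natCast, ENNReal.toReal_natCast]
  congr 1
  rw [Set.ncard_eq_toFinset_card', Finset.sum_indicator_eq_sum_filter]
  simp [Set.toFinset]

/-! ### Integration on the Loeb space -/

section Loeb

variable {d : ℕ → ℕ} {ω : Ultrafilter ℕ}

theorem LoebSpace.exists_mk (z : LoebSpace d ω) : ∃ j : ∀ k, Fin (d k), LoebSpace.mk ω j = z :=
  Quotient.exists_rep z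

theorem measurableSet_internal (A : ∀ k, Set (Fin (d k))) : MeasurableSet (internal ω A) :=
  MeasurableSpace.measurableSet_generateFrom ⟨A, rfl⟩

/-- `H` is the ultralimit of the real functions `h k`. -/
def IsUltralimit (ω : Ultrafilter ℕ) (h : ∀ k, Fin (d k) → ℝ) (H : LoebSpace d ω → ℝ) : Prop :=
  ∀ j : ∀ k, Fin (d k), Tendsto (fun k => h k (j k)) ω (𝓝 (H (LoebSpace.mk ω j)))

/-- A strict inequality along `ω` survives only weakly in the limit, so superlevel sets are
countable unions of internal sets at rational thresholds strictly above t. -/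
theorem IsUltralimit.measurable {h : ∀ k, Fin (d k) → ℝ} {H : LoebSpace d ω → ℝ}
    (hH : IsUltralimit ω h H) : Measurable H := by
  refine measurable_of_Ioi fun t => ?_
  have : H ⁻¹' Set.Ioi t = ⋃ q : {q : ℚ // t < q}, internal ω fun k => {j | (q : ℝ) < h k j} := by
    ext z
    obtain ⟨j, rfl⟩ := z.exists_mk
    simp only [Set.mem_preimage, Set.mem_Ioi, Set.mem_iUnion, mk_mem_internal, Set.mem_ofPred_eq]
    constructor
    · intro ht
      obtain ⟨q, h1, h2⟩ := exists_rat_btwn ht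
      exact ⟨⟨q, h1⟩, (hH j).eventually_const_lt h2⟩
    · rintro ⟨⟨q, hq⟩, h1⟩
      exact hq.trans_le (ge_of_tendsto (hH j) (h1.mono fun k hk => hk.le))
  rw [this]
  exact MeasurableSet.iUnion fun q => measurableSet_internal _

/-- The sum counts the levels -M + iε below x, which is ⌈(x + M)/ε⌉, and the bound on N makes enough
levels available. Superlevel sets correspond to internal sets, so this step function can be
transported to the Loeb space. -/
theorem step_approx {M ε x : ℝ} (hε : 0 < ε) {N : ℕ} (hN : 2 * M ≤ N * ε) (hx : |x| ≤ M) :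
    x ≤ -M + ε * ∑ i ∈ Finset.range N, (Set.Ioi (-M + i * ε)).indicator (fun _ => (1 : ℝ)) x ∧
    -M + ε * ∑ i ∈ Finset.range N, (Set.Ioi (-M + i * ε)).indicator (fun _ => (1 : ℝ)) x
      ≤ x + ε := by
  classical
  obtain ⟨h1, h2⟩ := abs_le.1 hx
  have hy : 0 ≤ (x + M) / ε := div_nonneg (by linarith) hε.le
  have hyN : ⌈(x + M) / ε⌉₊ ≤ N := Nat.ceil_le.2 (by rw [div_le_iff₀ hε]; linarith)
  have hsum : ∑ i ∈ Finset.range N, (Set.Ioi (-M + i * ε)).indicator (fun _ => (1 : ℝ)) x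
      = ⌈(x + M) / ε⌉₊ := by
    have : ∀ i ∈ Finset.range N, (Set.Ioi (-M + i * ε)).indicator (fun _ => (1 : ℝ)) x
        = if i < ⌈(x + M) / ε⌉₊ then 1 else 0 := by
      intro i _
      rw [Set.indicator_apply]
      refine if_congr ?_ rfl rfl
      rw [Nat.lt_ceil, lt_div_iff₀ hε, Set.mem_Ioi]
      constructor <;> intro h <;> linarith
    rw [Finset.sum_congr rfl this, Finset.sum_ite, Finset.sum_const_zero, add_zero,
      Finset.sum_const, nsmul_eq_mul, mul_one]
    congr 1
    have : (Finset.range N).filter (· < ⌈(x + M) / ε⌉₊) = Finset.range ⌈(x + M) / ε⌉₊ := by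
      ext i
      simp only [Finset.mem_filter, Finset.mem_range]
      omega
    rw [this, Finset.card_range]
  rw [hsum]
  have h3 := Nat.le_ceil ((x + M) / ε)
  have h4 := Nat.ceil_lt_add_one hy
  have h5 : ε * ((x + M) / ε) = x + M := by field_simp
  constructor
  · have := mul_le_mul_of_nonneg_left h3 hε.le
    linarith
  · have := mul_le_mul_of_nonneg_left h4.le hε.le
    linarith

/-- The integral of an ultralimit of uniformly bounded functions is the limit of the averages. -/
theorem IsUltralimit.tendsto_avg (hd : ∀ k, 0 < d k) (hω : (ω : Filter ℕ) ≤ cofinite)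
    {h : ∀ k, Fin (d k) → ℝ} {H : LoebSpace d ω → ℝ} (hH : IsUltralimit ω h H) {M : ℝ}
    (hM : ∀ k j, |h k j| ≤ M) :
    Tendsto (fun k => avg (h k)) ω (𝓝 (∫ z, H z ∂loebMeasure d ω)) := by
  have := isProbabilityMeasure_loebMeasure hd hω
  rw [Metric.tendsto_nhds]
  intro δ hδ
  -- One ε each for the step approximation of `h k`, that of `H`, and the convergence of the
  -- averages of the steps.
  obtain ⟨ε, hε, hεδ⟩ : ∃ ε : ℝ, 0 < ε ∧ 3 * ε < δ := ⟨δ / 4, by positivity, by linarith⟩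
  obtain ⟨N, hN⟩ := exists_nat_ge (2 * M / ε)
  rw [div_le_iff₀ hε] at hN
  let A : ℕ → ∀ k, Set (Fin (d k)) := fun i k => {j | -M + i * ε < h k j}
  -- `q` and `s` are the same step function at finite level and on the Loeb space. Each indicator is
  -- decided for `ω`-almost every k, so they agree along any sequence of points, and their means are
  -- governed by the measures of internal sets.
  let q : ∀ k, Fin (d k) → ℝ := fun k j =>
    -M + ε * ∑ i ∈ Finset.range N, (A i k).indicator (fun _ => (1 : ℝ)) j
  let s : LoebSpace d ω → ℝ := fun z =>
    -M + ε * ∑ i ∈ Finset.range N, (internal ω (A i)).indicator (fun _ => (1 : ℝ)) z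
  have hq : ∀ k j, h k j ≤ q k j ∧ q k j ≤ h k j + ε := fun k j =>
    step_approx hε hN (hM k j)
  have hqs : ∀ j : ∀ k, Fin (d k), ∀ᶠ k in (ω : Filter ℕ), q k (j k) = s (LoebSpace.mk ω j) := by
    intro j
    have : ∀ᶠ k in (ω : Filter ℕ), ∀ i ∈ Finset.range N,
        (A i k).indicator (fun _ => (1 : ℝ)) (j k)
          = (internal ω (A i)).indicator (fun _ => (1 : ℝ)) (LoebSpace.mk ω j) := by
      rw [eventually_all_finset]
      intro i _
      by_cases hi : ∀ᶠ k in (ω : Filter ℕ), j k ∈ A i k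
      · rw [Set.indicator_of_mem (mk_mem_internal.2 hi)]
        exact hi.mono fun k hk => Set.indicator_of_mem hk _
      · rw [Set.indicator_of_notMem (fun h => hi (mk_mem_internal.1 h))]
        exact (Ultrafilter.eventually_not.2 hi).mono fun k hk => Set.indicator_of_notMem hk _
    refine this.mono fun k hk => ?_
    simp only [q, s]
    rw [Finset.sum_congr rfl hk]
  have hs : ∀ z, H z ≤ s z ∧ s z ≤ H z + ε := by
    intro z
    obtain ⟨j, rfl⟩ := z.exists_mk
    exact ⟨le_of_tendsto (hH j) ((hqs j).mono fun k hk => hk ▸ (hq k (j k)).1),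
      ge_of_tendsto ((hH j).add_const ε) ((hqs j).mono fun k hk => hk ▸ (hq k (j k)).2)⟩
  have hindint : ∀ i, Integrable ((internal ω (A i)).indicator fun _ => (1 : ℝ))
      (loebMeasure d ω) := fun i =>
    (integrable_const (1 : ℝ)).indicator (measurableSet_internal _)
  have hsint : Integrable s (loebMeasure d ω) :=
    (integrable_const _).add ((integrable_finsetSum _ fun i _ => hindint i).const_mul ε)
  have hsval : ∫ z, s z ∂loebMeasure d ω
      = -M + ε * ∑ i ∈ Finset.range N, (ultralim ω fun k => unif (A i k)).toReal := by
    simp only [s]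
    rw [integral_add (integrable_const _)
      ((integrable_finsetSum _ fun i _ => hindint i).const_mul ε), integral_const_mul,
      integral_finsetSum _ fun i _ => hindint i]
    simp only [integral_const, probReal_univ, smul_eq_mul, one_mul]
    congr 2
    refine Finset.sum_congr rfl fun i _ => ?_
    rw [integral_indicator_const _ (measurableSet_internal _), measureReal_def,
      loebMeasure_internal hd hω, smul_eq_mul, mul_one]
  have hqlim : Tendsto (fun k => avg (q k)) ω (𝓝 (∫ z, s z ∂loebMeasure d ω)) := by
    rw [hsval]
    have h1 : ∀ k, avg (q k) = -M + ε * ∑ i ∈ Finset.range N, (unif (A i k)).toReal := by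
      intro k
      simp only [q]
      rw [avg_add, avg_const (hd k), avg_const_mul, avg_sum]
      simp only [← avg_indicator]
    simp only [h1]
    refine ((tendsto_finsetSum _ fun i _ => ?_).const_mul ε).const_add (-M)
    refine (ENNReal.tendsto_toReal ?_).comp (tendsto_ultralim ω fun k => unif (A i k))
    rw [← loebMeasure_internal hd hω]
    exact measure_ne_top _ _
  have hHb : ∀ z, |H z| ≤ M := by
    intro z
    obtain ⟨j, rfl⟩ := z.exists_mk
    exact le_of_tendsto (hH j).abs (.of_forall fun k => hM k (j k))
  have hHint : Integrable H (loebMeasure d ω) :=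
    (integrable_const M).mono' hH.measurable.aestronglyMeasurable (.of_forall hHb)
  have h1 : ∫ z, H z ∂loebMeasure d ω ≤ ∫ z, s z ∂loebMeasure d ω :=
    integral_mono hHint hsint fun z => (hs z).1
  have h2 : ∫ z, s z ∂loebMeasure d ω ≤ ∫ z, H z ∂loebMeasure d ω + ε := by
    have := integral_mono hsint (hHint.add (integrable_const ε)) fun z => (hs z).2
    rwa [integral_add' hHint (integrable_const ε), integral_const, probReal_univ, one_smul] at this
  filter_upwards [Metric.tendsto_nhds.1 hqlim ε hε] with k hk
  have h3 : avg (h k) ≤ avg (q k) := avg_mono fun j => (hq k j).1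
  have h4 : avg (q k) ≤ avg (h k) + ε := by
    have := avg_mono fun j => (hq k j).2
    rwa [avg_add (h k), avg_const (hd k)] at this
  rw [Real.dist_eq, abs_lt] at hk ⊢
  constructor <;> linarith [hk.1, hk.2]

/-! ### Ultralimits of maps into compact spaces -/

section UltraFun

variable {T : Type*} [TopologicalSpace T] [CompactSpace T]

theorem tendsto_ultraFun (f : ∀ k, Fin (d k) → T) (j : ∀ k, Fin (d k)) :
    Tendsto (fun k => f k (j k)) ω (𝓝 (ultraFun ω f (LoebSpace.mk ω j))) :=
  tendsto_ultralim ω _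

theorem ultraFun_comp {S : Type*} [TopologicalSpace S] [CompactSpace S] [T2Space S] {g : T → S}
    (hg : Continuous g) (f : ∀ k, Fin (d k) → T) (z : LoebSpace d ω) :
    ultraFun ω (fun k j => g (f k j)) z = g (ultraFun ω f z) := by
  obtain ⟨j, rfl⟩ := z.exists_mk
  exact ultralim_eq ((hg.tendsto _).comp (tendsto_ultraFun f j))

theorem ultraFun_prodMk {S : Type*} [TopologicalSpace S] [CompactSpace S] [T2Space S] [T2Space T]
    (f : ∀ k, Fin (d k) → T) (g : ∀ k, Fin (d k) → S) (z : LoebSpace d ω) :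
    ultraFun ω (fun k j => (f k j, g k j)) z = (ultraFun ω f z, ultraFun ω g z) := by
  obtain ⟨j, rfl⟩ := z.exists_mk
  exact ultralim_eq ((tendsto_ultraFun f j).prodMk_nhds (tendsto_ultraFun g j))

theorem isUltralimit_comp {g : T → ℝ} (hg : Continuous g) (f : ∀ k, Fin (d k) → T) :
    IsUltralimit ω (fun k j => g (f k j)) fun z => g (ultraFun ω f z) :=
  fun j => (hg.tendsto _).comp (tendsto_ultraFun f j)

theorem measurable_comp_ultraFun {g : T → ℝ} (hg : Continuous g) (f : ∀ k, Fin (d k) → T) :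
    Measurable fun z => g (ultraFun ω f z) :=
  (isUltralimit_comp hg f).measurable

theorem exists_abs_le {g : T → ℝ} (hg : Continuous g) : ∃ M, ∀ t, |g t| ≤ M := by
  obtain ⟨M, hM⟩ := (isCompact_univ (X := T)).exists_bound_of_continuousOn hg.continuousOn
  exact ⟨M, fun t => hM t (Set.mem_univ t)⟩

theorem tendsto_avg_ultraFun (hd : ∀ k, 0 < d k) (hω : (ω : Filter ℕ) ≤ cofinite) {g : T → ℝ}
    (hg : Continuous g) (f : ∀ k, Fin (d k) → T) :
    Tendsto (fun k => avg fun j => g (f k j)) ω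
      (𝓝 (∫ z, g (ultraFun ω f z) ∂loebMeasure d ω)) := by
  obtain ⟨M, hM⟩ := exists_abs_le hg
  exact (isUltralimit_comp hg f).tendsto_avg hd hω fun k j => hM _

/-- A nonnegative continuous function vanishes almost everywhere along an ultralimit if and only
if its averages tend to `0`. -/
theorem ae_ultraFun_eq_zero_iff (hd : ∀ k, 0 < d k) (hω : (ω : Filter ℕ) ≤ cofinite) {g : T → ℝ}
    (hg : Continuous g) (h0 : ∀ t, 0 ≤ g t) (f : ∀ k, Fin (d k) → T) :
    (∀ᵐ z ∂loebMeasure d ω, g (ultraFun ω f z) = 0) ↔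
      Tendsto (fun k => avg fun j => g (f k j)) ω (𝓝 0) := by
  have := isProbabilityMeasure_loebMeasure hd hω
  have h1 := tendsto_avg_ultraFun hd hω hg f
  obtain ⟨M, hM⟩ := exists_abs_le hg
  have hint : Integrable (fun z => g (ultraFun ω f z)) (loebMeasure d ω) :=
    (integrable_const M).mono' (measurable_comp_ultraFun hg f).aestronglyMeasurable
      (.of_forall fun z => hM _)
  have h2 := integral_eq_zero_iff_of_nonneg (fun z => h0 _) hint
  constructor
  · intro h
    rwa [h2.2 h] at h1
  · intro h
    exact h2.1 (tendsto_nhds_unique h1 h)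

end UltraFun

/-! ### Permutations of the Loeb space -/

theorem permAct_mk (τ : ∀ k, Equiv.Perm (Fin (d k))) (j : ∀ k, Fin (d k)) :
    permAct ω τ (LoebSpace.mk ω j) = LoebSpace.mk ω fun k => τ k (j k) := rfl

theorem ultraFun_permAct {T : Type*} [TopologicalSpace T] (τ : ∀ k, Equiv.Perm (Fin (d k)))
    (f : ∀ k, Fin (d k) → T) (z : LoebSpace d ω) :
    ultraFun ω f (permAct ω τ z) = ultraFun ω (fun k j => f k (τ k j)) z := by
  obtain ⟨j, rfl⟩ := z.exists_mk
  rfl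

theorem permAct_preimage_internal (τ : ∀ k, Equiv.Perm (Fin (d k))) (A : ∀ k, Set (Fin (d k))) :
    permAct ω τ ⁻¹' internal ω A = internal ω fun k => τ k ⁻¹' A k := by
  ext z
  obtain ⟨j, rfl⟩ := z.exists_mk
  rw [Set.mem_preimage, permAct_mk, mk_mem_internal, mk_mem_internal]
  rfl

theorem internal_inter (A B : ∀ k, Set (Fin (d k))) :
    internal ω A ∩ internal ω B = internal ω fun k => A k ∩ B k := by
  ext z
  obtain ⟨j, rfl⟩ := z.exists_mk
  simp only [Set.mem_inter_iff, mk_mem_internal, eventually_and]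

theorem measurePreserving_permAct (hd : ∀ k, 0 < d k) (hω : (ω : Filter ℕ) ≤ cofinite)
    (τ : ∀ k, Equiv.Perm (Fin (d k))) :
    MeasurePreserving (permAct ω τ) (loebMeasure d ω) (loebMeasure d ω) := by
  have := isProbabilityMeasure_loebMeasure hd hω
  have hm : Measurable (permAct ω τ) := by
    refine measurable_generateFrom ?_
    rintro _ ⟨A, rfl⟩
    rw [permAct_preimage_internal]
    exact measurableSet_internal _
  refine ⟨hm, ?_⟩
  have := Measure.isProbabilityMeasure_map hm.aemeasurable (μ := loebMeasure d ω)
  refine ext_of_generate_finite _ rfl ?_ ?_ (by simp)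
  · rintro _ ⟨A, rfl⟩ _ ⟨B, rfl⟩ _
    exact ⟨_, (internal_inter A B).symm⟩
  · rintro _ ⟨A, rfl⟩
    rw [Measure.map_apply hm (measurableSet_internal _), permAct_preimage_internal,
      loebMeasure_internal hd hω, loebMeasure_internal hd hω]
    congr 1
    ext k
    rw [unif, unif, ← Set.ncard_image_of_injective _ (τ k).injective,
      Set.image_preimage_eq _ (τ k).surjective]

/-- Countable saturation: decreasing internal conditions that are separately satisfiable for
`ω`-almost every `k` are simultaneously satisfiable. -/
theorem exists_saturated (hω : (ω : Filter ℕ) ≤ cofinite) {M : ℕ → Type*} [∀ k, Nonempty (M k)]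
    (R : ℕ → ∀ k, Set (M k)) (hanti : ∀ k, Antitone fun n => R n k)
    (hne : ∀ n, ∀ᶠ k in (ω : Filter ℕ), (R n k).Nonempty) :
    ∃ x : ∀ k, M k, ∀ n, ∀ᶠ k in (ω : Filter ℕ), x k ∈ R n k := by
  classical
  -- Diagonal choice: at stage k, satisfy the strongest satisfiable condition of index at most k.
  -- Freeness of `ω` makes any fixed n at most k eventually.
  have hpick : ∀ k, ∃ x : M k, ∀ n ≤ k, (R n k).Nonempty → x ∈ R n k := by
    intro k
    by_cases h0 : ∃ n, n ≤ k ∧ (R n k).Nonempty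
    · obtain ⟨n0, hn0⟩ := h0
      obtain ⟨x, hx⟩ := Nat.findGreatest_spec (P := fun n => (R n k).Nonempty) hn0.1 hn0.2
      exact ⟨x, fun n hn hne => hanti k (Nat.le_findGreatest hn hne) hx⟩
    · push Not at h0
      exact ⟨Classical.arbitrary _, fun n hn hne => absurd (h0 n hn) hne.ne_empty⟩
  choose x hx using hpick
  refine ⟨x, fun n => ?_⟩
  have hn : ∀ᶠ k in (ω : Filter ℕ), n ≤ k :=
    hω (by rw [Nat.cofinite_eq_atTop]; exact eventually_ge_atTop n)
  filter_upwards [hn, hne n] with k h1 h2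
  exact hx k n h1 h2

end Loeb

/-! ### The space of probability measures on a compact metrizable space -/

section Prob

theorem probabilityMeasure_ext {X : Type*} [MetricSpace X] [MeasurableSpace X] [BorelSpace X]
    {μ ν : ProbabilityMeasure X}
    (h : ∀ f : C(X, ℝ), ∫ x, f x ∂(μ : Measure X) = ∫ x, f x ∂(ν : Measure X)) : μ = ν :=
  ProbabilityMeasure.toMeasure_injective
    (ext_of_forall_integral_eq_of_IsFiniteMeasure fun f => h f.toContinuousMap)

variable {X : Type*} [MetricSpace X] [CompactSpace X] [MeasurableSpace X] [BorelSpace X]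

theorem continuous_integral (f : C(X, ℝ)) :
    Continuous fun μ : ProbabilityMeasure X => ∫ x, f x ∂(μ : Measure X) :=
  ProbabilityMeasure.continuous_integral_continuousMap f

/-- A dense sequence of continuous functions. -/
def testFun (X : Type*) [MetricSpace X] [CompactSpace X] : ℕ → C(X, ℝ) :=
  TopologicalSpace.denseSeq C(X, ℝ)

theorem continuous_integral_left (μ : ProbabilityMeasure X) :
    Continuous fun f : C(X, ℝ) => ∫ x, f x ∂(μ : Measure X) := by
  refine LipschitzWith.continuous (K := 1) (LipschitzWith.of_dist_le_mul fun f g => ?_)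
  rw [Real.dist_eq, ← integral_sub (integrable_continuousMap _ f) (integrable_continuousMap _ g)]
  have := norm_integral_le_of_norm_le_const (μ := (μ : Measure X)) (f := fun x => f x - g x)
    (C := dist f g) (.of_forall fun x => by
      rw [← dist_eq_norm]; exact ContinuousMap.dist_apply_le_dist x)
  simpa using this

theorem probabilityMeasure_ext_testFun {μ ν : ProbabilityMeasure X}
    (h : ∀ n, ∫ x, testFun X n x ∂(μ : Measure X) = ∫ x, testFun X n x ∂(ν : Measure X)) :
    μ = ν := by
  refine probabilityMeasure_ext fun f => ?_
  exact congrFun ((TopologicalSpace.denseRange_denseSeq C(X, ℝ)).equalizer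
    (continuous_integral_left μ) (continuous_integral_left ν) (funext h)) f

/-- Indicators of closed sets are limits of continuous functions, and closed sets form a π-system
generating the Borel sets. -/
theorem measurable_of_integral {Z : Type*} [MeasurableSpace Z] {Ψ : Z → ProbabilityMeasure X}
    (h : ∀ f : C(X, ℝ), Measurable fun z => ∫ x, f x ∂(Ψ z : Measure X)) : Measurable Ψ := by
  refine Measurable.subtype_mk (f := fun z => (Ψ z : Measure X)) ?_
  refine Measurable.measure_of_isPiSystem_of_isProbabilityMeasure
    (S := {F | IsClosed F}) ?_ isPiSystem_isClosed fun F hF => ?_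
  · rw [← borel_eq_generateFrom_isClosed]
    exact BorelSpace.measurable_eq
  · refine measurable_of_tendsto_metrizable
      (f := fun n z => ∫⁻ x, hF.apprSeq n x ∂(Ψ z : Measure X)) (fun n => ?_) ?_
    · have h1 : (fun z => ∫⁻ x, hF.apprSeq n x ∂(Ψ z : Measure X))
          = fun z => ENNReal.ofReal (∫ x, (hF.apprSeq n x : ℝ) ∂(Ψ z : Measure X)) := by
        ext z
        rw [ofReal_integral_eq_lintegral_ofReal]
        · simp
        · exact integrable_continuousMap _
            (⟨fun x => (hF.apprSeq n x : ℝ), by fun_prop⟩ : C(X, ℝ))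
        · exact .of_forall fun x => NNReal.coe_nonneg _
      rw [h1]
      exact (h ⟨fun x => (hF.apprSeq n x : ℝ), by fun_prop⟩).ennreal_ofReal
    · refine tendsto_pi_nhds.2 fun z => ?_
      exact HasOuterApproxClosed.tendsto_lintegral_apprSeq hF _

/-- A continuous injection from a compact space to a Hausdorff one. It places the probability
measures in a countable product of lines, which yields second countability and the identification of
the Borel σ-algebra. -/
theorem isClosedEmbedding_testFun : IsClosedEmbedding
    fun (μ : ProbabilityMeasure X) (n : ℕ) => ∫ x, testFun X n x ∂(μ : Measure X) :=
  Continuous.isClosedEmbedding (continuous_pi fun _ => continuous_integral _)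
    fun _ _ h => probabilityMeasure_ext_testFun fun n => congrFun h n

theorem measurable_integral (f : C(X, ℝ)) :
    Measurable fun μ : ProbabilityMeasure X => ∫ x, f x ∂(μ : Measure X) := by
  simp only [integral_eq_lintegral_pos_part_sub_lintegral_neg_part
    (integrable_continuousMap _ f)]
  have h : ∀ g : X → ℝ≥0∞, Measurable g →
      Measurable fun μ : ProbabilityMeasure X => ∫⁻ x, g x ∂(μ : Measure X) := fun g hg =>
    (Measure.measurable_lintegral hg).comp measurable_subtype_coe
  exact (h _ f.continuous.measurable.ennreal_ofReal).ennreal_toReal.sub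
    (h _ f.continuous.measurable.neg.ennreal_ofReal).ennreal_toReal

/-- The evaluation `σ`-algebra on the probability measures is the Borel `σ`-algebra of the weak
topology. -/
instance : BorelSpace (ProbabilityMeasure X) := by
  refine ⟨le_antisymm ?_ ?_⟩
  · have h : ∀ f : C(X, ℝ),
        Measurable[borel (ProbabilityMeasure X)] fun μ => ∫ x, f x ∂(μ : Measure X) := by
      intro f
      borelize (ProbabilityMeasure X)
      exact (continuous_integral f).measurable
    have := @measurable_of_integral X _ _ _ _ (ProbabilityMeasure X) (borel _) id h
    exact fun s hs => this hs
  · rw [isClosedEmbedding_testFun.eq_induced, borel_comap, ← BorelSpace.measurable_eq]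
    rw [← measurable_iff_comap_le]
    exact measurable_pi_lambda _ fun n => measurable_integral _

instance : SecondCountableTopology (ProbabilityMeasure X) :=
  isClosedEmbedding_testFun.isEmbedding.secondCountableTopology

theorem measurable_ultraFun {d : ℕ → ℕ} {ω : Ultrafilter ℕ}
    (f : ∀ k, Fin (d k) → ProbabilityMeasure X) : Measurable (ultraFun ω f) :=
  measurable_of_integral fun g => measurable_comp_ultraFun (continuous_integral g) f

/-- Two sequences of maps into the probability measures have the same ultralimit almost everywhere
as soon as the averages of the differences of the integrals of test functions tend to `0`. -/
theorem ultraFun_ae_eq {d : ℕ → ℕ} {ω : Ultrafilter ℕ} (hd : ∀ k, 0 < d k)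
    (hω : (ω : Filter ℕ) ≤ cofinite) {a b : ∀ k, Fin (d k) → ProbabilityMeasure X}
    (h : ∀ f : C(X, ℝ), Tendsto (fun k => avg fun j =>
      |∫ x, f x ∂(a k j : Measure X) - ∫ x, f x ∂(b k j : Measure X)|) ω (𝓝 0)) :
    ultraFun ω a =ᵐ[loebMeasure d ω] ultraFun ω b := by
  have h1 : ∀ n, ∀ᵐ z ∂loebMeasure d ω,
      |∫ x, testFun X n x ∂(ultraFun (T := ProbabilityMeasure X) ω a z : Measure X)
        - ∫ x, testFun X n x ∂(ultraFun (T := ProbabilityMeasure X) ω b z : Measure X)| = 0 := by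
    intro n
    have hg : Continuous fun p : ProbabilityMeasure X × ProbabilityMeasure X =>
        |∫ x, testFun X n x ∂(p.1 : Measure X) - ∫ x, testFun X n x ∂(p.2 : Measure X)| :=
      (((continuous_integral _).comp continuous_fst).sub
        ((continuous_integral _).comp continuous_snd)).abs
    have := (ae_ultraFun_eq_zero_iff hd hω hg (fun _ => abs_nonneg _)
      fun k j => (a k j, b k j)).2 (h (testFun X n))
    filter_upwards [this] with z hz
    rwa [ultraFun_prodMk] at hz
  filter_upwards [ae_all_iff.2 h1] with z hz
  exact probabilityMeasure_ext_testFun fun n => sub_eq_zero.1 (abs_eq_zero.1 (hz n))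

end Prob

/-! ### Convolutions and mixtures -/

section Conv

variable {M : Type*} [Group M] [MeasurableSpace M] [MeasurableMul₂ M]

/-- The convolution of two probability measures on a group. -/
def conv (μ ν : ProbabilityMeasure M) : ProbabilityMeasure M :=
  (μ.prod ν).map measurable_mul.aemeasurable

/-- Stated for measurable groups since it serves both X and the power X ^ n. -/
theorem integral_conv (μ ν : ProbabilityMeasure M) {f : M → ℝ} (hf : Measurable f) {C : ℝ}
    (hC : ∀ x, |f x| ≤ C) :
    ∫ x, f x ∂(conv μ ν : Measure M) = ∫ x, ∫ y, f (x * y) ∂(ν : Measure M) ∂(μ : Measure M) := by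
  have h1 : (conv μ ν : Measure M)
      = ((μ : Measure M).prod (ν : Measure M)).map fun p : M × M => p.1 * p.2 := rfl
  rw [h1, integral_map measurable_mul.aemeasurable hf.aestronglyMeasurable]
  refine integral_prod (fun p : M × M => f (p.1 * p.2)) ?_
  exact (integrable_const C).mono' (hf.comp measurable_mul).aestronglyMeasurable
    (.of_forall fun p => hC _)

end Conv

section Mix

variable {M : Type*} [MeasurableSpace M]

/-- The midpoint of two probability measures. -/
def mix (μ ν : ProbabilityMeasure M) : ProbabilityMeasure M :=
  ⟨(2⁻¹ : ℝ≥0∞) • (μ : Measure M) + (2⁻¹ : ℝ≥0∞) • (ν : Measure M), ⟨by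
    simp [ENNReal.inv_two_add_inv_two]⟩⟩

theorem mix_coe (μ ν : ProbabilityMeasure M) : (mix μ ν : Measure M)
    = (2⁻¹ : ℝ≥0∞) • (μ : Measure M) + (2⁻¹ : ℝ≥0∞) • (ν : Measure M) := rfl

theorem integral_mix (μ ν : ProbabilityMeasure M) {f : M → ℝ} (hμ : Integrable f (μ : Measure M))
    (hν : Integrable f (ν : Measure M)) :
    ∫ x, f x ∂(mix μ ν : Measure M)
      = 2⁻¹ * ∫ x, f x ∂(μ : Measure M) + 2⁻¹ * ∫ x, f x ∂(ν : Measure M) := by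
  rw [mix_coe, integral_add_measure (hμ.smul_measure (by simp)) (hν.smul_measure (by simp)),
    integral_smul_measure, integral_smul_measure]
  simp

end Mix

section Continuous

variable {T : Type*} [TopologicalSpace T] [CompactSpace T] [MeasurableSpace T]
  [OpensMeasurableSpace T] (μ : Measure T) [IsFiniteMeasure μ]

theorem integrable_of_continuous {f : T → ℝ} (hf : Continuous f) : Integrable f μ :=
  integrable_continuousMap μ ⟨f, hf⟩

theorem integral_sub_of_continuous {f g : T → ℝ} (hf : Continuous f) (hg : Continuous g) :
    ∫ x, (f x - g x) ∂μ = ∫ x, f x ∂μ - ∫ x, g x ∂μ :=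
  integral_sub (integrable_of_continuous μ hf) (integrable_of_continuous μ hg)

theorem integral_add_of_continuous {f g : T → ℝ} (hf : Continuous f) (hg : Continuous g) :
    ∫ x, (f x + g x) ∂μ = ∫ x, f x ∂μ + ∫ x, g x ∂μ :=
  integral_add (integrable_of_continuous μ hf) (integrable_of_continuous μ hg)

theorem integral_mono_of_continuous {f g : T → ℝ} (hf : Continuous f) (hg : Continuous g)
    (h : ∀ x, f x ≤ g x) : ∫ x, f x ∂μ ≤ ∫ x, g x ∂μ :=
  integral_mono (integrable_of_continuous μ hf) (integrable_of_continuous μ hg) h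

end Continuous

section CompactSpace

variable {X : Type*} [MetricSpace X] [CompactSpace X] [MeasurableSpace X] [BorelSpace X]

theorem integral_mix_continuousMap (μ ν : ProbabilityMeasure X) (f : C(X, ℝ)) :
    ∫ x, f x ∂(mix μ ν : Measure X)
      = 2⁻¹ * ∫ x, f x ∂(μ : Measure X) + 2⁻¹ * ∫ x, f x ∂(ν : Measure X) :=
  integral_mix μ ν (integrable_continuousMap _ f) (integrable_continuousMap _ f)

theorem continuous_mix :
    Continuous fun p : ProbabilityMeasure X × ProbabilityMeasure X => mix p.1 p.2 := by
  refine ProbabilityMeasure.continuous_iff_forall_continuousMap_continuous_integral.2 fun f => ?_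
  simp only [integral_mix_continuousMap]
  exact (((continuous_integral f).comp continuous_fst).const_mul _).add
    (((continuous_integral f).comp continuous_snd).const_mul _)

/-- The variance of g is nonnegative. -/
theorem sq_integral_le (μ : ProbabilityMeasure X) (g : C(X, ℝ)) :
    (∫ x, g x ∂(μ : Measure X)) ^ 2 ≤ ∫ x, g x ^ 2 ∂(μ : Measure X) := by
  have h0 : 0 ≤ ∫ x, (g x - ∫ y, g y ∂(μ : Measure X)) ^ 2 ∂(μ : Measure X) :=
    integral_nonneg fun _ => sq_nonneg _
  set c := ∫ y, g y ∂(μ : Measure X) with hc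
  have h1 : ∀ x, (g x - c) ^ 2 = g x ^ 2 - (2 * c * g x - c ^ 2) := fun x => by ring
  simp only [h1] at h0
  rw [integral_sub_of_continuous _ (by fun_prop) (by fun_prop),
    integral_sub_of_continuous _ (by fun_prop) (by fun_prop), integral_const_mul, ← hc] at h0
  simp only [integral_const, probReal_univ, smul_eq_mul, one_mul] at h0
  nlinarith

end CompactSpace

/-! ### Averaged translates, energy and strict convexity on a compact group -/

section CompactGroup

variable {X : Type*} [Group X] [MetricSpace X] [CompactSpace X] [IsTopologicalGroup X]
  [MeasurableSpace X] [BorelSpace X]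

theorem integral_conv_continuousMap (μ ν : ProbabilityMeasure X) (f : C(X, ℝ)) :
    ∫ x, f x ∂(conv μ ν : Measure X) = ∫ x, ∫ y, f (x * y) ∂(ν : Measure X) ∂(μ : Measure X) := by
  obtain ⟨C, hC⟩ := exists_abs_le f.continuous
  exact integral_conv μ ν f.continuous.measurable hC

theorem continuous_conv :
    Continuous fun p : ProbabilityMeasure X × ProbabilityMeasure X => conv p.1 p.2 :=
  (ProbabilityMeasure.continuous_map continuous_mul).comp ProbabilityMeasure.continuous_prod

/-- The translates `x ↦ ∫ f (x y) dμ(y)` of a test function, averaged by a measure. -/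
def smear (f : C(X, ℝ)) (μ : ProbabilityMeasure X) : C(X, ℝ) where
  toFun x := ∫ y, f (x * y) ∂(μ : Measure X)
  continuous_toFun := by
    have := continuous_parametric_integral_of_continuous (μ := (μ : Measure X))
      (f := fun x y : X => f (x * y)) (by fun_prop) isCompact_univ
    simpa using this

theorem smear_apply (f : C(X, ℝ)) (μ : ProbabilityMeasure X) (x : X) :
    smear f μ x = ∫ y, f (x * y) ∂(μ : Measure X) := rfl

theorem smear_one (f : C(X, ℝ)) (μ : ProbabilityMeasure X) :
    smear f μ 1 = ∫ y, f y ∂(μ : Measure X) := by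
  simp [smear_apply]

theorem smear_conv (f : C(X, ℝ)) (μ ν : ProbabilityMeasure X) (x : X) :
    smear f (conv μ ν) x = ∫ u, smear f ν (x * u) ∂(μ : Measure X) := by
  have := integral_conv_continuousMap μ ν (f.comp ⟨fun y => x * y, by fun_prop⟩)
  simp only [ContinuousMap.comp_apply, ContinuousMap.coe_mk] at this
  rw [smear_apply, this]
  simp only [smear_apply, mul_assoc]

theorem smear_mix (f : C(X, ℝ)) (μ ν : ProbabilityMeasure X) (x : X) :
    smear f (mix μ ν) x = 2⁻¹ * smear f μ x + 2⁻¹ * smear f ν x :=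
  integral_mix_continuousMap μ ν (f.comp ⟨fun y => x * y, by fun_prop⟩)

/-- The square of the `L²`-norm of `smear f μ` for the Haar measure. -/
def energy (f : C(X, ℝ)) (μ : ProbabilityMeasure X) : ℝ :=
  ∫ x, smear f μ x ^ 2 ∂(haarProb X : Measure X)

theorem integral_haar_mul_right (g : C(X, ℝ)) (u : X) :
    ∫ x, g (x * u) ∂(haarProb X : Measure X) = ∫ x, g x ∂(haarProb X : Measure X) := by
  conv_rhs => rw [← haarProb_map_mul_right X u]
  rw [integral_map (by fun_prop) g.continuous.aestronglyMeasurable]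

/-- By Fubini the energy is the integral against μ ⊗ μ of one fixed continuous kernel on X × X. -/
theorem continuous_energy (f : C(X, ℝ)) : Continuous (energy f) := by
  let k : C(X × X, ℝ) := ⟨fun p => ∫ x, f (x * p.1) * f (x * p.2) ∂(haarProb X : Measure X), by
    have := continuous_parametric_integral_of_continuous (μ := (haarProb X : Measure X))
      (f := fun (p : X × X) (x : X) => f (x * p.1) * f (x * p.2)) (by fun_prop) isCompact_univ
    simpa using this⟩
  have h : energy f = fun μ => ∫ p, k p ∂((μ.prod μ : ProbabilityMeasure (X × X)) :
      Measure (X × X)) := by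
    ext μ
    have h1 : ∀ x, smear f μ x ^ 2
        = ∫ p : X × X, f (x * p.1) * f (x * p.2) ∂((μ : Measure X).prod (μ : Measure X)) := by
      intro x
      rw [integral_prod_mul (fun y => f (x * y)) (fun y => f (x * y)), sq]
      rfl
    simp only [energy, h1]
    refine integral_integral_swap
      (f := fun (x : X) (p : X × X) => f (x * p.1) * f (x * p.2)) ?_
    exact integrable_continuousMap _
      (⟨fun q : X × (X × X) => f (q.1 * q.2.1) * f (q.1 * q.2.2), by fun_prop⟩ :
        C(X × (X × X), ℝ))
  rw [h]
  exact (continuous_integral k).comp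
    (ProbabilityMeasure.continuous_prod.comp (continuous_id.prodMk continuous_id))

theorem energy_nonneg (f : C(X, ℝ)) (μ : ProbabilityMeasure X) : 0 ≤ energy f μ :=
  integral_nonneg fun _ => sq_nonneg _

theorem abs_smear_le (f : C(X, ℝ)) (μ : ProbabilityMeasure X) (x : X) : |smear f μ x| ≤ ‖f‖ := by
  have := norm_integral_le_of_norm_le_const (μ := (μ : Measure X)) (f := fun y => f (x * y))
    (C := ‖f‖) (.of_forall fun y => f.norm_coe_le_norm _)
  simpa [smear_apply] using this

theorem energy_le (f : C(X, ℝ)) (μ : ProbabilityMeasure X) : energy f μ ≤ ‖f‖ ^ 2 := by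
  have := integral_mono (μ := (haarProb X : Measure X)) (f := fun x => smear f μ x ^ 2)
    (g := fun _ => ‖f‖ ^ 2) (integrable_continuousMap _ (smear f μ ^ 2)) (integrable_const _)
    fun x => sq_le_sq.2 (by rw [abs_norm]; exact abs_smear_le f μ x)
  simpa [energy] using this

theorem continuous_integral_mul_right (μ : ProbabilityMeasure X) (g : C(X, ℝ)) :
    Continuous fun x => ∫ u, g (x * u) ∂(μ : Measure X) :=
  (smear g μ).continuous

theorem integral_integral_mul_right (μ : ProbabilityMeasure X) (g : C(X, ℝ)) :
    ∫ x, ∫ u, g (x * u) ∂(μ : Measure X) ∂(haarProb X : Measure X)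
      = ∫ x, g x ∂(haarProb X : Measure X) := by
  rw [integral_integral_swap (f := fun x u : X => g (x * u)) (integrable_continuousMap _
    (⟨fun q : X × X => g (q.1 * q.2), by fun_prop⟩ : C(X × X, ℝ)))]
  simp [integral_haar_mul_right]

/-- By `smear_conv`, convolving on the left averages right translates of `smear f ν`. Jensen's
inequality and right invariance of Haar measure show that averaging does not increase the L² norm.
-/
theorem energy_conv_le (f : C(X, ℝ)) (μ ν : ProbabilityMeasure X) :
    energy f (conv μ ν) ≤ energy f ν := by
  have h1 : ∀ x, smear f (conv μ ν) x ^ 2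
      ≤ ∫ u, smear f ν (x * u) ^ 2 ∂(μ : Measure X) := by
    intro x
    rw [smear_conv]
    exact sq_integral_le μ ((smear f ν).comp ⟨fun u => x * u, by fun_prop⟩)
  have h2 := integral_integral_mul_right μ (smear f ν ^ 2)
  simp only [ContinuousMap.pow_apply] at h2
  rw [energy, energy, ← h2]
  exact integral_mono_of_continuous _ (by fun_prop)
    (continuous_integral_mul_right μ (smear f ν ^ 2)) h1

/-- The parallelogram identity in L²; the subtracted term is what makes the descent strict. -/
theorem energy_mix (f : C(X, ℝ)) (μ ν : ProbabilityMeasure X) :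
    energy f (mix μ ν) = 2⁻¹ * energy f μ + 2⁻¹ * energy f ν
      - 4⁻¹ * ∫ x, (smear f μ - smear f ν) x ^ 2 ∂(haarProb X : Measure X) := by
  have h1 : ∀ x, smear f (mix μ ν) x ^ 2 = 2⁻¹ * smear f μ x ^ 2 + 2⁻¹ * smear f ν x ^ 2
      - 4⁻¹ * (smear f μ - smear f ν) x ^ 2 := fun x => by
    rw [smear_mix, ContinuousMap.sub_apply]; ring
  simp only [energy, h1]
  rw [integral_sub_of_continuous _ (by fun_prop) (by fun_prop),
    integral_add_of_continuous _ (by fun_prop) (by fun_prop), integral_const_mul,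
    integral_const_mul, integral_const_mul]

theorem continuousMap_eq_zero_of_integral_sq (g : C(X, ℝ))
    (h : ∫ x, g x ^ 2 ∂(haarProb X : Measure X) = 0) : g = 0 := by
  have h1 : (fun x => g x ^ 2) =ᵐ[(haarProb X : Measure X)] 0 :=
    (integral_eq_zero_iff_of_nonneg (fun x => sq_nonneg (g x))
      (integrable_of_continuous _ (by fun_prop))).1 h
  have h2 := (Continuous.ae_eq_iff_eq (haarProb X : Measure X) (f := fun x => g x ^ 2)
    (g := fun _ => 0) (by fun_prop) (by fun_prop)).1 h1
  ext x
  have := congrFun h2 x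
  simpa using this

/-- A continuous functional that decreases strictly on passing from `ν` to the midpoint of `ν` and
`μ * ν`, unless `μ * ν = ν`. -/
theorem exists_strict_functional : ∃ J : ProbabilityMeasure X → ℝ, Continuous J ∧
    (∀ ν, 0 ≤ J ν) ∧ (∀ μ ν, J (mix ν (conv μ ν)) ≤ J ν) ∧
    ∀ μ ν, J ν ≤ J (mix ν (conv μ ν)) → conv μ ν = ν := by
  -- Since the energy is at most ‖f‖², these weights dominate the series by a geometric one,
  -- uniformly in ν; the sum is therefore continuous.
  let w : ℕ → ℝ := fun n => (1 / 2) ^ n / (1 + ‖testFun X n‖ ^ 2)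
  have hw : ∀ n, 0 < w n := fun n => by positivity
  have hwle : ∀ n (ν : ProbabilityMeasure X), w n * energy (testFun X n) ν ≤ (1 / 2) ^ n := by
    intro n ν
    have h1 := energy_le (testFun X n) ν
    rw [div_mul_eq_mul_div, div_le_iff₀ (by positivity)]
    gcongr
    linarith
  have hnn : ∀ n (ν : ProbabilityMeasure X), 0 ≤ w n * energy (testFun X n) ν := fun n ν =>
    mul_nonneg (hw n).le (energy_nonneg _ _)
  have hsum : ∀ ν : ProbabilityMeasure X, Summable fun n => w n * energy (testFun X n) ν :=
    fun ν => Summable.of_nonneg_of_le (fun n => hnn n ν) (fun n => hwle n ν) summable_geometric_two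
  have hstep : ∀ n (μ ν : ProbabilityMeasure X),
      w n * energy (testFun X n) (mix ν (conv μ ν)) ≤ w n * energy (testFun X n) ν := by
    intro n μ ν
    refine mul_le_mul_of_nonneg_left ?_ (hw n).le
    have h1 := energy_conv_le (testFun X n) μ ν
    have h2 : 0 ≤ ∫ x, (smear (testFun X n) ν - smear (testFun X n) (conv μ ν)) x ^ 2
      ∂(haarProb X : Measure X) := integral_nonneg fun _ => sq_nonneg _
    rw [energy_mix]
    linarith
  refine ⟨fun ν => ∑' n, w n * energy (testFun X n) ν, ?_, fun ν => tsum_nonneg fun n => hnn n ν,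
    fun μ ν => (hsum _).tsum_le_tsum (fun n => hstep n μ ν) (hsum _), fun μ ν h => ?_⟩
  · refine continuous_tsum (fun n => (continuous_energy _).const_mul _) summable_geometric_two
      fun n ν => ?_
    rw [Real.norm_of_nonneg (hnn n ν)]
    exact hwle n ν
  · refine probabilityMeasure_ext_testFun fun n => ?_
    -- Every term decreases weakly, so a sum that does not decrease forces equality in each term,
    -- and then the parallelogram defect vanishes.
    have heq : w n * energy (testFun X n) (mix ν (conv μ ν)) = w n * energy (testFun X n) ν := by
      by_contra hne
      exact absurd h (not_le.2 (Summable.tsum_lt_tsum (fun m => hstep m μ ν)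
        (lt_of_le_of_ne (hstep n μ ν) hne) (hsum _) (hsum _)))
    have heq' := mul_left_cancel₀ (hw n).ne' heq
    have h1 := energy_conv_le (testFun X n) μ ν
    have h2 : 0 ≤ ∫ x, (smear (testFun X n) ν - smear (testFun X n) (conv μ ν)) x ^ 2
      ∂(haarProb X : Measure X) := integral_nonneg fun _ => sq_nonneg _
    rw [energy_mix] at heq'
    have h3 := continuousMap_eq_zero_of_integral_sq _ (le_antisymm (by linarith) h2)
    rw [← smear_one, ← smear_one, sub_eq_zero.1 h3]

/-! ### Stabilizers and idempotents -/

/-- The closed subgroup of the `u` with `δ_u * ν = ν`. -/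
def stab (ν : ProbabilityMeasure X) : ClosedSubgroup X where
  carrier := {u | ∀ f : C(X, ℝ), smear f ν u = smear f ν 1}
  one_mem' := fun _ => rfl
  mul_mem' := by
    intro u v hu hv f
    have := hv (f.comp ⟨fun y => u * y, by fun_prop⟩)
    rw [← hu f]
    simpa [smear_apply, mul_assoc] using this
  inv_mem' := by
    intro u hu f
    have := hu (f.comp ⟨fun y => u⁻¹ * y, by fun_prop⟩)
    simpa [smear_apply] using this.symm
  isClosed' := by
    simp only [Set.ofPred_forall]
    exact isClosed_iInter fun f => isClosed_eq (smear f ν).continuous continuous_const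

theorem mem_stab {ν : ProbabilityMeasure X} {u : X} :
    u ∈ (stab ν).toSubgroup ↔ ∀ f : C(X, ℝ), smear f ν u = smear f ν 1 := Iff.rfl

/-- Countably many test functions detect the stabilizer, so almost everywhere statements for each
function combine into one. -/
theorem mem_stab_of_testFun {ν : ProbabilityMeasure X} {u : X}
    (h : ∀ n, smear (testFun X n) ν u = smear (testFun X n) ν 1) : u ∈ (stab ν).toSubgroup := by
  have h1 : ν.map (measurable_const_mul u).aemeasurable = ν := by
    refine probabilityMeasure_ext_testFun fun n => ?_
    rw [ProbabilityMeasure.toMeasure_map, integral_map (measurable_const_mul u).aemeasurable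
      (testFun X n).continuous.aestronglyMeasurable]
    rw [← smear_one]
    exact h n
  refine mem_stab.2 fun f => ?_
  rw [smear_one]
  conv_rhs => rw [← h1]
  rw [ProbabilityMeasure.toMeasure_map, integral_map (measurable_const_mul u).aemeasurable
      f.continuous.aestronglyMeasurable]
  rfl

/-- If `μ * ν = ν`, then `μ` is carried by the stabilizer of `ν`. -/
theorem ae_mem_stab {μ ν : ProbabilityMeasure X} (h : conv μ ν = ν) :
    ∀ᵐ u ∂(μ : Measure X), u ∈ (stab ν).toSubgroup := by
  have key : ∀ f : C(X, ℝ), ∀ᵐ u ∂(μ : Measure X), smear f ν u = smear f ν 1 := by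
    intro f
    set F := smear f ν with hF
    have hF1 : ∀ x, ∫ u, F (x * u) ∂(μ : Measure X) = F x := fun x => by
      rw [hF, ← smear_conv, h]
    have hcont : Continuous fun u : X => ∫ x, (F (x * u) - F x) ^ 2 ∂(haarProb X : Measure X) := by
      have := continuous_parametric_integral_of_continuous (μ := (haarProb X : Measure X))
        (f := fun u x : X => (F (x * u) - F x) ^ 2) (by fun_prop) isCompact_univ
      simpa using this
    have hint : ∀ x, ∫ u, (F (x * u) - F x) ^ 2 ∂(μ : Measure X)
        = ∫ u, F (x * u) ^ 2 ∂(μ : Measure X) - F x ^ 2 := by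
      intro x
      have e : ∀ u, (F (x * u) - F x) ^ 2 = F (x * u) ^ 2 - (2 * F x * F (x * u) - F x ^ 2) :=
        fun u => by ring
      simp only [e]
      rw [integral_sub_of_continuous _ (by fun_prop) (by fun_prop),
        integral_sub_of_continuous _ (by fun_prop) (by fun_prop), integral_const_mul, hF1]
      simp only [integral_const, probReal_univ, smul_eq_mul, one_mul]
      ring
    -- F is its own average over right translates by μ, so the inner variance is ∫ F(xu)² dμ(u) -
    -- F(x)². Its Haar integral vanishes by right invariance, hence F(xu) = F(x) for μ-almost every
    -- u and all x; x = 1 is the case needed.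
    have hzero : ∫ u, ∫ x, (F (x * u) - F x) ^ 2 ∂(haarProb X : Measure X) ∂(μ : Measure X)
        = 0 := by
      rw [integral_integral_swap (f := fun u x : X => (F (x * u) - F x) ^ 2)
        (integrable_continuousMap _
          (⟨fun q : X × X => (F (q.2 * q.1) - F q.2) ^ 2, by fun_prop⟩ : C(X × X, ℝ)))]
      simp only [hint]
      have h2 := integral_integral_mul_right μ (F ^ 2)
      simp only [ContinuousMap.pow_apply] at h2
      have h3 : Continuous fun x => ∫ u, F (x * u) ^ 2 ∂(μ : Measure X) :=
        continuous_integral_mul_right μ (F ^ 2)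
      rw [integral_sub_of_continuous _ h3 (by fun_prop),
        h2, sub_self]
    have hae := (integral_eq_zero_iff_of_nonneg
      (fun u => integral_nonneg fun _ => sq_nonneg _)
      (integrable_continuousMap (μ : Measure X) ⟨_, hcont⟩)).1 hzero
    filter_upwards [hae] with u hu
    have := continuousMap_eq_zero_of_integral_sq (F.comp ⟨fun x => x * u, by fun_prop⟩ - F) hu
    have := DFunLike.congr_fun this 1
    simpa [sub_eq_zero] using this
  filter_upwards [ae_all_iff.2 fun n => key (testFun X n)] with u hu
  exact mem_stab_of_testFun hu

theorem haarOn_coe (K : ClosedSubgroup X) : (haarOn K : Measure X)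
    = (haarProb K.toSubgroup : Measure K.toSubgroup).map Subtype.val := rfl

theorem ae_mem_haarOn (K : ClosedSubgroup X) : ∀ᵐ x ∂(haarOn K : Measure X), x ∈ K.toSubgroup := by
  rw [haarOn_coe]
  exact (ae_map_iff measurable_subtype_coe.aemeasurable K.isClosed'.measurableSet).2
    (.of_forall fun x => x.2)

theorem integral_haarOn_mul_right (K : ClosedSubgroup X) (f : C(X, ℝ)) {y : X}
    (hy : y ∈ K.toSubgroup) :
    ∫ x, f (x * y) ∂(haarOn K : Measure X) = ∫ x, f x ∂(haarOn K : Measure X) := by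
  have h1 := integral_haarOn K (f.comp ⟨fun x => x * y, by fun_prop⟩)
  simp only [ContinuousMap.comp_apply, ContinuousMap.coe_mk] at h1
  rw [h1, integral_haarOn]
  conv_rhs => rw [← haarProb_map_mul_right K.toSubgroup ⟨y, hy⟩]
  rw [integral_map (by fun_prop)
    (show Continuous fun x : K.toSubgroup => f x by fun_prop).aestronglyMeasurable]
  rfl

/-- A probability measure that is carried by a closed subgroup and invariant under it is the Haar
measure of the subgroup. -/
theorem eq_haarOn {ν : ProbabilityMeasure X} {K : ClosedSubgroup X}
    (h1 : ∀ᵐ y ∂(ν : Measure X), y ∈ K.toSubgroup) (h2 : K ≤ stab ν) : ν = haarOn K := by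
  refine probabilityMeasure_ext fun f => ?_
  have hswap := integral_integral_swap (μ := (haarOn K : Measure X)) (ν := (ν : Measure X))
    (f := fun x y : X => f (x * y)) (integrable_continuousMap _
      (⟨fun q : X × X => f (q.1 * q.2), by fun_prop⟩ : C(X × X, ℝ)))
  have e1 : ∫ x, ∫ y, f (x * y) ∂(ν : Measure X) ∂(haarOn K : Measure X)
      = ∫ y, f y ∂(ν : Measure X) := by
    rw [integral_congr_ae (g := fun _ => ∫ y, f y ∂(ν : Measure X))]
    · simp
    · filter_upwards [ae_mem_haarOn K] with x hx
      rw [← smear_one]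
      exact mem_stab.1 (h2 hx) f
  have e2 : ∫ y, ∫ x, f (x * y) ∂(haarOn K : Measure X) ∂(ν : Measure X)
      = ∫ y, f y ∂(haarOn K : Measure X) := by
    rw [integral_congr_ae (g := fun _ => ∫ y, f y ∂(haarOn K : Measure X))]
    · simp
    · filter_upwards [h1] with y hy
      exact integral_haarOn_mul_right K f hy
  rw [← e1, hswap, e2]

theorem eq_haarOn_of_conv_self {ν : ProbabilityMeasure X} (h : conv ν ν = ν) :
    ν = haarOn (stab ν) :=
  eq_haarOn (ae_mem_stab h) le_rfl

/-- If u preserves m_K, then both y and uy lie in K for almost every y, so u is in K. This makes K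
recoverable from its Haar measure. -/
theorem stab_haarOn (K : ClosedSubgroup X) : stab (haarOn K) = K := by
  refine le_antisymm (fun u hu => ?_) fun u hu => ?_
  · have hu' : (haarOn K).map (measurable_const_mul u).aemeasurable = haarOn K := by
      refine probabilityMeasure_ext fun f => ?_
      rw [ProbabilityMeasure.toMeasure_map, integral_map (measurable_const_mul u).aemeasurable
        f.continuous.aestronglyMeasurable, ← smear_one]
      exact mem_stab.1 hu f
    have h1 := ae_mem_haarOn K
    have h2 := ae_mem_haarOn K
    rw [← hu', ProbabilityMeasure.toMeasure_map] at h2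
    replace h2 := (ae_map_iff (measurable_const_mul u).aemeasurable
      K.isClosed'.measurableSet).1 h2
    obtain ⟨y, hy1, hy2⟩ := (h1.and h2).exists
    exact (K.toSubgroup.mul_mem_cancel_right hy1).1 hy2
  · refine mem_stab.2 fun f => ?_
    rw [smear_one]
    exact integral_haarOn_mul_left K f hu

theorem haarOn_injective : Function.Injective (haarOn : ClosedSubgroup X → ProbabilityMeasure X) :=
  Function.LeftInverse.injective stab_haarOn

/-- The part of K outside L is relatively open, and Haar measure on K charges every nonempty open
set. -/
theorem le_of_ae_haarOn {K L : ClosedSubgroup X}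
    (h : ∀ᵐ x ∂(haarOn K : Measure X), x ∈ L.toSubgroup) : K ≤ L := by
  rw [haarOn_coe] at h
  replace h := (ae_map_iff measurable_subtype_coe.aemeasurable L.isClosed'.measurableSet).1 h
  have hopen : IsOpen {x : K.toSubgroup | (x : X) ∉ L.toSubgroup} :=
    (L.isClosed'.preimage continuous_subtype_val).isOpen_compl
  have he : {x : K.toSubgroup | (x : X) ∉ L.toSubgroup} = ∅ := by
    by_contra hne
    exact hopen.measure_ne_zero (haarProb K.toSubgroup : Measure K.toSubgroup)
      (Set.nonempty_iff_ne_empty.2 hne) h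
  intro x hx
  by_contra hxL
  exact Set.eq_empty_iff_forall_notMem.1 he ⟨x, hx⟩ hxL

/-- The space of closed subgroups of a compact group is compact. -/
instance : CompactSpace (ClosedSubgroup X) := by
  refine ⟨isCompact_iff_ultrafilter_le_nhds.2 fun F _ => ?_⟩
  have hF := (F.map (toNonemptyCompacts (X := X))).le_nhds_lim
  set K0 := (F.map (toNonemptyCompacts (X := X))).lim
  have hsub : ∀ U : Set X, IsOpen U → (K0 : Set X) ⊆ U →
      ∀ᶠ K : ClosedSubgroup X in F, (K : Set X) ⊆ U := fun U hU h =>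
    hF ((TopologicalSpace.NonemptyCompacts.isOpen_subsets_of_isOpen hU).mem_nhds h)
  have hint : ∀ U : Set X, IsOpen U → ((K0 : Set X) ∩ U).Nonempty →
      ∀ᶠ K : ClosedSubgroup X in F, ((K : Set X) ∩ U).Nonempty := fun U hU h =>
    hF ((TopologicalSpace.NonemptyCompacts.isOpen_inter_nonempty_of_isOpen hU).mem_nhds h)
  -- Otherwise K0 and x y⁻¹ have disjoint neighbourhoods, but subgroups close to K0 contain points a
  -- near x and b near y, and a b⁻¹ lies in both neighbourhoods.
  have hdiv : ∀ x ∈ (K0 : Set X), ∀ y ∈ (K0 : Set X), x * y⁻¹ ∈ (K0 : Set X) := by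
    intro x hx y hy
    by_contra hxy
    obtain ⟨V, W, hV, hW, hKV, hxW, hVW⟩ :=
      SeparatedNhds.of_isCompact_isCompact K0.isCompact isCompact_singleton
        (Set.disjoint_singleton_right.2 hxy)
    have hpre : IsOpen {p : X × X | p.1 * p.2⁻¹ ∈ W} := hW.preimage (by fun_prop)
    obtain ⟨A, B, hA, hB, hxA, hyB, hAB⟩ := isOpen_prod_iff.1 hpre x y (hxW rfl)
    obtain ⟨K, ⟨hK1, a, haK, haA⟩, b, hbK, hbB⟩ := ((hsub V hV hKV).and
      (hint A hA ⟨x, hx, hxA⟩)).and (hint B hB ⟨y, hy, hyB⟩) |>.exists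
    exact Set.disjoint_left.1 hVW (hK1 (K.toSubgroup.mul_mem haK (K.toSubgroup.inv_mem hbK)))
      (hAB (Set.mk_mem_prod haA hbB))
  obtain ⟨x0, hx0⟩ := K0.nonempty
  have hone : (1 : X) ∈ (K0 : Set X) := by simpa using hdiv x0 hx0 x0 hx0
  have hinv : ∀ x ∈ (K0 : Set X), x⁻¹ ∈ (K0 : Set X) := fun x hx => by
    simpa using hdiv 1 hone x hx
  let K : ClosedSubgroup X :=
    { carrier := K0
      one_mem' := hone
      mul_mem' := fun {a b} ha hb => by simpa using hdiv a ha b⁻¹ (hinv b hb)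
      inv_mem' := fun {a} ha => hinv a ha
      isClosed' := K0.isCompact.isClosed }
  have hK : toNonemptyCompacts K = K0 := rfl
  refine ⟨K, Set.mem_univ _, ?_⟩
  rw [nhds_induced, hK]
  exact map_le_iff_le_comap.1 hF

/-- An injective continuous map from a compact space to a Hausdorff one. It supplies a measurable
way to read a subgroup off its Haar measure. -/
theorem measurableEmbedding_haarOn :
    MeasurableEmbedding (haarOn : ClosedSubgroup X → ProbabilityMeasure X) :=
  (continuous_haarOn.isClosedEmbedding haarOn_injective).measurableEmbedding

end CompactGroup

/-! ### Microstates and defects -/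

section Defect

variable {E : Type*} [MetricSpace E]

/-- The distance as a continuous function. -/
def distMap (E : Type*) [MetricSpace E] : C(E × E, ℝ) := ⟨fun p => dist p.1 p.2, by fun_prop⟩

theorem distMap_apply (x y : E) : distMap E (x, y) = dist x y := rfl

theorem continuous_avg {T : Type*} [TopologicalSpace T] {n : ℕ} {f : T → Fin n → ℝ}
    (h : ∀ j, Continuous fun t => f t j) : Continuous fun t => avg (f t) := by
  unfold avg
  fun_prop

theorem continuous_pairAvg (c : C(E × E, ℝ)) (a : C(E, E)) {n : ℕ} (s : Equiv.Perm (Fin n)) :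
    Continuous fun φ : Fin n → E => avg fun j => c (φ (s j), a (φ j)) :=
  continuous_avg fun j => by fun_prop

variable [MeasurableSpace E]

/-- The mean over `μ` of the average of `c (φ (s j), a (φ j))`. -/
def defect (c : C(E × E, ℝ)) (a : C(E, E)) {n : ℕ} (s : Equiv.Perm (Fin n))
    (μ : ProbabilityMeasure (Fin n → E)) : ℝ :=
  ∫ φ, avg (fun j => c (φ (s j), a (φ j))) ∂(μ : Measure (Fin n → E))

theorem defect_nonneg {c : C(E × E, ℝ)} (hc : ∀ p, 0 ≤ c p) (a : C(E, E)) {n : ℕ}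
    (s : Equiv.Perm (Fin n)) (μ : ProbabilityMeasure (Fin n → E)) : 0 ≤ defect c a s μ :=
  integral_nonneg fun _ => avg_nonneg fun _ => hc _

variable [BorelSpace E]

theorem integral_marginal {n : ℕ} (μ : ProbabilityMeasure (Fin n → E)) (j : Fin n) (f : C(E, ℝ)) :
    ∫ x, f x ∂(marginal μ j : Measure E) = ∫ φ, f (φ j) ∂(μ : Measure (Fin n → E)) := by
  rw [marginal, ProbabilityMeasure.toMeasure_map, integral_map
    (measurable_pi_apply j).aemeasurable f.continuous.aestronglyMeasurable]

variable [CompactSpace E]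

theorem defect_le {c : C(E × E, ℝ)} {ε C : ℝ} (h : ∀ p, c p ≤ ε + C * distMap E p) (a : C(E, E))
    {n : ℕ} (hn : 0 < n) (s : Equiv.Perm (Fin n)) (μ : ProbabilityMeasure (Fin n → E)) :
    defect c a s μ ≤ ε + C * defect (distMap E) a s μ := by
  have h1 : ∀ φ : Fin n → E, avg (fun j => c (φ (s j), a (φ j)))
      ≤ ε + C * avg (fun j => distMap E (φ (s j), a (φ j))) := by
    intro φ
    refine (avg_mono fun j => h _).trans (le_of_eq ?_)
    rw [avg_add, avg_const hn, avg_const_mul]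
  have hc := continuous_pairAvg (distMap E) a s
  refine (integral_mono_of_continuous _ (continuous_pairAvg c a s) (by fun_prop) h1).trans
    (le_of_eq ?_)
  rw [integral_add_of_continuous _ (by fun_prop) (by fun_prop), integral_const_mul]
  simp [defect]

theorem measurableSet_goodMaps (a : C(E, E)) {n : ℕ} (s : Equiv.Perm (Fin n)) {U : Set (E × E)}
    (hU : IsOpen U) (ε : ℝ) :
    MeasurableSet {φ : Fin n → E | 1 - ε < (unif {j | (φ (s j), a (φ j)) ∈ U}).toReal} := by
  have h : ∀ φ : Fin n → E, (unif {j | (φ (s j), a (φ j)) ∈ U}).toReal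
      = avg fun j => U.indicator (fun _ => (1 : ℝ)) (φ (s j), a (φ j)) := fun φ => by
    rw [← avg_indicator]; rfl
  simp only [h, avg]
  refine measurableSet_lt measurable_const (Measurable.div_const ?_ _)
  refine Finset.measurable_sum _ fun j _ => ?_
  refine (measurable_const.indicator hU.measurableSet).comp ?_
  have : Continuous fun φ : Fin n → E => (φ (s j), a (φ j)) := by fun_prop
  exact this.measurable

theorem one_sub_unif {n : ℕ} (hn : 0 < n) (A : Set (Fin n)) :
    avg (fun j => Aᶜ.indicator (fun _ => (1 : ℝ)) j) = 1 - (unif A).toReal := by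
  have h : ∀ j, A.indicator (fun _ => (1 : ℝ)) j + Aᶜ.indicator (fun _ => (1 : ℝ)) j = 1 :=
    fun j => Set.indicator_self_add_compl_apply A _ j
  have h1 := avg_add (A.indicator fun _ => (1 : ℝ)) (Aᶜ.indicator fun _ => (1 : ℝ))
  simp only [h, avg_const hn] at h1
  rw [avg_indicator] at h1
  linarith

variable {G : Type*} {d : ℕ → ℕ} {ω : Ultrafilter ℕ} {σ : ∀ k, G → Equiv.Perm (Fin (d k))}
  {act : G → C(E, E)} {μ : ∀ k, ProbabilityMeasure (Fin (d k) → E)}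

/-- Take for U the points at distance less than ε. The distance is small on U and bounded elsewhere,
and the exceptional indices j and exceptional maps φ both have weight at most ε. -/
theorem AsympSupported.tendsto_defect_dist (hd : ∀ k, 0 < d k)
    (h : AsympSupported (fun g => act g) σ ω μ) (g : G) :
    Tendsto (fun k => defect (distMap E) (act g) (σ k g) (μ k)) ω (𝓝 0) := by
  obtain ⟨M, hM⟩ := exists_abs_le (distMap E).continuous
  have hM0 : 0 ≤ |M| := abs_nonneg M
  have hM' : ∀ p, distMap E p ≤ |M| := fun p => (le_abs_self _).trans ((hM p).trans (le_abs_self M))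
  refine Metric.tendsto_nhds.2 fun ε' hε' => ?_
  obtain ⟨ε, hε, hεε⟩ : ∃ ε, 0 < ε ∧ ε * (1 + 2 * |M|) < ε' := by
    refine ⟨ε' / (2 * (1 + 2 * |M|)), by positivity, ?_⟩
    have : ε' / (2 * (1 + 2 * |M|)) * (1 + 2 * |M|) = ε' / 2 := by field_simp
    linarith
  let U : Set (E × E) := {p | dist p.1 p.2 < ε}
  have hU : IsOpen U := isOpen_lt (by fun_prop) continuous_const
  have hdiag : Set.diagonal E ⊆ U := by
    rintro ⟨x, y⟩ hxy
    have : x = y := hxy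
    simp [U, this, hε]
  have h1 := NNReal.tendsto_coe.2 (h g U hU hdiag ε hε)
  have h2 : ∀ᶠ k in (ω : Filter ℕ), 1 - ε < (μ k {φ | 1 - ε <
      (unif {j | (φ (σ k g j), act g (φ j)) ∈ U}).toReal} : ℝ) :=
    h1.eventually_const_lt (by simpa using hε)
  filter_upwards [h2] with k hk
  set S := {φ : Fin (d k) → E | 1 - ε < (unif {j | (φ (σ k g j), act g (φ j)) ∈ U}).toReal}
    with hS
  have hSm : MeasurableSet S := measurableSet_goodMaps (act g) (σ k g) hU ε
  have hpt : ∀ φ : Fin (d k) → E, avg (fun j => distMap E (φ (σ k g j), act g (φ j)))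
      ≤ (ε + |M| * ε) + |M| * Sᶜ.indicator (fun _ => 1) φ := by
    intro φ
    by_cases hφ : φ ∈ S
    · rw [Set.indicator_of_notMem (by simpa using hφ), mul_zero, add_zero]
      have e1 : ∀ j, distMap E (φ (σ k g j), act g (φ j)) ≤ ε + |M| *
          ({j | (φ (σ k g j), act g (φ j)) ∈ U}ᶜ : Set (Fin (d k))).indicator (fun _ => (1 : ℝ)) j := by
        intro j
        by_cases hj : (φ (σ k g j), act g (φ j)) ∈ U
        · rw [Set.indicator_of_notMem (by simpa using hj), mul_zero, add_zero]
          exact le_of_lt hj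
        · rw [Set.indicator_of_mem (by simpa using hj), mul_one]
          linarith [hM' (φ (σ k g j), act g (φ j))]
      refine (avg_mono e1).trans ?_
      rw [avg_add, avg_const (hd k), avg_const_mul, one_sub_unif (hd k)]
      have : 1 - ε < (unif {j | (φ (σ k g j), act g (φ j)) ∈ U}).toReal := hφ
      gcongr
      linarith
    · rw [Set.indicator_of_mem (by simpa using hφ), mul_one]
      have : avg (fun j => distMap E (φ (σ k g j), act g (φ j))) ≤ |M| :=
        (avg_mono fun j => hM' _).trans (avg_const (hd k) _).le
      have : 0 ≤ ε + |M| * ε := by positivity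
      linarith
  have hint : Integrable (Sᶜ.indicator fun _ => (1 : ℝ)) (μ k : Measure (Fin (d k) → E)) :=
    (integrable_const (1 : ℝ)).indicator hSm.compl
  have h3 := integral_mono (μ := (μ k : Measure (Fin (d k) → E)))
    (integrable_of_continuous _ (continuous_pairAvg (distMap E) (act g) (σ k g)))
    ((integrable_const (ε + |M| * ε)).add (hint.const_mul |M|)) hpt
  rw [integral_add' (integrable_const _) (hint.const_mul _), integral_const_mul,
    integral_indicator_const _ hSm.compl, probReal_compl_eq_one_sub hSm] at h3
  simp only [integral_const, probReal_univ, smul_eq_mul, one_mul, mul_one,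
    ProbabilityMeasure.measureReal_eq_coe_coeFn] at h3
  rw [Real.dist_eq, sub_zero, abs_of_nonneg (defect_nonneg (fun p => dist_nonneg) _ _ _)]
  refine lt_of_le_of_lt h3 (lt_of_le_of_lt ?_ hεε)
  have : |M| * (1 - (μ k S : ℝ)) ≤ |M| * ε := by gcongr; linarith
  linarith

/-- A cost vanishing on the diagonal is dominated by ε plus a multiple of the distance. -/
theorem AsympSupported.tendsto_defect (hd : ∀ k, 0 < d k)
    (h : AsympSupported (fun g => act g) σ ω μ) (g : G) {c : C(E × E, ℝ)} (hc : ∀ p, 0 ≤ c p)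
    (hc0 : ∀ x, c (x, x) = 0) :
    Tendsto (fun k => defect c (act g) (σ k g) (μ k)) ω (𝓝 0) := by
  refine Metric.tendsto_nhds.2 fun ε hε => ?_
  obtain ⟨C, hC, hle⟩ := exists_le_add_mul (distMap E).continuous c.continuous
    (fun p => dist_nonneg) (fun p hp => by
      have : p.1 = p.2 := dist_eq_zero.1 hp
      have h2 : p = (p.1, p.1) := Prod.ext rfl this.symm
      rw [h2, hc0]) (half_pos hε)
  have h1 := (h.tendsto_defect_dist hd g).const_mul C
  rw [mul_zero] at h1
  filter_upwards [h1.eventually_lt_const (half_pos hε)] with k hk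
  rw [Real.dist_eq, sub_zero, abs_of_nonneg (defect_nonneg hc _ _ _)]
  have := defect_le hle (act g) (hd k) (σ k g) (μ k)
  linarith

/-- Two applications of Markov's inequality: U contains the pairs closer than some δ, so a map with
at least a proportion ε of bad indices has average distance at least εδ, and such maps have measure
at most the defect over εδ. -/
theorem asympSupported_of_tendsto_defect (hd : ∀ k, 0 < d k)
    (h : ∀ g, Tendsto (fun k => defect (distMap E) (act g) (σ k g) (μ k)) ω (𝓝 0)) :
    AsympSupported (fun g => act g) σ ω μ := by
  intro g U hU hdiag ε hε
  obtain ⟨δ, hδ, hδU⟩ : ∃ δ > 0, ∀ x y : E, dist x y < δ → (x, y) ∈ U := by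
    have : U ∈ uniformity E := by
      rw [← nhdsSet_diagonal_eq_uniformity]
      exact hU.mem_nhdsSet.2 hdiag
    obtain ⟨δ, hδ, h⟩ := Metric.mem_uniformity_dist.1 this
    exact ⟨δ, hδ, fun x y hxy => h hxy⟩
  rw [← NNReal.tendsto_coe]
  have hlim := ((h g).div_const (ε * δ)).const_sub 1
  rw [zero_div, sub_zero] at hlim
  refine tendsto_of_tendsto_of_tendsto_of_le_of_le hlim tendsto_const_nhds (fun k => ?_) fun k => ?_
  · set S := {φ : Fin (d k) → E | 1 - ε < (unif {j | (φ (σ k g j), act g (φ j)) ∈ U}).toReal}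
      with hS
    have hSm : MeasurableSet S := measurableSet_goodMaps (act g) (σ k g) hU ε
    have hsub : Sᶜ ⊆ {φ | ε * δ ≤ avg fun j => distMap E (φ (σ k g j), act g (φ j))} := by
      intro φ hφ
      have h1 : (unif {j | (φ (σ k g j), act g (φ j)) ∈ U}).toReal ≤ 1 - ε := not_lt.1 hφ
      have h2 : ∀ j, δ * ({j | (φ (σ k g j), act g (φ j)) ∈ U}ᶜ :
          Set (Fin (d k))).indicator (fun _ => (1 : ℝ)) j
            ≤ distMap E (φ (σ k g j), act g (φ j)) := by
        intro j
        by_cases hj : (φ (σ k g j), act g (φ j)) ∈ U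
        · rw [Set.indicator_of_notMem (by simpa using hj), mul_zero]
          exact dist_nonneg
        · rw [Set.indicator_of_mem (by simpa using hj), mul_one]
          exact not_lt.1 fun hlt => hj (hδU _ _ hlt)
      have h3 := avg_mono h2
      rw [avg_const_mul, one_sub_unif (hd k)] at h3
      refine le_trans ?_ h3
      rw [mul_comm]
      gcongr
      linarith
    have h4 := mul_meas_ge_le_integral_of_nonneg (μ := (μ k : Measure (Fin (d k) → E)))
      (.of_forall fun φ => avg_nonneg fun j => dist_nonneg)
      (integrable_of_continuous _ (continuous_pairAvg (distMap E) (act g) (σ k g))) (ε * δ)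
    have h5 : (μ k : Measure (Fin (d k) → E)).real Sᶜ ≤ _ := measureReal_mono hsub
    have h6 := probReal_compl_eq_one_sub hSm (μ := (μ k : Measure (Fin (d k) → E)))
    have h7 : (μ k : Measure (Fin (d k) → E)).real Sᶜ
        ≤ defect (distMap E) (act g) (σ k g) (μ k) / (ε * δ) := by
      rw [le_div_iff₀ (by positivity), mul_comm]
      exact (mul_le_mul_of_nonneg_left h5 (by positivity)).trans h4
    simp only [ProbabilityMeasure.measureReal_eq_coe_coeFn] at h6 h7
    linarith
  · exact_mod_cast ProbabilityMeasure.apply_le_one _ _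

/-- This replaces neighbourhoods and proportions by a quantity affine in the measure, which makes
stability under midpoints, relabelling and convolution accessible. -/
theorem asympSupported_iff (hd : ∀ k, 0 < d k) : AsympSupported (fun g => act g) σ ω μ ↔
    ∀ g, Tendsto (fun k => defect (distMap E) (act g) (σ k g) (μ k)) ω (𝓝 0) :=
  ⟨fun h => h.tendsto_defect_dist hd, asympSupported_of_tendsto_defect hd⟩

/-! ### Marginals -/

theorem marginal_mix {n : ℕ} (μ ν : ProbabilityMeasure (Fin n → E)) (j : Fin n) :
    marginal (mix μ ν) j = mix (marginal μ j) (marginal ν j) := by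
  refine probabilityMeasure_ext fun f => ?_
  have hf : ∀ μ : ProbabilityMeasure (Fin n → E),
      Integrable (fun φ => f (φ j)) (μ : Measure (Fin n → E)) := fun μ =>
    integrable_of_continuous _ (by fun_prop)
  rw [integral_mix_continuousMap, integral_marginal, integral_marginal, integral_marginal,
    integral_mix _ _ (hf μ) (hf ν)]

theorem defect_mix (c : C(E × E, ℝ)) (a : C(E, E)) {n : ℕ} (s : Equiv.Perm (Fin n))
    (μ ν : ProbabilityMeasure (Fin n → E)) :
    defect c a s (mix μ ν) = 2⁻¹ * defect c a s μ + 2⁻¹ * defect c a s ν :=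
  integral_mix _ _ (integrable_of_continuous _ (continuous_pairAvg c a s))
    (integrable_of_continuous _ (continuous_pairAvg c a s))

theorem AsympSupported.mix {ν : ∀ k, ProbabilityMeasure (Fin (d k) → E)} (hd : ∀ k, 0 < d k)
    (hμ : AsympSupported (fun g => act g) σ ω μ) (hν : AsympSupported (fun g => act g) σ ω ν) :
    AsympSupported (fun g => act g) σ ω fun k => mix (μ k) (ν k) := by
  rw [asympSupported_iff hd] at *
  intro g
  simp only [defect_mix]
  simpa using ((hμ g).const_mul 2⁻¹).add ((hν g).const_mul 2⁻¹)

/-- The image of a measure on `E ^ n` under the relabelling `φ ↦ φ ∘ τ`. -/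
def relabel {n : ℕ} (τ : Equiv.Perm (Fin n)) (μ : ProbabilityMeasure (Fin n → E)) :
    ProbabilityMeasure (Fin n → E) :=
  μ.map (f := fun φ => φ ∘ τ) (by fun_prop : Continuous fun φ : Fin n → E => φ ∘ τ).aemeasurable

theorem integral_relabel {n : ℕ} (τ : Equiv.Perm (Fin n)) (μ : ProbabilityMeasure (Fin n → E))
    {f : (Fin n → E) → ℝ} (hf : Continuous f) :
    ∫ φ, f φ ∂(relabel τ μ : Measure (Fin n → E))
      = ∫ φ, f (φ ∘ τ) ∂(μ : Measure (Fin n → E)) := by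
  rw [relabel, ProbabilityMeasure.toMeasure_map, integral_map
    (by fun_prop : Continuous fun φ : Fin n → E => φ ∘ τ).aemeasurable hf.aestronglyMeasurable]

theorem marginal_relabel {n : ℕ} (τ : Equiv.Perm (Fin n)) (μ : ProbabilityMeasure (Fin n → E))
    (j : Fin n) : marginal (relabel τ μ) j = marginal μ (τ j) := by
  refine probabilityMeasure_ext fun f => ?_
  rw [integral_marginal, integral_marginal, integral_relabel τ μ (by fun_prop)]
  rfl

theorem avg_ne {n : ℕ} (p q : Equiv.Perm (Fin n)) :
    avg (fun j => if p j = q j then 0 else 1) = hamm p q := by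
  rw [avg, hamm, hammingDist]
  congr 1
  rw [Finset.card_eq_sum_ones, Finset.sum_filter]
  push_cast
  exact Finset.sum_congr rfl fun j _ => by split_ifs <;> simp_all

/-- After reindexing the average by τ, the integrands differ only where τ s and s τ disagree, and
there by at most M. -/
theorem defect_relabel_le {M : ℝ} (hM : ∀ p, distMap E p ≤ M) (a : C(E, E)) {n : ℕ}
    (s τ : Equiv.Perm (Fin n)) (μ : ProbabilityMeasure (Fin n → E)) :
    defect (distMap E) a s (relabel τ μ)
      ≤ defect (distMap E) a s μ + M * hamm (τ * s) (s * τ) := by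
  rw [defect, integral_relabel τ μ (continuous_pairAvg _ a s)]
  have hpt : ∀ φ : Fin n → E, avg (fun j => distMap E ((φ ∘ τ) (s j), a ((φ ∘ τ) j)))
      ≤ avg (fun j => distMap E (φ (s j), a (φ j))) + M * hamm (τ * s) (s * τ) := by
    intro φ
    rw [← avg_comp_perm τ fun j => distMap E (φ (s j), a (φ j)), ← avg_ne, ← avg_const_mul,
      ← avg_add]
    refine avg_mono fun j => ?_
    by_cases hj : (τ * s) j = (s * τ) j
    · rw [if_pos hj, mul_zero, add_zero]
      have : τ (s j) = s (τ j) := hj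
      simp [this]
    · rw [if_neg hj, mul_one]
      have h0 : 0 ≤ distMap E (φ (s (τ j)), a (φ (τ j))) := dist_nonneg
      have h1 := hM ((φ ∘ τ) (s j), a ((φ ∘ τ) j))
      linarith
  have hc := continuous_pairAvg (distMap E) a s
  have hc2 : Continuous fun φ : Fin n → E =>
      avg fun j => distMap E ((φ ∘ τ) (s j), a ((φ ∘ τ) j)) :=
    hc.comp (by fun_prop : Continuous fun φ : Fin n → E => φ ∘ τ)
  refine (integral_mono_of_continuous _ hc2 (by fun_prop) hpt).trans (le_of_eq ?_)
  rw [integral_add_of_continuous _ (by fun_prop) (by fun_prop)]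
  simp [defect]

/-- Relabelling by permutations that asymptotically commute with the sofic approximation preserves
asymptotic support on microstates. -/
theorem AsympSupported.relabel (hd : ∀ k, 0 < d k)
    (hμ : AsympSupported (fun g => act g) σ ω μ) {τ : ∀ k, Equiv.Perm (Fin (d k))}
    (hτ : ∀ g, Tendsto (fun k => hamm (τ k * σ k g) (σ k g * τ k)) ω (𝓝 0)) :
    AsympSupported (fun g => act g) σ ω fun k => relabel (τ k) (μ k) := by
  rw [asympSupported_iff hd] at *
  intro g
  obtain ⟨M, hM⟩ := exists_abs_le (distMap E).continuous
  have hM' : ∀ p, distMap E p ≤ M := fun p => (le_abs_self _).trans (hM p)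
  refine squeeze_zero (fun k => defect_nonneg (fun p => dist_nonneg) _ _ _)
    (fun k => defect_relabel_le hM' (act g) (σ k g) (τ k) (μ k)) ?_
  simpa using (hμ g).add ((hτ g).const_mul M)

/-- The marginals of measures that are asymptotically supported on microstates are asymptotically
equivariant. -/
theorem AsympSupported.ultraFun_marginal_equivariant (hd : ∀ k, 0 < d k)
    (hω : (ω : Filter ℕ) ≤ cofinite) (hμ : AsympSupported (fun g => act g) σ ω μ) (g : G) :
    ∀ᵐ z ∂loebMeasure d ω, ultraFun ω (fun k => marginal (μ k)) (permAct ω (fun k => σ k g) z)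
      = (ultraFun ω (fun k => marginal (μ k)) z).map
        (act g).continuous.measurable.aemeasurable := by
  have h1 : ultraFun ω (fun k j => marginal (μ k) (σ k g j)) =ᵐ[loebMeasure d ω]
      ultraFun ω fun k j => (marginal (μ k) j).map (act g).continuous.measurable.aemeasurable := by
    refine ultraFun_ae_eq hd hω fun f => ?_
    let c : C(E × E, ℝ) := ⟨fun p => |f p.1 - f p.2|, by fun_prop⟩
    refine squeeze_zero (fun k => avg_nonneg fun j => abs_nonneg _) (fun k => ?_)
      (hμ.tendsto_defect hd g (c := c) (fun p => abs_nonneg _) fun x => by simp [c])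
    have h2 : ∀ j, |∫ x, f x ∂(marginal (μ k) (σ k g j) : Measure E)
        - ∫ x, f x ∂((marginal (μ k) j).map (act g).continuous.measurable.aemeasurable : Measure E)|
          ≤ ∫ φ, c (φ (σ k g j), act g (φ j)) ∂(μ k : Measure (Fin (d k) → E)) := by
      intro j
      rw [ProbabilityMeasure.toMeasure_map, integral_map
        (act g).continuous.measurable.aemeasurable f.continuous.aestronglyMeasurable,
        integral_marginal]
      have h3 := integral_marginal (μ k) j (f.comp (act g))
      simp only [ContinuousMap.comp_apply] at h3
      rw [h3, ← integral_sub_of_continuous _ (by fun_prop) (by fun_prop)]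
      exact abs_integral_le_integral_abs
    refine (avg_mono h2).trans (le_of_eq ?_)
    simp only [defect, avg]
    rw [integral_div, integral_finsetSum]
    exact fun j _ => integrable_of_continuous _ (by fun_prop)
  filter_upwards [h1] with z hz
  rw [ultraFun_permAct, hz, ultraFun_comp (g := fun ν : ProbabilityMeasure E =>
    ν.map (act g).continuous.measurable.aemeasurable)
    (ProbabilityMeasure.continuous_map (act g).continuous)]

end Defect

/-! ### Algebraic actions -/

theorem tendsto_hamm_of_mem_soficCentralizer {G : Type*} {d : ℕ → ℕ} {ω : Ultrafilter ℕ}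
    {σ : ∀ k, G → Equiv.Perm (Fin (d k))} {τ : ∀ k, Equiv.Perm (Fin (d k))}
    (h : (QuotientGroup.mk τ : PermUltraproduct d ω) ∈ soficCentralizer σ ω) (g : G) :
    Tendsto (fun k => hamm (τ k * σ k g) (σ k g * τ k)) ω (𝓝 0) := by
  have h1 := Subgroup.mem_centralizer_iff.1 h _ ⟨g, rfl⟩
  have h2 : (QuotientGroup.mk (fun k => σ k g * τ k) : PermUltraproduct d ω)
      = QuotientGroup.mk fun k => τ k * σ k g := h1
  have h3 : Tendsto (fun k => hamm ((σ k g * τ k)⁻¹ * (τ k * σ k g)) 1) ω (𝓝 0) :=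
    QuotientGroup.eq.1 h2
  refine h3.congr fun k => ?_
  rw [← hamm_mul_left (σ k g * τ k), mul_inv_cancel_left, mul_one]

theorem IsMaximalElement.ae_eq {G : Type*} {X : Type*} [Group X] [MetricSpace X]
    [CompactSpace X] [IsTopologicalGroup X] [MeasurableSpace X] [BorelSpace X] [SMul G X]
    {d : ℕ → ℕ} {ω : Ultrafilter ℕ} {σ : ∀ k, G → Equiv.Perm (Fin (d k))} {Y Y' : LoebSpace d ω → ClosedSubgroup X}
    (hY : IsMaximalElement G X σ ω Y) (hY' : IsMaximalElement G X σ ω Y') :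
    Y =ᵐ[loebMeasure d ω] Y' := by
  filter_upwards [hY.2 Y' hY'.1, hY'.2 Y hY.1] with z h1 h2 using le_antisymm h2 h1

/-- The transformation `x ↦ g • x` as a continuous map. -/
def actMap {G : Type*} (X : Type*) [TopologicalSpace X] [SMul G X] [ContinuousConstSMul G X] (g : G) :
    C(X, X) := ⟨fun x => g • x, continuous_const_smul g⟩

/-- The constant map 1 is an exact microstate because automorphisms fix 1. The minimization problem
below thus has a candidate. -/
theorem asympSupported_dirac_one {G : Type*} [Group G] {X : Type*} [Group X] [MetricSpace X]
    [CompactSpace X] [MeasurableSpace X] [BorelSpace X] [MulDistribMulAction G X]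
    [ContinuousConstSMul G X] {d : ℕ → ℕ} {ω : Ultrafilter ℕ}
    {σ : ∀ k, G → Equiv.Perm (Fin (d k))} (hd : ∀ k, 0 < d k) :
    AsympSupported (fun g => actMap (G := G) X g) σ ω
      fun _ => diracProba 1 := by
  rw [asympSupported_iff hd]
  intro g
  refine tendsto_const_nhds.congr fun k => ?_
  rw [defect, diracProba, ProbabilityMeasure.coe_mk, integral_dirac]
  simp [avg, distMap, actMap]

/-! ### Convolution of microstates and absorption -/

section Algebraic

variable {G : Type*} [Group G] {X : Type*} [Group X] [MetricSpace X] [CompactSpace X]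
  [IsTopologicalGroup X] [MeasurableSpace X] [BorelSpace X] [MulDistribMulAction G X]
  [ContinuousConstSMul G X]

theorem marginal_conv {n : ℕ} (μ ν : ProbabilityMeasure (Fin n → X)) (j : Fin n) :
    marginal (conv μ ν) j = conv (marginal μ j) (marginal ν j) := by
  refine probabilityMeasure_ext fun f => ?_
  obtain ⟨C, hC⟩ := exists_abs_le f.continuous
  rw [integral_marginal, integral_conv_continuousMap,
    integral_conv μ ν (f := fun φ => f (φ j)) (by fun_prop) fun φ => hC _]
  have h1 := integral_marginal μ j (smear f (marginal ν j))
  simp only [smear_apply] at h1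
  rw [h1]
  refine integral_congr_ae (.of_forall fun φ => ?_)
  have h2 := integral_marginal ν j (f.comp ⟨fun y => φ j * y, by fun_prop⟩)
  simp only [ContinuousMap.comp_apply, ContinuousMap.coe_mk] at h2
  simp only [Pi.mul_apply]
  rw [h2]

/-- Uniform continuity of multiplication, phrased as a domination on X⁴. The constant depends on X
and ε only, not on n or the measures, so the estimate can be used along k → ω. -/
theorem exists_defect_conv_le (X : Type*) [Group X] [MetricSpace X] [CompactSpace X]
    [IsTopologicalGroup X] [MeasurableSpace X] [BorelSpace X] {ε : ℝ} (hε : 0 < ε) :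
    ∃ C, 0 ≤ C ∧ ∀ (a : C(X, X)) (_ : ∀ x y, a (x * y) = a x * a y) (n : ℕ) (_ : 0 < n)
      (s : Equiv.Perm (Fin n)) (μ ν : ProbabilityMeasure (Fin n → X)),
      defect (distMap X) a s (conv μ ν)
        ≤ ε + C * (defect (distMap X) a s μ + defect (distMap X) a s ν) := by
  obtain ⟨C, hC, hle⟩ := exists_le_add_mul
    (T := (X × X) × (X × X))
    (a := fun q => distMap X q.1 + distMap X q.2)
    (b := fun q => distMap X (q.1.1 * q.2.1, q.1.2 * q.2.2)) (by fun_prop) (by fun_prop)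
    (fun q => add_nonneg dist_nonneg dist_nonneg) (fun q hq => by
      have h1 : 0 ≤ dist q.1.1 q.1.2 := dist_nonneg
      have h2 : 0 ≤ dist q.2.1 q.2.2 := dist_nonneg
      have h3 : dist q.1.1 q.1.2 + dist q.2.1 q.2.2 = 0 := hq
      have h4 : q.1.1 = q.1.2 := dist_eq_zero.1 (by linarith)
      have h5 : q.2.1 = q.2.2 := dist_eq_zero.1 (by linarith)
      rw [h4, h5, distMap_apply, dist_self]) hε
  refine ⟨C, hC, fun a ha n hn s μ ν => ?_⟩
  have hc := continuous_pairAvg (distMap X) a s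
  obtain ⟨B, hB⟩ := exists_abs_le hc
  rw [defect, integral_conv μ ν hc.measurable hB]
  have hpt : ∀ φ ψ : Fin n → X, avg (fun j => distMap X ((φ * ψ) (s j), a ((φ * ψ) j)))
      ≤ ε + C * (avg (fun j => distMap X (φ (s j), a (φ j)))
        + avg (fun j => distMap X (ψ (s j), a (ψ j)))) := by
    intro φ ψ
    rw [← avg_add, ← avg_const_mul, ← avg_const hn ε, ← avg_add]
    refine avg_mono fun j => ?_
    rw [Pi.mul_apply, Pi.mul_apply, ha]
    exact hle ((φ (s j), a (φ j)), (ψ (s j), a (ψ j)))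
  have h2 : ∀ φ : Fin n → X,
      ∫ ψ, avg (fun j => distMap X ((φ * ψ) (s j), a ((φ * ψ) j))) ∂(ν : Measure (Fin n → X))
        ≤ ε + C * (avg (fun j => distMap X (φ (s j), a (φ j))) + defect (distMap X) a s ν) := by
    intro φ
    have hc2 : Continuous fun ψ : Fin n → X =>
        avg (fun j => distMap X ((φ * ψ) (s j), a ((φ * ψ) j))) :=
      hc.comp (by fun_prop : Continuous fun ψ : Fin n → X => φ * ψ)
    refine (integral_mono_of_continuous _ hc2 (by fun_prop) (hpt φ)).trans (le_of_eq ?_)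
    rw [integral_add_of_continuous _ (by fun_prop) (by fun_prop), integral_const_mul,
      integral_add_of_continuous _ (by fun_prop) (by fun_prop)]
    simp [defect]
  have hc3 : Continuous fun φ : Fin n → X =>
      ∫ ψ, avg (fun j => distMap X ((φ * ψ) (s j), a ((φ * ψ) j))) ∂(ν : Measure (Fin n → X)) := by
    have := continuous_parametric_integral_of_continuous (μ := (ν : Measure (Fin n → X)))
      (f := fun φ ψ : Fin n → X => avg (fun j => distMap X ((φ * ψ) (s j), a ((φ * ψ) j))))
      (hc.comp (by fun_prop : Continuous fun q : (Fin n → X) × (Fin n → X) => q.1 * q.2))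
      isCompact_univ
    simpa using this
  refine (integral_mono_of_continuous _ hc3 (by fun_prop) h2).trans (le_of_eq ?_)
  rw [integral_add_of_continuous _ (by fun_prop) (by fun_prop), integral_const_mul,
    integral_add_of_continuous _ (by fun_prop) (by fun_prop)]
  simp [defect]

variable {d : ℕ → ℕ} {ω : Ultrafilter ℕ} {σ : ∀ k, G → Equiv.Perm (Fin (d k))}
  {μ ν : ∀ k, ProbabilityMeasure (Fin (d k) → X)}

/-- Convolutions of measures that are asymptotically supported on microstates of an algebraic
action are asymptotically supported on microstates. -/
theorem AsympSupported.conv (hd : ∀ k, 0 < d k)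
    (hμ : AsympSupported (fun g => actMap (G := G) X g) σ ω μ)
    (hν : AsympSupported (fun g => actMap (G := G) X g) σ ω ν) :
    AsympSupported (fun g => actMap (G := G) X g) σ ω fun k => conv (μ k) (ν k) := by
  rw [asympSupported_iff hd] at *
  intro g
  refine Metric.tendsto_nhds.2 fun ε hε => ?_
  obtain ⟨C, hC, hle⟩ := exists_defect_conv_le X (half_pos hε)
  have h1 := ((hμ g).add (hν g)).const_mul C
  rw [add_zero, mul_zero] at h1
  filter_upwards [h1.eventually_lt_const (half_pos hε)] with k hk
  rw [Real.dist_eq, sub_zero, abs_of_nonneg (defect_nonneg (fun p => dist_nonneg) _ _ _)]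
  have := hle (actMap X g) (fun x y => smul_mul' g x y) (d k) (hd k) (σ k g) (μ k) (ν k)
  linarith

/-- There is a sequence of measures, asymptotically supported on microstates, whose marginals
absorb the marginals of all other such sequences. -/
theorem exists_absorbing [Countable G] (hd : ∀ k, 0 < d k) (hω : (ω : Filter ℕ) ≤ cofinite)
    (σ : ∀ k, G → Equiv.Perm (Fin (d k))) :
    ∃ μ : ∀ k, ProbabilityMeasure (Fin (d k) → X),
      AsympSupported (fun g => actMap (G := G) X g) σ ω μ ∧
      ∀ ν, AsympSupported (fun g => actMap (G := G) X g) σ ω ν →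
        ∀ᵐ z ∂loebMeasure d ω, conv (ultraFun ω (fun k => marginal (ν k)) z)
          (ultraFun ω (fun k => marginal (μ k)) z) = ultraFun ω (fun k => marginal (μ k)) z := by
  obtain ⟨J, hJc, hJ0, hJle, hJeq⟩ := exists_strict_functional (X := X)
  obtain ⟨e, he⟩ := exists_surjective_nat G
  let S : Set (∀ k, ProbabilityMeasure (Fin (d k) → X)) :=
    {μ | AsympSupported (fun g => actMap (G := G) X g) σ ω μ}
  let I : (∀ k, ProbabilityMeasure (Fin (d k) → X)) → ℝ := fun μ =>
    ∫ z, J (ultraFun ω (fun k => marginal (μ k)) z) ∂loebMeasure d ω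
  have hI : ∀ μ, Tendsto (fun k => avg fun j => J (marginal (μ k) j)) ω (𝓝 (I μ)) := fun μ =>
    tendsto_avg_ultraFun hd hω hJc _
  have hne : (I '' S).Nonempty := ⟨_, _, asympSupported_dirac_one hd, rfl⟩
  have hbdd : BddBelow (I '' S) := ⟨0, by
    rintro _ ⟨μ, _, rfl⟩
    exact integral_nonneg fun z => hJ0 _⟩
  set s := sInf (I '' S) with hs
  have hnonempty : ∀ k, Nonempty (ProbabilityMeasure (Fin (d k) → X)) := fun _ =>
    ⟨diracProba 1⟩
  -- Precision 1/(n + 1) on the elements of index at most n of an enumeration of G, together with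
  -- near-minimality of J. Near-minimizing sequences make each condition satisfiable, and saturation
  -- turns them into one exact minimizer.
  let R : ℕ → ∀ k, Set (ProbabilityMeasure (Fin (d k) → X)) := fun n k =>
    {μ | (∀ i ≤ n, defect (distMap X) (actMap X (e i)) (σ k (e i)) μ < 1 / ((n : ℝ) + 1)) ∧
      avg (fun j => J (marginal μ j)) < s + 1 / ((n : ℝ) + 1)}
  obtain ⟨μ, hμ⟩ := exists_saturated hω R (fun k n m hnm μ hμ => by
      have hle : 1 / ((m : ℝ) + 1) ≤ 1 / ((n : ℝ) + 1) :=
        one_div_le_one_div_of_le (by positivity) (by simpa using hnm)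
      exact ⟨fun i hi => (hμ.1 i (hi.trans hnm)).trans_le hle, hμ.2.trans_le (by linarith)⟩)
    (fun n => by
      have hpos : 0 < 1 / ((n : ℝ) + 1) := by positivity
      obtain ⟨_, ⟨μ, hμS, rfl⟩, hlt⟩ := exists_lt_of_csInf_lt hne (lt_add_of_pos_right s hpos)
      have h1 : ∀ᶠ k in (ω : Filter ℕ), ∀ i ∈ Finset.range (n + 1),
          defect (distMap X) (actMap X (e i)) (σ k (e i)) (μ k) < 1 / ((n : ℝ) + 1) := by
        rw [eventually_all_finset]
        exact fun i _ => (hμS.tendsto_defect_dist hd (e i)).eventually_lt_const hpos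
      filter_upwards [h1, (hI μ).eventually_lt_const hlt] with k hk1 hk2
      exact ⟨μ k, fun i hi => hk1 i (Finset.mem_range.2 (by omega)), hk2⟩)
  have hsmall : ∀ ε : ℝ, 0 < ε → ∃ n : ℕ, 1 / ((n : ℝ) + 1) < ε := fun ε hε =>
    exists_nat_one_div_lt hε
  have hμS : AsympSupported (fun g => actMap (G := G) X g) σ ω μ := by
    rw [asympSupported_iff hd]
    intro g
    obtain ⟨i, rfl⟩ := he g
    refine Metric.tendsto_nhds.2 fun ε hε => ?_
    obtain ⟨n, hn⟩ := hsmall ε hε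
    -- The index i puts `e i` among the controlled elements, and n gives the precision.
    filter_upwards [hμ (max i n)] with k hk
    rw [Real.dist_eq, sub_zero, abs_of_nonneg (defect_nonneg (fun p => dist_nonneg) _ _ _)]
    refine (hk.1 i (le_max_left _ _)).trans_le (le_trans ?_ hn.le)
    exact one_div_le_one_div_of_le (by positivity) (by simp)
  have hIμ : I μ ≤ s := by
    refine le_of_forall_pos_le_add fun ε hε => ?_
    obtain ⟨n, hn⟩ := hsmall ε hε
    refine le_of_tendsto (hI μ) ((hμ n).mono fun k hk => ?_)
    exact hk.2.le.trans (by linarith)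
  refine ⟨μ, hμS, fun ν hν => ?_⟩
  -- The competitor is the midpoint of μ and ν * μ. Minimality bounds its integral from below, while
  -- J cannot increase pointwise, so the nonnegative pointwise drop has integral zero.
  have hmix := hμS.mix hd (hν.conv hd hμS)
  have hge : s ≤ I _ := csInf_le hbdd ⟨_, hmix, rfl⟩
  have hgc : Continuous fun p : ProbabilityMeasure X × ProbabilityMeasure X =>
      J p.2 - J (mix p.2 (LocalWeak.conv p.1 p.2)) :=
    (hJc.comp continuous_snd).sub
      (hJc.comp (continuous_mix.comp (continuous_snd.prodMk continuous_conv)))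
  have hg0 : ∀ p : ProbabilityMeasure X × ProbabilityMeasure X,
      0 ≤ J p.2 - J (mix p.2 (LocalWeak.conv p.1 p.2)) := fun p => sub_nonneg.2 (hJle _ _)
  have hlim : Tendsto (fun k => avg fun j => J (marginal (μ k) j)
      - J (mix (marginal (μ k) j) (LocalWeak.conv (marginal (ν k) j) (marginal (μ k) j)))) ω
      (𝓝 0) := by
    have h1 := (hI μ).sub (hI fun k => mix (μ k) (LocalWeak.conv (ν k) (μ k)))
    have h2 : ∀ k, (avg fun j => J (marginal (μ k) j))
        - (avg fun j => J (marginal (mix (μ k) (LocalWeak.conv (ν k) (μ k))) j))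
        = avg fun j => J (marginal (μ k) j)
          - J (mix (marginal (μ k) j) (LocalWeak.conv (marginal (ν k) j) (marginal (μ k) j))) := by
      intro k
      simp only [marginal_mix, marginal_conv, sub_eq_add_neg]
      rw [avg_add, ← neg_one_mul (avg _), ← avg_const_mul]
      simp only [neg_one_mul]
    simp only [h2] at h1
    have h3 : 0 ≤ I μ - I fun k => mix (μ k) (LocalWeak.conv (ν k) (μ k)) :=
      ge_of_tendsto h1 (.of_forall fun k => avg_nonneg fun j =>
        hg0 (marginal (ν k) j, marginal (μ k) j))
    have h4 : I μ - I (fun k => mix (μ k) (LocalWeak.conv (ν k) (μ k))) = 0 := by linarith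
    rwa [h4] at h1
  have hae := (ae_ultraFun_eq_zero_iff hd hω hgc hg0
    fun k j => (marginal (ν k) j, marginal (μ k) j)).2 hlim
  filter_upwards [hae] with z hz
  rw [ultraFun_prodMk] at hz
  exact hJeq _ _ (by linarith)

/-! ### The maximal element -/

/-- The random subgroup `Y` is represented by the marginals of `μ`, and its Haar measure absorbs
all marginals of measures that are asymptotically supported on microstates. -/
theorem exists_maximalElement [Countable G] (hd : ∀ k, 0 < d k) (hω : (ω : Filter ℕ) ≤ cofinite)
    (σ : ∀ k, G → Equiv.Perm (Fin (d k))) :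
    ∃ Y : LoebSpace d ω → ClosedSubgroup X, IsMaximalElement G X σ ω Y ∧
      ∀ ν, AsympSupported (fun (g : G) (x : X) => g • x) σ ω ν →
        ∀ᵐ z ∂loebMeasure d ω, conv (ultraFun ω (fun k => marginal (ν k)) z) (haarOn (Y z))
          = haarOn (Y z) := by
  obtain ⟨μ, hμ, habs⟩ := exists_absorbing (X := X) hd hω σ
  have hnonempty : Nonempty (ClosedSubgroup X) := ⟨stab (haarProb X)⟩
  -- A measurable left inverse of K ↦ m_K on all of Prob(X) makes the resulting Y measurable,
  -- without discussing measurability of the stabilizer.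
  obtain ⟨r, hr, hrh⟩ := measurableEmbedding_haarOn.exists_measurable_extend
    (measurable_id (α := ClosedSubgroup X)) fun _ => hnonempty
  set Ψ := ultraFun (T := ProbabilityMeasure X) ω (fun k => marginal (μ k)) with hΨ
  have hY : ∀ᵐ z ∂loebMeasure d ω, haarOn (r (Ψ z)) = Ψ z := by
    filter_upwards [habs μ hμ] with z hz
    have h1 : Ψ z = haarOn (stab (Ψ z)) := eq_haarOn_of_conv_self hz
    have h2 : r (haarOn (stab (Ψ z))) = stab (Ψ z) := congrFun hrh _
    rw [h1, h2]
  have habs' : ∀ ν, AsympSupported (fun (g : G) (x : X) => g • x) σ ω ν →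
      ∀ᵐ z ∂loebMeasure d ω, conv (ultraFun ω (fun k => marginal (ν k)) z) (haarOn (r (Ψ z)))
        = haarOn (r (Ψ z)) := by
    intro ν hν
    filter_upwards [habs ν hν, hY] with z h1 h2
    rw [h2]
    exact h1
  have hm : Measurable fun z => r (Ψ z) := hr.comp (measurable_ultraFun _)
  refine ⟨fun z => r (Ψ z), ⟨⟨hm, measurable_haarOn.comp hm, μ, hμ, hY⟩, ?_⟩, habs'⟩
  rintro Y' ⟨_, _, ν, hν, hYν⟩
  filter_upwards [habs' ν hν, hYν] with z h1 h2
  refine le_of_ae_haarOn ?_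
  rw [h2]
  have := ae_mem_stab h1
  rwa [stab_haarOn] at this

/-- The Haar measures of the maximal element absorb all marginals of measures that are
asymptotically supported on microstates. -/
theorem IsMaximalElement.conv_eq [Countable G] (hd : ∀ k, 0 < d k)
    (hω : (ω : Filter ℕ) ≤ cofinite) {Y : LoebSpace d ω → ClosedSubgroup X}
    (hY : IsMaximalElement G X σ ω Y) (hν : AsympSupported (fun (g : G) (x : X) => g • x) σ ω ν) :
    ∀ᵐ z ∂loebMeasure d ω, conv (ultraFun ω (fun k => marginal (ν k)) z) (haarOn (Y z))
      = haarOn (Y z) := by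
  obtain ⟨Y', hY', habs⟩ := exists_maximalElement (X := X) hd hω σ
  filter_upwards [habs ν hν, hY.ae_eq hY'] with z h1 h2
  rw [h2, h1]

/-! ### Invariance of the maximal element -/

theorem haarOn_translate (g : G) (K : ClosedSubgroup X) :
    (haarOn K).map (actMap X g).continuous.measurable.aemeasurable = haarOn (translate g K) := by
  refine eq_haarOn ?_ ?_
  · rw [ProbabilityMeasure.toMeasure_map]
    refine (ae_map_iff (actMap X g).continuous.measurable.aemeasurable
      (translate g K).isClosed'.measurableSet).2 ?_
    filter_upwards [ae_mem_haarOn K] with x hx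
    exact ⟨x, hx, rfl⟩
  · rintro _ ⟨x, hx, rfl⟩
    refine mem_stab.2 fun f => ?_
    have h1 : ∀ u, smear f ((haarOn K).map (actMap X g).continuous.measurable.aemeasurable) u
        = ∫ y, f (u * g • y) ∂(haarOn K : Measure X) := by
      intro u
      rw [smear_apply, ProbabilityMeasure.toMeasure_map,
        integral_map (actMap X g).continuous.measurable.aemeasurable
          (by fun_prop : Continuous fun y => f (u * y)).aestronglyMeasurable]
      rfl
    rw [h1, h1]
    have h2 := integral_haarOn_mul_left K (f.comp (actMap X g)) hx
    simpa [actMap, smul_mul'] using h2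

/-- Equivariance of the limiting marginals passes to subgroups because a subgroup is determined by
its Haar measure. -/
theorem SSet_equivariant (hd : ∀ k, 0 < d k) (hω : (ω : Filter ℕ) ≤ cofinite)
    {Y : LoebSpace d ω → ClosedSubgroup X} (hY : Y ∈ SSet G X σ ω) (g : G) :
    ∀ᵐ z ∂loebMeasure d ω, Y (permAct ω (fun k => σ k g) z) = translate g (Y z) := by
  obtain ⟨_, _, μ, hμ, hYμ⟩ := hY
  have hμ' : AsympSupported (fun g => actMap (G := G) X g) σ ω μ := hμ
  have hp := measurePreserving_permAct hd hω (ω := ω) fun k => σ k g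
  filter_upwards [hμ'.ultraFun_marginal_equivariant hd hω g, hYμ,
    hp.quasiMeasurePreserving.ae hYμ] with z h1 h2 h3
  refine haarOn_injective ?_
  rw [← haarOn_translate, h3, h1]
  congr 1
  exact h2.symm

theorem isInvariantRandomSubgroup_map (hd : ∀ k, 0 < d k) (hω : (ω : Filter ℕ) ≤ cofinite)
    {Y : LoebSpace d ω → ClosedSubgroup X} (hY : Y ∈ SSet G X σ ω) :
    IsInvariantRandomSubgroup G ((loebMeasure d ω).map Y) := by
  have := isProbabilityMeasure_loebMeasure hd hω
  refine ⟨Measure.isProbabilityMeasure_map hY.1.aemeasurable, fun g => ?_⟩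
  have hp := measurePreserving_permAct hd hω (ω := ω) fun k => σ k g
  rw [Measure.map_map (continuous_translate g).measurable hY.1]
  conv_rhs => rw [← hp.map_eq]
  rw [Measure.map_map hY.1 hp.measurable]
  refine Measure.map_congr ?_
  filter_upwards [SSet_equivariant hd hω hY g] with z hz using hz.symm

/-- Translating Y by the centralizer is realized by relabelling the coordinates of the measures that
represent Y. -/
theorem SSet_permAct (hd : ∀ k, 0 < d k) (hω : (ω : Filter ℕ) ≤ cofinite)
    {Y : LoebSpace d ω → ClosedSubgroup X} (hY : Y ∈ SSet G X σ ω)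
    {τ : ∀ k, Equiv.Perm (Fin (d k))}
    (hτ : (QuotientGroup.mk τ : PermUltraproduct d ω) ∈ soficCentralizer σ ω) :
    (fun z => Y (permAct ω τ z)) ∈ SSet G X σ ω := by
  obtain ⟨hm, _, μ, hμ, hYμ⟩ := hY
  have hμ' : AsympSupported (fun g => actMap (G := G) X g) σ ω μ := hμ
  have hp := measurePreserving_permAct hd hω (ω := ω) τ
  have hm' := hm.comp hp.measurable
  refine ⟨hm', measurable_haarOn.comp hm', fun k => relabel (τ k) (μ k),
    hμ'.relabel hd fun g => tendsto_hamm_of_mem_soficCentralizer hτ g, ?_⟩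
  filter_upwards [hp.quasiMeasurePreserving.ae hYμ] with z hz
  rw [hz, ultraFun_permAct]
  congr 1
  ext k j
  rw [marginal_relabel]

theorem permAct_inv (τ : ∀ k, Equiv.Perm (Fin (d k))) (z : LoebSpace d ω) :
    permAct ω τ (permAct ω (fun k => (τ k)⁻¹) z) = z := by
  obtain ⟨j, rfl⟩ := z.exists_mk
  simp [permAct_mk]

/-- The maximal element is invariant under the centralizer. -/
theorem IsMaximalElement.permAct_ae_eq (hd : ∀ k, 0 < d k) (hω : (ω : Filter ℕ) ≤ cofinite)
    {Y : LoebSpace d ω → ClosedSubgroup X} (hY : IsMaximalElement G X σ ω Y)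
    {τ : ∀ k, Equiv.Perm (Fin (d k))}
    (hτ : (QuotientGroup.mk τ : PermUltraproduct d ω) ∈ soficCentralizer σ ω) :
    (fun z => Y (permAct ω τ z)) =ᵐ[loebMeasure d ω] Y := by
  have hτ' : (QuotientGroup.mk (fun k => (τ k)⁻¹) : PermUltraproduct d ω)
      ∈ soficCentralizer σ ω := inv_mem hτ
  have hp := measurePreserving_permAct hd hω (ω := ω) τ
  -- Maximality is used for τ at z and for τ⁻¹ at τ z; the second inclusion is the reverse of the
  -- first.
  filter_upwards [hY.2 _ (SSet_permAct hd hω hY.1 hτ),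
    hp.quasiMeasurePreserving.ae (hY.2 _ (SSet_permAct hd hω hY.1 hτ'))] with z h1 h2
  refine le_antisymm h1 ?_
  have h3 := permAct_inv (ω := ω) (fun k => (τ k)⁻¹) z
  simp only [inv_inv] at h3
  rwa [h3] at h2

/-- If the centralizer acts ergodically, then the maximal element is constant. -/
theorem IsMaximalElement.exists_eq_const (hd : ∀ k, 0 < d k) (hω : (ω : Filter ℕ) ≤ cofinite)
    {Y : LoebSpace d ω → ClosedSubgroup X} (hY : IsMaximalElement G X σ ω Y)
    (herg : CentralizerErgodic σ ω) : ∃ K, ∀ᵐ z ∂loebMeasure d ω, Y z = K := by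
  have := isProbabilityMeasure_loebMeasure hd hω
  have hm : Measurable fun z => haarOn (Y z) := measurable_haarOn.comp hY.1.1
  have hne : Nonempty (ProbabilityMeasure X) := ⟨haarProb X⟩
  -- Preimages of measurable sets are invariant, hence null or conull. The argument runs in Prob(X),
  -- where countably many measurable sets separate points.
  obtain ⟨ν, hν⟩ := exists_eventuallyEq_const_of_forall_separating
    (l := ae (loebMeasure d ω)) (f := fun z => haarOn (Y z)) MeasurableSet fun U hU => by
      have hE : MeasurableSet ((fun z => haarOn (Y z)) ⁻¹' U) := hm hU
      rcases herg _ hE fun τ hτ => by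
        refine measure_symmDiff_eq_zero_iff.2 ?_
        filter_upwards [hY.permAct_ae_eq hd hω hτ] with z hz
        have : haarOn (Y (permAct ω τ z)) = haarOn (Y z) := by rw [hz]
        exact congrArg (· ∈ U) this with h | h
      · exact Or.inr (measure_eq_zero_iff_ae_notMem.1 h)
      · exact Or.inl h
  obtain ⟨z0, hz0⟩ := hν.exists
  refine ⟨Y z0, ?_⟩
  filter_upwards [hν] with z hz
  exact haarOn_injective (hz.trans hz0.symm)

theorem translate_eq_of_ae_eq_const (hd : ∀ k, 0 < d k) (hω : (ω : Filter ℕ) ≤ cofinite)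
    {Y : LoebSpace d ω → ClosedSubgroup X} (hY : Y ∈ SSet G X σ ω) {K : ClosedSubgroup X}
    (hK : ∀ᵐ z ∂loebMeasure d ω, Y z = K) (g : G) : translate g K = K := by
  have := isProbabilityMeasure_loebMeasure hd hω
  have hp := measurePreserving_permAct hd hω (ω := ω) fun k => σ k g
  obtain ⟨z, h1, h2, h3⟩ := ((SSet_equivariant hd hω hY g).and
    (hK.and (hp.quasiMeasurePreserving.ae hK))).exists
  rw [← h2, ← h1, h3, h2]

end Algebraic

/-! ### The metric `ρ₂` and covering numbers -/

section Rho

variable {E : Type*} [MetricSpace E] {n : ℕ}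

theorem rho2_lt_iff {ε : ℝ} (hε : 0 < ε) (φ ψ : Fin n → E) :
    rho2 φ ψ < ε ↔ avg (fun j => dist (φ j) (ψ j) ^ 2) < ε ^ 2 := by
  rw [rho2, Real.sqrt_lt' hε]
  rfl

theorem rho2_self (φ : Fin n → E) : rho2 φ φ = 0 := by simp [rho2]

theorem rho2_comm (φ ψ : Fin n → E) : rho2 φ ψ = rho2 ψ φ := by
  simp only [rho2, dist_comm]

/-- The inequality (a + b)² ≤ 2(a² + b²) replaces Minkowski; with both halves equal it gives exactly
ε². -/
theorem rho2_lt_of_half {ε : ℝ} (hε : 0 < ε) {φ ψ χ : Fin n → E} (h1 : rho2 φ χ < ε / 2)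
    (h2 : rho2 ψ χ < ε / 2) : rho2 φ ψ < ε := by
  rw [rho2_lt_iff (half_pos hε)] at h1 h2
  rw [rho2_lt_iff hε]
  have h3 : avg (fun j => dist (φ j) (ψ j) ^ 2)
      ≤ avg fun j => 2 * (dist (φ j) (χ j) ^ 2 + dist (ψ j) (χ j) ^ 2) := by
    refine avg_mono fun j => ?_
    have := dist_triangle_right (φ j) (ψ j) (χ j)
    have h0 : 0 ≤ dist (φ j) (ψ j) := dist_nonneg
    nlinarith [sq_nonneg (dist (φ j) (χ j) - dist (ψ j) (χ j))]
  rw [avg_const_mul, avg_add] at h3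
  nlinarith

theorem rho2_lt_of_dist_lt (hn : 0 < n) {ε : ℝ} (hε : 0 < ε) {φ ψ : Fin n → E}
    (h : dist φ ψ < ε) : rho2 φ ψ < ε := by
  rw [rho2_lt_iff hε]
  have h1 : avg (fun j => dist (φ j) (ψ j) ^ 2) ≤ avg fun _ : Fin n => dist φ ψ ^ 2 :=
    avg_mono fun j => pow_le_pow_left₀ dist_nonneg (dist_le_pi_dist φ ψ j) 2
  rw [avg_const hn] at h1
  have h0 : 0 ≤ dist φ ψ := dist_nonneg
  nlinarith

theorem continuous_rho2 {T : Type*} [TopologicalSpace T] {f g : T → Fin n → E}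
    (hf : Continuous f) (hg : Continuous g) : Continuous fun t => rho2 (f t) (g t) := by
  have h1 : ∀ j, Continuous fun t => f t j := fun j => (continuous_apply j).comp hf
  have h2 : ∀ j, Continuous fun t => g t j := fun j => (continuous_apply j).comp hg
  unfold rho2
  fun_prop

theorem isOpen_nhd (ε : ℝ) (B : Set (Fin n → E)) : IsOpen (nhd ε B) := by
  have : nhd ε B = ⋃ ψ ∈ B, {φ | rho2 φ ψ < ε} := by
    ext φ
    simp [nhd]
  rw [this]
  exact isOpen_biUnion fun ψ _ =>
    isOpen_lt (continuous_rho2 continuous_id continuous_const) continuous_const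

/-- A set of maps has a finite `ε`-separated subset with at least as many elements as its minimal
`ε`-covers. -/
theorem exists_separated [CompactSpace E] (hn : 0 < n) {ε : ℝ} (hε : 0 < ε)
    (A : Set (Fin n → E)) : ∃ B : Finset (Fin n → E), (B : Set (Fin n → E)) ⊆ A ∧
      (∀ φ ∈ B, ∀ ψ ∈ B, rho2 φ ψ < ε → φ = ψ) ∧ coverNum ε A ≤ B.card := by
  let S : Set (Set (Fin n → E)) := {B | B ⊆ A ∧ ∀ φ ∈ B, ∀ ψ ∈ B, rho2 φ ψ < ε → φ = ψ}
  obtain ⟨M, hM⟩ := zorn_subset S fun c hc hchain => by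
    refine ⟨⋃₀ c, ⟨Set.sUnion_subset fun B hB => (hc hB).1, ?_⟩, fun s hs =>
      Set.subset_sUnion_of_mem hs⟩
    rintro φ ⟨B1, hB1, h1⟩ ψ ⟨B2, hB2, h2⟩ hlt
    rcases hchain.total hB1 hB2 with h | h
    · exact (hc hB2).2 φ (h h1) ψ h2 hlt
    · exact (hc hB1).2 φ h1 ψ (h h2) hlt
  have hMS : M ∈ S := hM.prop
  -- A maximal separated set is a cover, since an uncovered point could be added to it.
  have hcov : A ⊆ nhd ε M := by
    intro φ hφ
    by_contra hcon
    have hfar : ∀ ψ ∈ M, ¬ rho2 φ ψ < ε := fun ψ hψ hlt => hcon ⟨ψ, hψ, hlt⟩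
    have hins : insert φ M ∈ S := by
      refine ⟨Set.insert_subset hφ hMS.1, ?_⟩
      rintro a (rfl | ha) b (rfl | hb) hlt
      · rfl
      · exact absurd hlt (hfar b hb)
      · exact absurd (rho2_comm a b ▸ hlt) (hfar a ha)
      · exact hMS.2 a ha b hb hlt
    have hmem : φ ∈ M := hM.le_of_ge hins (Set.subset_insert φ M) (Set.mem_insert φ M)
    exact hfar φ hmem (by rw [rho2_self]; exact hε)
  -- The sup metric dominates ρ₂, so each ball of radius ε/2 in a finite cover contains at most one
  -- point of M.
  have hfin : M.Finite := by
    obtain ⟨t, _, ht, hcover⟩ := (isCompact_univ (X := Fin n → E)).finite_cover_balls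
      (half_pos hε)
    refine (ht.biUnion (t := fun x => M ∩ Metric.ball x (ε / 2)) fun x _ => ?_).subset
      fun φ hφ => ?_
    · refine Set.Subsingleton.finite fun φ hφ ψ hψ => hMS.2 φ hφ.1 ψ hψ.1 ?_
      exact rho2_lt_of_half hε (rho2_lt_of_dist_lt hn (half_pos hε) hφ.2)
        (rho2_lt_of_dist_lt hn (half_pos hε) hψ.2)
    · obtain ⟨x, hx, hφx⟩ := Set.mem_iUnion₂.1 (hcover (Set.mem_univ φ))
      exact Set.mem_biUnion hx ⟨hφ, hφx⟩
  refine ⟨hfin.toFinset, by simpa using hMS.1, fun φ hφ ψ hψ =>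
    hMS.2 φ (by simpa using hφ) ψ (by simpa using hψ), ?_⟩
  refine (iInf₂_le M ⟨hMS.1, hcov⟩).trans (le_of_eq ?_)
  rw [hfin.encard_eq_coe_toFinset_card]

theorem measCoverNum_le_coverNum [MeasurableSpace E] {ε δ : ℝ} {A : Set (Fin n → E)}
    {μ : ProbabilityMeasure (Fin n → E)} (h : 1 - δ ≤ (μ A : ℝ)) :
    measCoverNum ε δ μ ≤ coverNum ε A := by
  refine le_iInf₂ fun B hB => ?_
  rcases B.finite_or_infinite with hfin | hinf
  · refine (iInf₂_le hfin.toFinset ?_).trans (le_of_eq hfin.encard_eq_coe_toFinset_card.symm)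
    refine h.trans ?_
    rw [Set.Finite.coe_toFinset]
    exact_mod_cast ProbabilityMeasure.apply_mono μ hB.2
  · rw [hinf.encard_eq]
    exact le_top

theorem logRate_mono {N M : ℕ∞} (h : N ≤ M) : logRate n N ≤ logRate n M := by
  refine EReal.div_le_div_right_of_nonneg (by exact_mod_cast Nat.cast_nonneg n) ?_
  exact ENNReal.log_monotone (ENat.toENNReal_le.2 h)

theorem logRate_natCast {N : ℕ} (hN : 0 < N) :
    logRate n (N : ℕ∞) = ((Real.log N / n : ℝ) : EReal) := by
  have h : (((N : ℕ∞) : ℝ≥0∞)) = (N : ℝ≥0∞) := by simp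
  rw [logRate, h, ENNReal.log_pos_real (by exact_mod_cast hN.ne') (ENNReal.natCast_ne_top N),
    ENNReal.toReal_natCast, EReal.coe_div]

theorem pos_of_lt_logRate (hn : 0 < n) {c : ℝ} {N : ℕ} (h : (c : EReal) < logRate n (N : ℕ∞)) :
    0 < N := by
  refine Nat.pos_of_ne_zero fun h0 => ?_
  have h1 : logRate n ((0 : ℕ) : ℕ∞) = ⊥ := by
    rw [logRate]
    simp only [Nat.cast_zero, ENat.toENNReal_zero, ENNReal.log_zero]
    exact EReal.bot_div_of_pos_ne_top (by exact_mod_cast hn) (EReal.coe_ne_top _)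
  rw [h0, h1] at h
  exact not_lt_bot h

/-- Losing a factor exp(b - c) costs (c - b)/n in the rate, at most c - b because n ≥ 1. Infinite M
is included since a covering number may be an infimum over the empty set. -/
theorem le_logRate_of_mul_le (hn : 0 < n) {c b : ℝ} (hb : b ≤ c) {N : ℕ} {M : ℕ∞}
    (hN : (c : EReal) < logRate n (N : ℕ∞))
    (h : ∀ m : ℕ, M = m → Real.exp (b - c) * N ≤ m) :
    (b : EReal) ≤ logRate n M := by
  have hNpos := pos_of_lt_logRate hn hN
  rw [logRate_natCast hNpos, EReal.coe_lt_coe_iff, lt_div_iff₀ (by positivity)] at hN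
  rcases eq_or_ne M ⊤ with rfl | hM
  · have : logRate n ⊤ = ⊤ := by
      rw [logRate]
      simp only [ENat.toENNReal_top, ENNReal.log_top]
      exact EReal.top_div_of_pos_ne_top (by exact_mod_cast hn) (EReal.coe_ne_top _)
    rw [this]
    exact le_top
  · obtain ⟨m, rfl⟩ := ENat.ne_top_iff_exists.1 hM
    have h1 := h m rfl
    have hN' : (0 : ℝ) < N := by exact_mod_cast hNpos
    have hm : (0 : ℝ) < m := lt_of_lt_of_le (by positivity) h1
    rw [logRate_natCast (by exact_mod_cast hm), EReal.coe_le_coe_iff, le_div_iff₀ (by positivity)]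
    have h2 := Real.log_le_log (by positivity) h1
    rw [Real.log_mul (Real.exp_pos _).ne' hN'.ne', Real.log_exp] at h2
    have h3 : (1 : ℝ) ≤ n := by exact_mod_cast hn
    nlinarith

theorem ultralim_mono {ω : Ultrafilter ℕ} {f g : ℕ → EReal}
    (h : ∀ᶠ k in (ω : Filter ℕ), f k ≤ g k) : ultralim ω f ≤ ultralim ω g :=
  le_of_tendsto_of_tendsto (tendsto_ultralim ω f) (tendsto_ultralim ω g) h

theorem le_ultralim {ω : Ultrafilter ℕ} {f : ℕ → EReal} {c : EReal}
    (h : ∀ᶠ k in (ω : Filter ℕ), c ≤ f k) : c ≤ ultralim ω f :=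
  ge_of_tendsto (tendsto_ultralim ω f) h

/-- Covering numbers of an isometrically embedded subset. -/
theorem coverNum_le_coverNum_half {D : Type*} [MetricSpace D] {i : D → E} (hi : Isometry i)
    {ε : ℝ} (hε : 0 < ε) {A : Set (Fin n → D)} {A' : Set (Fin n → E)}
    (h : ∀ φ ∈ A, i ∘ φ ∈ A') : coverNum ε A ≤ coverNum (ε / 2) A' := by
  refine le_iInf₂ fun B hB => ?_
  rcases A.eq_empty_or_nonempty with rfl | ⟨φ₀, _⟩
  · exact (iInf₂_le ∅ ⟨Set.empty_subset _, Set.empty_subset _⟩).trans (by simp)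
  have : Nonempty (Fin n → D) := ⟨φ₀⟩
  -- Centres of the larger cover need not come from A, so each useful one is replaced by a nearby
  -- point of A; this doubles the radius.
  let S : Set (Fin n → E) := {ψ ∈ B | ∃ φ ∈ A, rho2 (i ∘ φ) ψ < ε / 2}
  choose! r hr using fun ψ (hψ : ψ ∈ S) => hψ.2
  have hrho : ∀ φ ψ : Fin n → D, rho2 (i ∘ φ) (i ∘ ψ) = rho2 φ ψ := fun φ ψ => by
    simp [rho2, hi.dist_eq]
  refine (iInf₂_le (r '' S) ⟨?_, ?_⟩).trans
    ((Set.encard_image_le r S).trans (Set.encard_le_encard (Set.sep_subset _ _)))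
  · rintro _ ⟨ψ, hψ, rfl⟩
    exact (hr ψ hψ).1
  · intro φ hφ
    obtain ⟨ψ, hψ, hlt⟩ := hB.2 (h φ hφ)
    have hS : ψ ∈ S := ⟨hψ, φ, hφ, hlt⟩
    refine ⟨r ψ, ⟨ψ, hS, rfl⟩, ?_⟩
    rw [← hrho]
    exact rho2_lt_of_half hε hlt (hr ψ hS).2

end Rho

/-! ### Topological entropy and the upper bound -/

section Entropy

variable {G : Type*} {d : ℕ → ℕ} {ω : Ultrafilter ℕ} {σ : ∀ k, G → Equiv.Perm (Fin (d k))}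

/-- Halving the radius is harmless under the supremum over ε. -/
theorem topEntropy_le_of_isometry {D E : Type*} [MetricSpace D] [MetricSpace E]
    {actD : G → D → D} {actE : G → E → E} {i : D → E} (hi : Isometry i)
    (h : ∀ g x, i (actD g x) = actE g (i x)) :
    topEntropy actD σ ω ≤ topEntropy actE σ ω := by
  refine iSup₂_le fun ε hε => ?_
  refine le_trans ?_ (le_iSup₂ (ε / 2) (half_pos hε))
  refine iInf_mono fun F => iInf₂_mono fun δ hδ => ultralim_mono (.of_forall fun k => ?_)
  refine logRate_mono (coverNum_le_coverNum_half hi hε fun φ hφ g hg => ?_)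
  have := hφ g hg
  simp only [rho2, Function.comp_apply, ← h, hi.dist_eq] at this ⊢
  exact this

variable {E : Type*} [MetricSpace E]

/-- The square of the distance as a continuous function. -/
def distSqMap (E : Type*) [MetricSpace E] : C(E × E, ℝ) :=
  ⟨fun p => dist p.1 p.2 ^ 2, by fun_prop⟩

theorem distSqMap_apply (x y : E) : distSqMap E (x, y) = dist x y ^ 2 := rfl

theorem isOpen_mapSet (act : G → C(E, E)) (F : Finset G) (δ : ℝ) {n : ℕ}
    (s : G → Equiv.Perm (Fin n)) : IsOpen (MapSet (fun g => act g) F δ s : Set (Fin n → E)) := by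
  have : MapSet (fun g => act g) F δ s
      = ⋂ g ∈ F, {φ : Fin n → E | rho2 (fun j => act g (φ j)) (φ ∘ s g) < δ} := by
    ext φ
    simp [MapSet]
  rw [this]
  refine isOpen_biInter_finset fun g _ => isOpen_lt (continuous_rho2 ?_ ?_) continuous_const
  · fun_prop
  · fun_prop

variable [CompactSpace E] [MeasurableSpace E] [BorelSpace E]
  {act : G → C(E, E)} {μ : ∀ k, ProbabilityMeasure (Fin (d k) → E)}

/-- Measures that are asymptotically supported on microstates are carried, up to small errors, by
the sets of approximately equivariant maps. -/
theorem AsympSupported.eventually_mapSet (hd : ∀ k, 0 < d k)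
    (h : AsympSupported (fun g => act g) σ ω μ) (F : Finset G) {δ η : ℝ} (hδ : 0 < δ)
    (hη : 0 < η) :
    ∀ᶠ k in (ω : Filter ℕ), 1 - η ≤ (μ k (MapSet (fun g => act g) F δ (σ k)) : ℝ) := by
  have h1 : Tendsto (fun k => ∑ g ∈ F, defect (distSqMap E) (act g) (σ k g) (μ k) / δ ^ 2) ω
      (𝓝 0) := by
    have := tendsto_finsetSum F fun g _ => (h.tendsto_defect hd g (c := distSqMap E)
      (fun p => sq_nonneg _) fun x => by simp [distSqMap_apply]).div_const (δ ^ 2)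
    simpa using this
  filter_upwards [h1.eventually_lt_const hη] with k hk
  have hm := (isOpen_mapSet act F δ (σ k)).measurableSet
  have h2 := probReal_compl_eq_one_sub hm (μ := (μ k : Measure (Fin (d k) → E)))
  have hsub : (MapSet (fun g => act g) F δ (σ k))ᶜ ⊆ ⋃ g ∈ F,
      {φ | δ ^ 2 ≤ avg fun j => distSqMap E (φ (σ k g j), act g (φ j))} := by
    intro φ hφ
    simp only [MapSet, Set.mem_compl_iff, Set.mem_ofPred_eq, not_forall, exists_prop] at hφ
    obtain ⟨g, hg, hlt⟩ := hφ
    rw [rho2_comm, rho2_lt_iff hδ, not_lt] at hlt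
    exact Set.mem_biUnion hg hlt
  have h3 : (μ k : Measure (Fin (d k) → E)).real (MapSet (fun g => act g) F δ (σ k))ᶜ
      ≤ ∑ g ∈ F, defect (distSqMap E) (act g) (σ k g) (μ k) / δ ^ 2 := by
    refine (measureReal_mono hsub (measure_ne_top _ _)).trans ((measureReal_biUnion_finset_le _ _).trans ?_)
    refine Finset.sum_le_sum fun g _ => ?_
    rw [le_div_iff₀ (by positivity), mul_comm]
    exact mul_meas_ge_le_integral_of_nonneg (.of_forall fun φ => avg_nonneg fun j => sq_nonneg _)
      (integrable_of_continuous _ (continuous_pairAvg (distSqMap E) (act g) (σ k g))) (δ ^ 2)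
  simp only [ProbabilityMeasure.measureReal_eq_coe_coeFn] at h2 h3
  linarith

/-- Each set of approximately equivariant maps eventually has measure at least 1 - δ, so any of its
covers is admissible for the measure. -/
theorem lwEntropy_le_topEntropy (hd : ∀ k, 0 < d k) (m : Measure (ProbabilityMeasure E)) :
    lwEntropy (fun g => act g) σ ω m ≤ topEntropy (fun g => act g) σ ω := by
  refine iSup₂_le fun μ hμ => iSup₂_le fun ε hε => iSup₂_le fun δ hδ => ?_
  refine le_trans ?_ (le_iSup₂ ε hε)
  refine le_iInf fun F => le_iInf₂ fun δ' hδ' => ultralim_mono ?_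
  filter_upwards [hμ.1.eventually_mapSet hd F hδ' hδ] with k hk
  exact logRate_mono (measCoverNum_le_coverNum hk)

/-- Measures carried by sets of approximately equivariant maps are asymptotically supported on
microstates. -/
theorem asympSupported_of_rho2 (hd : ∀ k, 0 < d k)
    (h : ∀ (g : G) (δ : ℝ), 0 < δ → ∀ᶠ k in (ω : Filter ℕ),
      ∀ᵐ φ ∂(μ k : Measure (Fin (d k) → E)), rho2 (fun j => act g (φ j)) (φ ∘ σ k g) < δ) :
    AsympSupported (fun g => act g) σ ω μ := by
  rw [asympSupported_iff hd]
  intro g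
  refine Metric.tendsto_nhds.2 fun ε hε => ?_
  obtain ⟨C, hC, hle⟩ := exists_le_add_mul (distSqMap E).continuous (distMap E).continuous
    (fun p => sq_nonneg _) (fun p hp => by
      have : dist p.1 p.2 = 0 := pow_eq_zero_iff two_ne_zero |>.1 hp
      exact this.le) (half_pos hε)
  -- The squared tolerance: C times it is below ε/2, and C + ε keeps the denominator positive when C
  -- = 0.
  have hδ : 0 < ε / (2 * (C + ε)) := by positivity
  filter_upwards [h g (√(ε / (2 * (C + ε)))) (Real.sqrt_pos.2 hδ)] with k hk
  rw [Real.dist_eq, sub_zero, abs_of_nonneg (defect_nonneg (fun p => dist_nonneg) _ _ _)]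
  have h1 : ∀ᵐ φ ∂(μ k : Measure (Fin (d k) → E)),
      avg (fun j => distMap E (φ (σ k g j), act g (φ j))) ≤ ε / 2 + C * (ε / (2 * (C + ε))) := by
    filter_upwards [hk] with φ hφ
    rw [rho2_comm, rho2_lt_iff (Real.sqrt_pos.2 hδ), Real.sq_sqrt hδ.le] at hφ
    refine (avg_mono fun j => hle _).trans ?_
    rw [avg_add, avg_const (hd k), avg_const_mul]
    gcongr
    exact hφ.le
  have h2 := integral_mono_ae (integrable_of_continuous (μ k : Measure (Fin (d k) → E))
    (continuous_pairAvg (distMap E) (act g) (σ k g))) (integrable_const _) h1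
  simp only [integral_const, probReal_univ, smul_eq_mul, one_mul] at h2
  refine lt_of_le_of_lt h2 ?_
  have h3 : C * (ε / (2 * (C + ε))) < ε / 2 := by
    rw [← mul_div_assoc, div_lt_div_iff₀ (by positivity) two_pos]
    nlinarith
  linarith

end Entropy

/-! ### Uniform measures on separated sets -/

section Uniform

variable {M : Type*} [MeasurableSpace M] [MeasurableSingletonClass M] [One M]

open Classical in
/-- The uniform probability measure on a nonempty finite set (the Dirac measure at `1` on `∅`). -/
def unifProb (B : Finset M) : ProbabilityMeasure M :=
  ⟨if B.Nonempty then ProbabilityTheory.uniformOn (B : Set M) else Measure.dirac 1, by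
    split_ifs with h
    · exact ProbabilityTheory.isProbabilityMeasure_uniformOn B.finite_toSet h
    · infer_instance⟩

theorem unifProb_coe {B : Finset M} (h : B.Nonempty) :
    (unifProb B : Measure M) = ProbabilityTheory.uniformOn (B : Set M) :=
  if_pos h

theorem ae_unifProb_mem {B : Finset M} (h : B.Nonempty) : ∀ᵐ x ∂(unifProb B : Measure M), x ∈ B := by
  rw [unifProb_coe h]
  have := ProbabilityTheory.isProbabilityMeasure_uniformOn B.finite_toSet h
  exact (prob_compl_eq_zero_iff B.measurableSet).2
    (ProbabilityTheory.uniformOn_self B.finite_toSet h)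

open Classical in
theorem unifProb_apply {B : Finset M} (h : B.Nonempty) (S : Set M) :
    (unifProb B : Measure M) S = ((B.filter (· ∈ S)).card : ℝ≥0∞) / B.card := by
  rw [unifProb_coe h, ← ProbabilityTheory.uniformOn_inter_self B.finite_toSet]
  have : (B : Set M) ∩ S = (B.filter (· ∈ S) : Finset M) := by
    ext x
    simp
  rw [this, ProbabilityTheory.uniformOn_apply_finset, Finset.inter_eq_right.2
    (Finset.filter_subset _ _)]

end Uniform

/-! ### Lower bound: convolving uniform measures on separated microstates -/

section Lower

variable {G : Type*} [Group G] {X : Type*} [Group X] [MetricSpace X] [CompactSpace X]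
  [IsTopologicalGroup X]

/-- By compactness of X³, right translation is invertible with a modulus independent of the
translating element. The averaged form is uniform in n and ψ. -/
theorem exists_rho2_mul_right (X : Type*) [Group X] [MetricSpace X] [CompactSpace X]
    [IsTopologicalGroup X] {ε : ℝ} (hε : 0 < ε) :
    ∃ η : ℝ, 0 < η ∧ ∀ (n : ℕ) (_ : 0 < n) (φ φ' ψ : Fin n → X),
      rho2 (φ * ψ) (φ' * ψ) < η → rho2 φ φ' < ε := by
  obtain ⟨C, hC, hle⟩ := exists_le_add_mul (T := X × X × X)
    (a := fun q => dist (q.1 * q.2.2) (q.2.1 * q.2.2) ^ 2)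
    (b := fun q => dist q.1 q.2.1 ^ 2) (by fun_prop) (by fun_prop)
    (fun q => sq_nonneg _) (fun q hq => by
      have h1 : dist (q.1 * q.2.2) (q.2.1 * q.2.2) = 0 := pow_eq_zero_iff two_ne_zero |>.1 hq
      have h2 : q.1 = q.2.1 := mul_right_cancel (dist_eq_zero.1 h1)
      rw [h2, dist_self]
      norm_num) (by positivity : 0 < ε ^ 2 / 2)
  have hη : 0 < ε / (2 * (C + 1)) := by positivity
  refine ⟨ε / (2 * (C + 1)), hη, fun n hn φ φ' ψ h => ?_⟩
  rw [rho2_lt_iff hη] at h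
  rw [rho2_lt_iff hε]
  have h1 := avg_mono fun j => hle (φ j, φ' j, ψ j)
  rw [avg_add, avg_const hn, avg_const_mul] at h1
  have h2 : C * avg (fun j => dist ((φ * ψ) j) ((φ' * ψ) j) ^ 2)
      ≤ C * (ε / (2 * (C + 1))) ^ 2 := mul_le_mul_of_nonneg_left h.le hC
  have h3 : C * (ε / (2 * (C + 1))) ^ 2 ≤ ε ^ 2 / 4 := by
    rw [div_pow, ← mul_div_assoc, div_le_div_iff₀ (by positivity) (by norm_num)]
    have : 0 ≤ ε ^ 2 * (C ^ 2 + C + 1) := by positivity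
    nlinarith
  have h4 : 0 < ε ^ 2 := by positivity
  simp only [Pi.mul_apply] at h2
  linarith

variable [MeasurableSpace X] [BorelSpace X]

/-- A convolution with the uniform measure on a separated set cannot be carried by few balls. -/
theorem mul_card_le_card {n : ℕ} {ε η : ℝ} (hη : 0 < η)
    (hmul : ∀ φ φ' ψ : Fin n → X, rho2 (φ * ψ) (φ' * ψ) < η → rho2 φ φ' < ε)
    {B : Finset (Fin n → X)} (hB : B.Nonempty)
    (hsep : ∀ φ ∈ B, ∀ ψ ∈ B, rho2 φ ψ < ε → φ = ψ) {ν : ProbabilityMeasure (Fin n → X)} {r : ℝ}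
    {C : Finset (Fin n → X)}
    (h : r ≤ (conv (unifProb B) ν (nhd (η / 2) (C : Set (Fin n → X))) : ℝ)) :
    r * B.card ≤ C.card := by
  classical
  set N := nhd (η / 2) (C : Set (Fin n → X)) with hN
  have hNm : MeasurableSet N := (isOpen_nhd _ _).measurableSet
  have h1 : (conv (unifProb B) ν : Measure (Fin n → X)) N
      = ∫⁻ ψ, (unifProb B : Measure (Fin n → X)) {φ | φ * ψ ∈ N} ∂(ν : Measure (Fin n → X)) := by
    have e : (conv (unifProb B) ν : Measure (Fin n → X))
      = ((unifProb B : Measure (Fin n → X)).prod (ν : Measure (Fin n → X))).map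
        fun p => p.1 * p.2 := rfl
    rw [e, Measure.map_apply measurable_mul hNm, Measure.prod_apply_symm (measurable_mul hNm)]
    rfl
  -- Some fibre over ν is at least average: for this ψ, a proportion r of the translates of B by ψ
  -- lies in the neighbourhood of C.
  obtain ⟨ψ, hψ⟩ := exists_lintegral_le (μ := (ν : Measure (Fin n → X)))
    (f := fun ψ => (unifProb B : Measure (Fin n → X)) {φ | φ * ψ ∈ N})
    (by rw [← h1]; exact measure_ne_top _ _)
  rw [← h1] at hψ
  have h2 : r ≤ ((B.filter (· ∈ {φ | φ * ψ ∈ N})).card : ℝ) / B.card := by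
    refine h.trans ?_
    have := ENNReal.toReal_mono (measure_ne_top _ _) hψ
    rw [unifProb_apply hB] at this
    rwa [ENNReal.toReal_div, ENNReal.toReal_natCast, ENNReal.toReal_natCast] at this
  have hBpos : (0 : ℝ) < B.card := by exact_mod_cast hB.card_pos
  rw [le_div_iff₀ hBpos] at h2
  refine h2.trans ?_
  have hch : ∀ φ ∈ B.filter (· ∈ {φ | φ * ψ ∈ N}), ∃ χ ∈ C, rho2 (φ * ψ) χ < η / 2 := by
    intro φ hφ
    obtain ⟨χ, hχ, hlt⟩ := (Finset.mem_filter.1 hφ).2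
    exact ⟨χ, hχ, hlt⟩
  choose! f hf using hch
  -- Two points of B sent to the same centre have translates closer than η, hence are closer than ε
  -- and equal by separation.
  exact_mod_cast Finset.card_le_card_of_injOn f (fun φ hφ => (hf φ hφ).1) fun φ hφ φ' hφ' he => by
    refine hsep φ (Finset.mem_filter.1 hφ).1 φ' (Finset.mem_filter.1 hφ').1 (hmul φ φ' ψ ?_)
    exact rho2_lt_of_half hη (hf φ hφ).2 (he ▸ (hf φ' hφ').2)

variable [MulDistribMulAction G X] [ContinuousConstSMul G X] {d : ℕ → ℕ} {ω : Ultrafilter ℕ}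
  {σ : ∀ k, G → Equiv.Perm (Fin (d k))}

theorem ultraFun_conv (α ν : ∀ k, ProbabilityMeasure (Fin (d k) → X)) (z : LoebSpace d ω) :
    ultraFun ω (fun k => marginal (conv (α k) (ν k))) z
      = conv (ultraFun ω (fun k => marginal (α k)) z) (ultraFun ω (fun k => marginal (ν k)) z) := by
  have h := ultraFun_comp (ω := ω) continuous_conv fun k j => (marginal (α k) j, marginal (ν k) j)
  simp only [ultraFun_prodMk, ← marginal_conv] at h
  exact h z

/-- Below the topological entropy there are measures, asymptotically supported on microstates, whose
marginals are represented by the Haar measures of the maximal element. -/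
theorem IsMaximalElement.exists_le_seqEntropy [Countable G] (hd : ∀ k, 0 < d k)
    (hω : (ω : Filter ℕ) ≤ cofinite) {Y : LoebSpace d ω → ClosedSubgroup X}
    (hY : IsMaximalElement G X σ ω Y) {b : ℝ}
    (hb : (b : EReal) < topEntropy (fun (g : G) (x : X) => g • x) σ ω) :
    ∃ μ : ∀ k, ProbabilityMeasure (Fin (d k) → X),
      AsympSupported (fun (g : G) (x : X) => g • x) σ ω μ ∧
      (∀ᵐ z ∂loebMeasure d ω, ultraFun ω (fun k => marginal (μ k)) z = haarOn (Y z)) ∧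
      (b : EReal) ≤ seqEntropy ω μ := by
  classical
  obtain ⟨c, hbc, hc⟩ := EReal.lt_iff_exists_real_btwn.1 hb
  rw [EReal.coe_lt_coe_iff] at hbc
  obtain ⟨ε, hc⟩ := lt_iSup_iff.1 hc
  obtain ⟨hε, hc⟩ := lt_iSup_iff.1 hc
  have hlim : ∀ (F : Finset G) (δ : ℝ), 0 < δ → ∀ᶠ k in (ω : Filter ℕ), (c : EReal)
      < logRate (d k) (coverNum ε (MapSet (fun (g : G) (x : X) => g • x) F δ (σ k))) := by
    intro F δ hδ
    have : (c : EReal) < ultralim ω fun k =>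
        logRate (d k) (coverNum ε (MapSet (fun (g : G) (x : X) => g • x) F δ (σ k))) :=
      hc.trans_le ((iInf_le _ F).trans (iInf₂_le δ hδ))
    exact (tendsto_ultralim ω _).eventually_const_lt this
  obtain ⟨η, hη, hmul⟩ := exists_rho2_mul_right X hε
  obtain ⟨e, he⟩ := exists_surjective_nat G
  -- Saturation makes one sequence of separated sets serve every finite set of group elements and
  -- every tolerance, at fixed scale ε and rate above c.
  let R : ℕ → ∀ k, Set (Finset (Fin (d k) → X)) := fun n k =>
    {B | (∀ φ ∈ B, ∀ i ≤ n, rho2 (fun j => e i • φ j) (φ ∘ σ k (e i)) < 1 / ((n : ℝ) + 1)) ∧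
      (∀ φ ∈ B, ∀ ψ ∈ B, rho2 φ ψ < ε → φ = ψ) ∧ (c : EReal) < logRate (d k) (B.card : ℕ∞)}
  obtain ⟨B, hB⟩ := exists_saturated hω R (fun k n m hnm B hB => by
      have hle : 1 / ((m : ℝ) + 1) ≤ 1 / ((n : ℝ) + 1) :=
        one_div_le_one_div_of_le (by positivity) (by simpa using hnm)
      exact ⟨fun φ hφ i hi => (hB.1 φ hφ i (hi.trans hnm)).trans_le hle, hB.2⟩)
    (fun n => by
      filter_upwards [hlim ((Finset.range (n + 1)).image e) (1 / ((n : ℝ) + 1)) (by positivity)]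
        with k hk
      obtain ⟨B, hBA, hsep, hcard⟩ := exists_separated (hd k) hε
        (MapSet (fun (g : G) (x : X) => g • x) ((Finset.range (n + 1)).image e)
          (1 / ((n : ℝ) + 1)) (σ k))
      refine ⟨B, fun φ hφ i hi => ?_, hsep, hk.trans_le (logRate_mono hcard)⟩
      exact hBA hφ (e i) (Finset.mem_image_of_mem e (Finset.mem_range.2 (by omega))))
  have hBne : ∀ᶠ k in (ω : Filter ℕ), (B k).Nonempty := by
    filter_upwards [hB 0] with k hk
    exact Finset.card_pos.1 (pos_of_lt_logRate (hd k) hk.2.2)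
  let α : ∀ k, ProbabilityMeasure (Fin (d k) → X) := fun k => unifProb (B k)
  have hα : AsympSupported (fun g => actMap (G := G) X g) σ ω α := by
    refine asympSupported_of_rho2 hd fun g δ hδ => ?_
    obtain ⟨i, rfl⟩ := he g
    obtain ⟨n, hn⟩ := exists_nat_one_div_lt hδ
    filter_upwards [hB (max i n), hBne] with k hk hne
    filter_upwards [ae_unifProb_mem hne] with φ hφ
    refine (hk.1 φ hφ i (le_max_left _ _)).trans_le (le_trans ?_ hn.le)
    exact one_div_le_one_div_of_le (by positivity) (by simp)
  obtain ⟨_, _, ν, hν, hYν⟩ := hY.1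
  refine ⟨fun k => conv (α k) (ν k), hα.conv hd hν, ?_, ?_⟩
  · filter_upwards [hY.conv_eq hd hω hα, hYν] with z h1 h2
    rw [ultraFun_conv, ← h2, h1]
  -- With this δ, a cover of measure 1 - δ has at least exp(b - c) times as many elements as B, the
  -- loss absorbed by the gap between b and c.
  · have hδ : 0 < 1 - Real.exp (b - c) := by
      have : Real.exp (b - c) < 1 := by
        rw [← Real.exp_zero]
        exact Real.exp_lt_exp.2 (by linarith)
      linarith
    refine le_trans ?_ (le_iSup₂_of_le (η / 2) (half_pos hη) (le_iSup₂ (1 - Real.exp (b - c)) hδ))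
    refine le_ultralim ?_
    filter_upwards [hB 0, hBne] with k hk hne
    refine le_logRate_of_mul_le (hd k) hbc.le hk.2.2 fun m hm => ?_
    by_contra hcon
    -- Every admissible cover has more than m elements, so the infimum m would be at least m + 1.
    have : ((m + 1 : ℕ) : ℕ∞) ≤ m := by
      rw [← hm]
      refine le_iInf₂ fun C hC => ?_
      have h1 := mul_card_le_card hη (hmul (d k) (hd k)) hne hk.2.1
        (r := Real.exp (b - c)) (by simpa using hC)
      have h2 : (m : ℝ) < C.card := (not_le.1 hcon).trans_le h1
      have h3 : m < C.card := by exact_mod_cast h2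
      exact_mod_cast h3
    have : m + 1 ≤ m := by exact_mod_cast this
    omega

theorem lwTendsto_of_ae {E : Type*} [MetricSpace E] [CompactSpace E] [MeasurableSpace E]
    [BorelSpace E] (hd : ∀ k, 0 < d k) (hω : (ω : Filter ℕ) ≤ cofinite)
    {μ : ∀ k, ProbabilityMeasure (Fin (d k) → E)} {Φ : LoebSpace d ω → ProbabilityMeasure E}
    (hΦ : Measurable Φ)
    (h : ∀ᵐ z ∂loebMeasure d ω, ultraFun ω (fun k => marginal (μ k)) z = Φ z) :
    LWTendsto ω μ ((loebMeasure d ω).map Φ) := by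
  intro f
  rw [integral_map hΦ.aemeasurable f.continuous.aestronglyMeasurable]
  have h1 := tendsto_avg_ultraFun hd hω f.continuous fun k => marginal (μ k)
  rwa [integral_congr_ae (g := fun z => f (Φ z))] at h1
  filter_upwards [h] with z hz
  rw [hz]

/-- The local weak* entropy of the law of the Haar measures of the maximal element is the topological
entropy. -/
theorem IsMaximalElement.lwEntropy_eq [Countable G] (hd : ∀ k, 0 < d k)
    (hω : (ω : Filter ℕ) ≤ cofinite) {Y : LoebSpace d ω → ClosedSubgroup X}
    (hY : IsMaximalElement G X σ ω Y) :
    lwEntropy (fun (g : G) (x : X) => g • x) σ ω (((loebMeasure d ω).map Y).map haarOn) =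
      topEntropy (fun (g : G) (x : X) => g • x) σ ω := by
  refine le_antisymm (lwEntropy_le_topEntropy (act := actMap X) hd _)
    (EReal.ge_of_forall_gt_iff_ge.1 fun b hb => ?_)
  obtain ⟨μ, h1, h2, h3⟩ := hY.exists_le_seqEntropy hd hω hb
  refine h3.trans (le_iSup₂_of_le μ ⟨h1, ?_⟩ le_rfl)
  rw [Measure.map_map measurable_haarOn hY.1.1]
  exact lwTendsto_of_ae hd hω (measurable_haarOn.comp hY.1.1) h2

end Lower

/-! ### Retraction of measures onto an invariant closed subset -/

theorem tendsto_zero_of_le_add_mul {ι : Type*} {l : Filter ι} {a v : ι → ℝ}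
    (hv : Tendsto v l (𝓝 0)) (h0 : ∀ k, 0 ≤ a k)
    (h : ∀ ε : ℝ, 0 < ε → ∃ C, ∀ k, a k ≤ ε + C * v k) : Tendsto a l (𝓝 0) := by
  refine Metric.tendsto_nhds.2 fun ε hε => ?_
  obtain ⟨C, hC⟩ := h (ε / 2) (half_pos hε)
  have h1 : Tendsto (fun k => C * v k) l (𝓝 0) := by simpa using hv.const_mul C
  filter_upwards [h1.eventually_lt_const (half_pos hε)] with k hk
  rw [Real.dist_eq, sub_zero, abs_of_nonneg (h0 k)]
  linarith [hC k]

section Retraction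

/-- Take the first point of a dense sequence that is nearest up to t. The slack t makes each
condition open, which gives measurability without a selection theorem. -/
theorem exists_measurable_retraction {D E : Type*} [MetricSpace D] [CompactSpace D] [Nonempty D]
    [MeasurableSpace D] [MetricSpace E] [MeasurableSpace E] [BorelSpace E] {i : D → E} (hi : Continuous i) {t : ℝ} (ht : 0 < t) :
    ∃ f : E → D, Measurable f ∧ ∀ x, dist x (i (f x)) ≤ Metric.infDist x (Set.range i) + t := by
  classical
  let e := TopologicalSpace.denseSeq D
  have hex : ∀ x, ∃ n, dist x (i (e n)) < Metric.infDist x (Set.range i) + t := by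
    intro x
    obtain ⟨_, ⟨y, rfl⟩, hy⟩ := (Metric.infDist_lt_iff (Set.range_nonempty i)).1
      (lt_add_of_pos_right (Metric.infDist x (Set.range i)) ht)
    have ho : IsOpen {z | dist x (i z) < Metric.infDist x (Set.range i) + t} :=
      isOpen_lt (by fun_prop) continuous_const
    exact (TopologicalSpace.denseRange_denseSeq D).exists_mem_open ho ⟨y, hy⟩
  refine ⟨fun x => e (Nat.find (hex x)), ?_, fun x => (Nat.find_spec (hex x)).le⟩
  refine (measurable_from_nat (f := e)).comp (measurable_find hex fun n => ?_)
  exact (isOpen_lt (by fun_prop)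
    ((Metric.continuous_infDist_pt _).add continuous_const)).measurableSet

/-- The distance to the image of `i` as a continuous function. -/
def distRange {D E : Type*} [MetricSpace E] (i : D → E) : C(E, ℝ) :=
  ⟨fun x => Metric.infDist x (Set.range i), Metric.continuous_infDist_pt _⟩

theorem distRange_nonneg {D E : Type*} [MetricSpace E] (i : D → E) (x : E) :
    0 ≤ distRange i x := Metric.infDist_nonneg

theorem distRange_apply_self {D E : Type*} [MetricSpace E] {i : D → E} (y : D) :
    distRange i (i y) = 0 :=
  Metric.infDist_zero_of_mem ⟨y, rfl⟩

/-- The image of a measure on `E ^ n` under a coordinatewise map. -/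
def coordMap {D E : Type*} [MeasurableSpace D] [MeasurableSpace E] {f : E → D} (hf : Measurable f)
    {n : ℕ} (μ : ProbabilityMeasure (Fin n → E)) :
    ProbabilityMeasure (Fin n → D) :=
  μ.map (f := fun φ j => f (φ j))
    (measurable_pi_lambda _ fun j => hf.comp (measurable_pi_apply j)).aemeasurable

theorem marginal_coordMap {D E : Type*} [MeasurableSpace D] [MeasurableSpace E] {f : E → D}
    (hf : Measurable f) {n : ℕ}
    (ν : ProbabilityMeasure (Fin n → E)) (j : Fin n) :
    marginal (coordMap hf ν) j = (marginal ν j).map hf.aemeasurable := by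
  refine ProbabilityMeasure.toMeasure_injective ?_
  have h : Measurable fun (φ : Fin n → E) j => f (φ j) :=
    measurable_pi_lambda _ fun j => hf.comp (measurable_pi_apply j)
  simp only [marginal, coordMap, ProbabilityMeasure.toMeasure_map]
  rw [Measure.map_map (measurable_pi_apply j) h, Measure.map_map hf (measurable_pi_apply j)]
  rfl

variable {D E : Type*} [MeasurableSpace D] [MetricSpace E] [CompactSpace E] [MeasurableSpace E]
  [BorelSpace E] {i : D → E}

theorem integral_avg {n : ℕ} (μ : ProbabilityMeasure (Fin n → E)) (c : C(E, ℝ)) :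
    ∫ φ, avg (fun j => c (φ j)) ∂(μ : Measure (Fin n → E))
      = avg fun j => ∫ x, c x ∂(marginal μ j : Measure E) := by
  simp only [avg, integral_marginal]
  rw [integral_div, integral_finsetSum _ fun j _ => integrable_of_continuous _ (by fun_prop)]

theorem integral_add_mul_avg_distRange {D : Type*} {i : D → E} {n : ℕ}
    (ν : ProbabilityMeasure (Fin n → E)) (a b : ℝ) :
    ∫ φ, (a + b * avg fun j => distRange i (φ j)) ∂(ν : Measure (Fin n → E))
      = a + b * ∫ φ, avg (fun j => distRange i (φ j)) ∂(ν : Measure (Fin n → E)) := by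
  have hc : Continuous fun φ : Fin n → E => avg fun j => distRange i (φ j) :=
    continuous_avg fun j => by fun_prop
  rw [integral_add_of_continuous _ continuous_const (by fun_prop), integral_const_mul]
  simp

variable {G : Type*} {d : ℕ → ℕ} {ω : Ultrafilter ℕ} {σ : ∀ k, G → Equiv.Perm (Fin (d k))}
  {μ : ∀ k, ProbabilityMeasure (Fin (d k) → E)} {m : ProbabilityMeasure D}

/-- Measures whose marginals are represented by a measure on the image of `i` are, on average,
concentrated near that image. -/
theorem tendsto_integral_avg_of_ae_eq_map (hd : ∀ k, 0 < d k) (hω : (ω : Filter ℕ) ≤ cofinite)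
    (hi : Measurable i)
    (hm : ∀ᵐ z ∂loebMeasure d ω,
      ultraFun ω (fun k => marginal (μ k)) z = m.map hi.aemeasurable)
    {c : C(E, ℝ)} (hc : ∀ x, 0 ≤ c x) (hci : ∀ y, c (i y) = 0) :
    Tendsto (fun k => ∫ φ, avg (fun j => c (φ j)) ∂(μ k : Measure (Fin (d k) → E))) ω (𝓝 0) := by
  simp only [integral_avg]
  refine (ae_ultraFun_eq_zero_iff hd hω (continuous_integral c) (fun ν => integral_nonneg hc)
    fun k => marginal (μ k)).1 ?_
  filter_upwards [hm] with z hz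
  rw [hz, ProbabilityMeasure.toMeasure_map,
    integral_map hi.aemeasurable c.continuous.aestronglyMeasurable]
  simp [hci]

variable [MetricSpace D] [CompactSpace D] [BorelSpace D] {f : ℕ → E → D} {t : ℕ → ℝ}

/-- The new equivariance error is at most the old one plus two displacements, one of them passed
through the action and controlled by uniform continuity. Reindexing by σ makes both averages
multiples of the mean distance to the image. -/
theorem AsympSupported.retract (hd : ∀ k, 0 < d k) (hi : Isometry i) {actD : G → C(D, D)}
    {actE : G → C(E, E)} (hact : ∀ g y, i (actD g y) = actE g (i y))
    (hμ : AsympSupported (fun g => actE g) σ ω μ) (hf : ∀ k, Measurable (f k))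
    (ht : Tendsto t ω (𝓝 0)) (hft : ∀ k x, dist x (i (f k x)) ≤ distRange i x + t k)
    (hv : Tendsto (fun k => ∫ φ, avg (fun j => distRange i (φ j))
      ∂(μ k : Measure (Fin (d k) → E))) ω (𝓝 0)) :
    AsympSupported (fun g => actD g) σ ω fun k => coordMap (hf k) (μ k) := by
  refine asympSupported_of_tendsto_defect hd fun g => ?_
  have hv' := (hv.add ht).add (hμ.tendsto_defect_dist hd g)
  simp only [add_zero] at hv'
  refine tendsto_zero_of_le_add_mul hv' (fun k => defect_nonneg (fun _ => dist_nonneg) _ _ _)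
    fun ε hε => ?_
  obtain ⟨C, hC, hle⟩ := exists_le_add_mul (T := E × E) (a := fun p => dist p.1 p.2)
    (b := fun p => dist (actE g p.1) (actE g p.2)) (by fun_prop) (by fun_prop)
    (fun _ => dist_nonneg) (fun p hp => by rw [dist_eq_zero.1 hp, dist_self]) hε
  refine ⟨C + 1, fun k => ?_⟩
  have hpt : ∀ φ : Fin (d k) → E,
      avg (fun j => distMap D (f k (φ (σ k g j)), actD g (f k (φ j))))
        ≤ (ε + (C + 1) * t k + (C + 1) * avg fun j => distRange i (φ j))
          + avg fun j => distMap E (φ (σ k g j), actE g (φ j)) := by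
    intro φ
    have h1 : ∀ j, distMap D (f k (φ (σ k g j)), actD g (f k (φ j)))
        ≤ (((ε + (C + 1) * t k) + C * distRange i (φ j)) + distRange i (φ (σ k g j)))
          + distMap E (φ (σ k g j), actE g (φ j)) := by
      intro j
      rw [distMap_apply, distMap_apply, ← hi.dist_eq, hact]
      have h2 := dist_triangle4 (i (f k (φ (σ k g j)))) (φ (σ k g j)) (actE g (φ j))
        (actE g (i (f k (φ j))))
      have h3 := hle (φ j, i (f k (φ j)))
      have h4 := hft k (φ j)
      have h5 := hft k (φ (σ k g j))
      rw [dist_comm] at h5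
      have h6 := mul_le_mul_of_nonneg_left h4 hC
      simp only at h3
      linarith
    refine (avg_mono h1).trans (le_of_eq ?_)
    rw [avg_add, avg_add, avg_add, avg_const (hd k), avg_const_mul,
      avg_comp_perm (σ k g) fun j => distRange i (φ j)]
    ring
  have hcE := continuous_pairAvg (distMap E) (actE g) (σ k g)
  have hcR : Continuous fun φ : Fin (d k) → E => avg fun j => distRange i (φ j) :=
    continuous_avg fun j => by fun_prop
  have hmeas : Measurable fun (φ : Fin (d k) → E) j => f k (φ j) :=
    measurable_pi_lambda _ fun j => (hf k).comp (measurable_pi_apply j)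
  have hcD := continuous_pairAvg (distMap D) (actD g) (σ k g)
  obtain ⟨M, hM⟩ := exists_abs_le hcD
  rw [defect, coordMap, ProbabilityMeasure.toMeasure_map,
    integral_map hmeas.aemeasurable hcD.aestronglyMeasurable]
  have h7 : ∫ φ : Fin (d k) → E, avg (fun j => distMap D (f k (φ (σ k g j)), actD g (f k (φ j))))
        ∂(μ k : Measure (Fin (d k) → E))
      ≤ ∫ φ : Fin (d k) → E, ((ε + (C + 1) * t k + (C + 1) * avg fun j => distRange i (φ j))
          + avg fun j => distMap E (φ (σ k g j), actE g (φ j)))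
        ∂(μ k : Measure (Fin (d k) → E)) := by
    refine integral_mono ?_ (integrable_of_continuous _ (by fun_prop)) hpt
    exact (integrable_const M).mono' (hcD.measurable.comp hmeas).aestronglyMeasurable
      (.of_forall fun φ => hM fun j => f k (φ j))
  refine h7.trans ?_
  rw [integral_add_of_continuous _ (by fun_prop) hcE, integral_add_mul_avg_distRange]
  have h8 := mul_nonneg hC (defect_nonneg (c := distMap E) (fun _ => dist_nonneg) (actE g)
    (σ k g) (μ k))
  simp only [defect] at h8 ⊢
  linarith

/-- Pushed back into E by i, the retracted marginals differ from the original ones by vanishing mean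
displacements, so they have the same limit; push-forward under the embedding i is injective. -/
theorem ae_ultraFun_marginal_coordMap (hd : ∀ k, 0 < d k) (hω : (ω : Filter ℕ) ≤ cofinite)
    (hi : Isometry i)
    (hm : ∀ᵐ z ∂loebMeasure d ω,
      ultraFun ω (fun k => marginal (μ k)) z = m.map hi.continuous.measurable.aemeasurable)
    (hf : ∀ k, Measurable (f k))
    (ht : Tendsto t ω (𝓝 0)) (hft : ∀ k x, dist x (i (f k x)) ≤ distRange i x + t k)
    (hv : Tendsto (fun k => ∫ φ, avg (fun j => distRange i (φ j))
      ∂(μ k : Measure (Fin (d k) → E))) ω (𝓝 0)) :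
    ∀ᵐ z ∂loebMeasure d ω, ultraFun ω (fun k => marginal (coordMap (hf k) (μ k))) z = m := by
  have hmi := hi.continuous.measurable
  have hae : ultraFun ω (fun k j => (marginal (coordMap (hf k) (μ k)) j).map hmi.aemeasurable)
      =ᵐ[loebMeasure d ω] ultraFun ω fun k => marginal (μ k) := by
    refine ultraFun_ae_eq hd hω fun g => ?_
    have hv' := hv.add ht
    simp only [add_zero] at hv'
    refine tendsto_zero_of_le_add_mul hv' (fun k => avg_nonneg fun j => abs_nonneg _)
      fun ε hε => ?_
    obtain ⟨C, hC, hle⟩ := exists_le_add_mul (T := E × E) (a := fun p => dist p.1 p.2)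
      (b := fun p => |g p.2 - g p.1|) (by fun_prop) (by fun_prop)
      (fun _ => dist_nonneg) (fun p hp => by rw [dist_eq_zero.1 hp, sub_self, abs_zero]) hε
    refine ⟨C, fun k => ?_⟩
    obtain ⟨M, hM⟩ := exists_abs_le g.continuous
    have hj : ∀ j, |∫ x, g x ∂((marginal (coordMap (hf k) (μ k)) j).map hmi.aemeasurable : Measure E)
          - ∫ x, g x ∂(marginal (μ k) j : Measure E)|
        ≤ (ε + C * t k) + C * ∫ x, distRange i x ∂(marginal (μ k) j : Measure E) := by
      intro j
      have hmif : Measurable (i ∘ f k) := hmi.comp (hf k)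
      have hint : Integrable (fun x => g (i (f k x))) (marginal (μ k) j : Measure E) :=
        (integrable_const M).mono' (g.continuous.measurable.comp hmif).aestronglyMeasurable
          (.of_forall fun x => hM _)
      rw [marginal_coordMap, ProbabilityMeasure.toMeasure_map, ProbabilityMeasure.toMeasure_map,
        Measure.map_map hmi (hf k), integral_map hmif.aemeasurable
          g.continuous.aestronglyMeasurable]
      simp only [Function.comp_apply]
      rw [← integral_sub hint (integrable_of_continuous _ g.continuous)]
      refine (abs_integral_le_integral_abs).trans ?_
      have h1 : ∫ x, ((ε + C * t k) + C * distRange i x) ∂(marginal (μ k) j : Measure E)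
          = (ε + C * t k) + C * ∫ x, distRange i x ∂(marginal (μ k) j : Measure E) := by
        rw [integral_add_of_continuous _ continuous_const (by fun_prop), integral_const_mul]
        simp
      rw [← h1]
      refine integral_mono (hint.sub (integrable_of_continuous _ g.continuous)).abs
        (integrable_of_continuous _ (by fun_prop)) fun x => ?_
      have h2 := hle (x, i (f k x))
      have h3 := mul_le_mul_of_nonneg_left (hft k x) hC
      simp only at h2 ⊢
      linarith
    refine (avg_mono hj).trans (le_of_eq ?_)
    rw [avg_add, avg_const (hd k), avg_const_mul, integral_avg]
    ring
  filter_upwards [hm, hae] with z h1 h2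
  have h3 := ultraFun_comp (ω := ω) (ProbabilityMeasure.continuous_map hi.continuous)
    (fun k => marginal (coordMap (hf k) (μ k))) z
  have h4 : (ultraFun ω (fun k => marginal (coordMap (hf k) (μ k))) z).map hmi.aemeasurable
      = m.map hmi.aemeasurable := h3.symm.trans (h2.trans h1)
  have he : MeasurableEmbedding i := hi.isClosedEmbedding.measurableEmbedding
  refine ProbabilityMeasure.toMeasure_injective ?_
  have h5 := congrArg (fun ν : ProbabilityMeasure E => (ν : Measure E).comap i) h4
  simpa only [ProbabilityMeasure.toMeasure_map, he.comap_map] using h5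

/-- A cover for the retracted measure becomes, through i, a cover for the original one, except at
maps displaced by too much in ρ₂; these have small measure by Markov's inequality. -/
theorem seqEntropy_le_coordMap (hd : ∀ k, 0 < d k) (hi : Isometry i)
    (hf : ∀ k, Measurable (f k)) (ht : Tendsto t ω (𝓝 0))
    (hft : ∀ k x, dist x (i (f k x)) ≤ distRange i x + t k)
    (hv : Tendsto (fun k => ∫ φ, avg (fun j => distRange i (φ j) ^ 2)
      ∂(μ k : Measure (Fin (d k) → E))) ω (𝓝 0)) :
    seqEntropy ω μ ≤ seqEntropy ω fun k => coordMap (hf k) (μ k) := by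
  classical
  refine iSup₂_le fun ε hε => iSup₂_le fun δ hδ => ?_
  refine le_trans ?_ (le_iSup₂_of_le (ε / 2) (half_pos hε) (le_iSup₂ (δ / 2) (half_pos hδ)))
  have hw : Tendsto (fun k => 2 * ∫ φ, avg (fun j => distRange i (φ j) ^ 2)
      ∂(μ k : Measure (Fin (d k) → E)) + 2 * t k ^ 2) ω (𝓝 0) := by
    simpa using (hv.const_mul 2).add ((ht.pow 2).const_mul 2)
  -- Half of ε pays for the displacement and half for the cover; half of δ pays for the maps where
  -- the bound `w` on the squared displacement reaches (ε/2)².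
  have hpos : 0 < (ε / 2) ^ 2 * (δ / 2) := by positivity
  refine ultralim_mono ?_
  filter_upwards [hw.eventually_lt_const hpos] with k hk
  refine logRate_mono (le_iInf₂ fun B hB => ?_)
  let w : (Fin (d k) → E) → ℝ := fun φ => 2 * avg (fun j => distRange i (φ j) ^ 2) + 2 * t k ^ 2
  have hsq : Continuous fun φ : Fin (d k) → E => avg fun j => distRange i (φ j) ^ 2 :=
    continuous_avg fun j => by fun_prop
  have hwc : Continuous w := by fun_prop
  have hw0 : ∀ φ, 0 ≤ w φ := fun φ => by
    have := avg_nonneg fun j => sq_nonneg (distRange i (φ j))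
    positivity
  have hbad : (μ k : Measure (Fin (d k) → E)).real {φ | (ε / 2) ^ 2 ≤ w φ} ≤ δ / 2 := by
    have h1 := mul_meas_ge_le_integral_of_nonneg (μ := (μ k : Measure (Fin (d k) → E)))
      (.of_forall hw0) (integrable_of_continuous _ hwc) ((ε / 2) ^ 2)
    have h2 : ∫ φ, w φ ∂(μ k : Measure (Fin (d k) → E))
        = 2 * ∫ φ, avg (fun j => distRange i (φ j) ^ 2) ∂(μ k : Measure (Fin (d k) → E))
          + 2 * t k ^ 2 := by
      rw [integral_add_of_continuous _ (by fun_prop) continuous_const, integral_const_mul]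
      simp
    rw [h2] at h1
    exact (lt_of_mul_lt_mul_left (h1.trans_lt hk) (by positivity)).le
  have hmeas : Measurable fun (φ : Fin (d k) → E) j => f k (φ j) :=
    measurable_pi_lambda _ fun j => (hf k).comp (measurable_pi_apply j)
  have hB' : 1 - δ / 2 ≤ (μ k : Measure (Fin (d k) → E)).real
      ((fun φ j => f k (φ j)) ⁻¹' nhd (ε / 2) (B : Set (Fin (d k) → D))) := by
    have e : (coordMap (hf k) (μ k) : Measure (Fin (d k) → D)).real
        (nhd (ε / 2) (B : Set (Fin (d k) → D))) = (μ k : Measure (Fin (d k) → E)).real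
      ((fun φ j => f k (φ j)) ⁻¹' nhd (ε / 2) (B : Set (Fin (d k) → D))) :=
      map_measureReal_apply hmeas (isOpen_nhd _ _).measurableSet
    rw [← e]
    exact hB
  have hsub : (fun (φ : Fin (d k) → E) j => f k (φ j)) ⁻¹' nhd (ε / 2) (B : Set (Fin (d k) → D))
      ⊆ nhd ε ((B.image fun ψ => i ∘ ψ : Finset (Fin (d k) → E)) : Set (Fin (d k) → E))
        ∪ {φ | (ε / 2) ^ 2 ≤ w φ} := by
    rintro φ ⟨ψ, hψ, hlt⟩
    by_cases hφ : (ε / 2) ^ 2 ≤ w φ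
    · exact Or.inr hφ
    refine Or.inl ⟨i ∘ ψ, by simpa using ⟨ψ, hψ, rfl⟩, ?_⟩
    refine rho2_lt_of_half hε (χ := fun j => i (f k (φ j))) ?_ ?_
    · rw [rho2_lt_iff (half_pos hε)]
      refine lt_of_le_of_lt ?_ (not_le.1 hφ)
      have h1 : ∀ j, dist (φ j) (i (f k (φ j))) ^ 2
          ≤ 2 * distRange i (φ j) ^ 2 + 2 * t k ^ 2 := fun j => by
        have h2 := pow_le_pow_left₀ dist_nonneg (hft k (φ j)) 2
        nlinarith [sq_nonneg (distRange i (φ j) - t k)]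
      refine (avg_mono h1).trans (le_of_eq ?_)
      rw [avg_add, avg_const (hd k), avg_const_mul]
    · rw [rho2_comm]
      simpa only [rho2, Function.comp_apply, hi.dist_eq] using hlt
  refine (iInf₂_le (B.image fun ψ => i ∘ ψ) ?_).trans (by exact_mod_cast Finset.card_image_le)
  have h1 := (measureReal_mono (μ := (μ k : Measure (Fin (d k) → E))) hsub).trans
    (measureReal_union_le _ _)
  change 1 - δ ≤ (μ k : Measure (Fin (d k) → E)).real _
  linarith

/-- Measures asymptotically supported on microstates, whose marginals are represented by a measure
on an invariant closed subset, can be moved to that subset without loss of entropy. -/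
theorem AsympSupported.exists_of_ae_eq_map [Nonempty D] (hd : ∀ k, 0 < d k)
    (hω : (ω : Filter ℕ) ≤ cofinite) (hi : Isometry i) {actD : G → C(D, D)}
    {actE : G → C(E, E)} (hact : ∀ g y, i (actD g y) = actE g (i y))
    (hμ : AsympSupported (fun g => actE g) σ ω μ)
    (hm : ∀ᵐ z ∂loebMeasure d ω,
      ultraFun ω (fun k => marginal (μ k)) z = m.map hi.continuous.measurable.aemeasurable) :
    ∃ ν : ∀ k, ProbabilityMeasure (Fin (d k) → D), AsympSupported (fun g => actD g) σ ω ν ∧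
      (∀ᵐ z ∂loebMeasure d ω, ultraFun ω (fun k => marginal (ν k)) z = m) ∧
      seqEntropy ω μ ≤ seqEntropy ω ν := by
  have hex : ∀ k : ℕ, ∃ f : E → D, Measurable f ∧
      ∀ x, dist x (i (f x)) ≤ distRange i x + 1 / ((k : ℝ) + 1) := fun k =>
    exists_measurable_retraction hi.continuous (by positivity)
  choose f hf hft using hex
  -- The retraction varies with k so that its slack vanishes along `ω`.
  have ht : Tendsto (fun k : ℕ => 1 / ((k : ℝ) + 1)) ω (𝓝 0) :=
    tendsto_one_div_add_atTop_nhds_zero_nat.mono_left (Nat.cofinite_eq_atTop ▸ hω)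
  have hv := tendsto_integral_avg_of_ae_eq_map hd hω hi.continuous.measurable hm
    (distRange_nonneg i) distRange_apply_self
  have hv2 := tendsto_integral_avg_of_ae_eq_map hd hω hi.continuous.measurable hm
    (c := distRange i ^ 2) (fun x => sq_nonneg _) fun y => by simp [distRange_apply_self]
  exact ⟨fun k => coordMap (hf k) (μ k), hμ.retract hd hi hact hf ht hft hv,
    ae_ultraFun_marginal_coordMap hd hω hi hm hf ht hft hv,
    seqEntropy_le_coordMap hd hi hf ht hft hv2⟩

end Retraction

/-! ### The ergodic case -/

section Ergodic

variable {G : Type*} [Group G] {X : Type*} [Group X] [MetricSpace X] [MulDistribMulAction G X]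
  [ContinuousConstSMul G X] {d : ℕ → ℕ} {ω : Ultrafilter ℕ}
  {σ : ∀ k, G → Equiv.Perm (Fin (d k))}

theorem smul_mem_of_translate_eq {K : ClosedSubgroup X} (h : ∀ g : G, translate g K = K) (g : G)
    (x : X) (hx : x ∈ K.toSubgroup) : g • x ∈ K.toSubgroup := by
  have h1 : g • x ∈ (translate g K).toSubgroup := ⟨x, hx, rfl⟩
  rwa [h g] at h1

/-- The restriction of the action to an invariant closed subgroup. -/
def restrictMap (K : ClosedSubgroup X)
    (hK : ∀ (g : G) (x : X), x ∈ K.toSubgroup → g • x ∈ K.toSubgroup) (g : G) :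
    C(K.toSubgroup, K.toSubgroup) :=
  ⟨fun x => ⟨g • (x : X), hK g x x.2⟩,
    ((continuous_const_smul g).comp continuous_subtype_val).subtype_mk _⟩

theorem topEntropy_restrictMap_le (K : ClosedSubgroup X)
    (hK : ∀ (g : G) (x : X), x ∈ K.toSubgroup → g • x ∈ K.toSubgroup) :
    topEntropy (fun g => restrictMap K hK g) σ ω
      ≤ topEntropy (fun (g : G) (x : X) => g • x) σ ω :=
  topEntropy_le_of_isometry isometry_subtype_coe fun _ _ => rfl

variable [CompactSpace X] [IsTopologicalGroup X] [MeasurableSpace X] [BorelSpace X]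

theorem map_haarOn_of_ae_eq_const (hd : ∀ k, 0 < d k) (hω : (ω : Filter ℕ) ≤ cofinite)
    {Y : LoebSpace d ω → ClosedSubgroup X} {K : ClosedSubgroup X}
    (hK : ∀ᵐ z ∂loebMeasure d ω, Y z = K) :
    ((loebMeasure d ω).map Y).map haarOn = Measure.dirac (haarOn K) := by
  have := isProbabilityMeasure_loebMeasure hd hω
  rw [Measure.map_congr (g := fun _ => K) hK, Measure.map_const, measure_univ, one_smul,
    Measure.map_dirac' measurable_haarOn]

/-- The near-optimal measures of the lower bound have limiting marginals equal to m_K, so they can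
be retracted onto K. -/
theorem IsMaximalElement.topEntropy_le_lwEntropy_restrictMap [Countable G] (hd : ∀ k, 0 < d k)
    (hω : (ω : Filter ℕ) ≤ cofinite) {Y : LoebSpace d ω → ClosedSubgroup X}
    (hY : IsMaximalElement G X σ ω Y) {K : ClosedSubgroup X}
    (hK : ∀ (g : G) (x : X), x ∈ K.toSubgroup → g • x ∈ K.toSubgroup)
    (hYK : ∀ᵐ z ∂loebMeasure d ω, Y z = K) :
    topEntropy (fun (g : G) (x : X) => g • x) σ ω
      ≤ lwEntropy (fun g => restrictMap K hK g) σ ω (Measure.dirac (haarProb K.toSubgroup)) := by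
  have := isProbabilityMeasure_loebMeasure hd hω
  refine EReal.ge_of_forall_gt_iff_ge.1 fun b hb => ?_
  obtain ⟨μ, h1, h2, h3⟩ := hY.exists_le_seqEntropy hd hω hb
  obtain ⟨ν, h4, h5, h6⟩ := AsympSupported.exists_of_ae_eq_map (i := Subtype.val)
    (m := haarProb K.toSubgroup) (actD := restrictMap K hK) (actE := actMap X) (μ := μ) hd hω
    isometry_subtype_coe (fun _ _ => rfl) h1 (by
      filter_upwards [h2, hYK] with z hz hz'
      rw [hz, hz']
      rfl)
  refine (h3.trans h6).trans (le_iSup₂_of_le ν ⟨h4, ?_⟩ le_rfl)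
  have h7 := lwTendsto_of_ae hd hω (Φ := fun _ => haarProb K.toSubgroup) measurable_const h5
  rwa [Measure.map_const, measure_univ, one_smul] at h7

end Ergodic

end LocalWeak

end

theorem theorem1p6 {G : Type*} [Group G] [Countable G]
    {X : Type*} [Group X] [MetricSpace X] [CompactSpace X] [IsTopologicalGroup X]
    [MeasurableSpace X] [BorelSpace X] [MulDistribMulAction G X] [ContinuousConstSMul G X]
    (d : ℕ → ℕ) (hd : ∀ k, 0 < d k) (σ : ∀ k, G → Equiv.Perm (Fin (d k)))
    (hσ : IsSoficApproximation σ)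
    (ω : Ultrafilter ℕ) (hω : (ω : Filter ℕ) ≤ Filter.cofinite) :
    (∃ Y : LoebSpace d ω → ClosedSubgroup X, IsMaximalElement G X σ ω Y) ∧
    ∀ Y : LoebSpace d ω → ClosedSubgroup X, IsMaximalElement G X σ ω Y →
      IsInvariantRandomSubgroup G ((loebMeasure d ω).map Y) ∧
      lwEntropy (fun (g : G) (x : X) => g • x) σ ω (((loebMeasure d ω).map Y).map haarOn) =
        topEntropy (fun (g : G) (x : X) => g • x) σ ω ∧
      (CentralizerErgodic σ ω →
        ∃ (K : ClosedSubgroup X) (hK : ∀ (g : G) (x : X), x ∈ K.toSubgroup → g • x ∈ K.toSubgroup),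
          (∀ᵐ z ∂loebMeasure d ω, Y z = K) ∧
          lwEntropy (fun (g : G) (x : X) => g • x) σ ω (Measure.dirac (haarOn K)) =
            topEntropy (fun (g : G) (x : X) => g • x) σ ω ∧
          lwEntropy (fun (g : G) (x : K.toSubgroup) => (⟨g • (x : X), hK g x x.2⟩ : K.toSubgroup))
              σ ω (Measure.dirac (haarProb K.toSubgroup)) =
            topEntropy (fun (g : G) (x : X) => g • x) σ ω ∧
          topEntropy (fun (g : G) (x : K.toSubgroup) => (⟨g • (x : X), hK g x x.2⟩ : K.toSubgroup))
              σ ω =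
            topEntropy (fun (g : G) (x : X) => g • x) σ ω) := by
  refine ⟨(exists_maximalElement hd hω σ).imp fun Y h => h.1, fun Y hY =>
    ⟨isInvariantRandomSubgroup_map hd hω hY.1, hY.lwEntropy_eq hd hω, fun herg => ?_⟩⟩
  obtain ⟨K, hYK⟩ := hY.exists_eq_const hd hω herg
  have hK := smul_mem_of_translate_eq fun g : G => translate_eq_of_ae_eq_const hd hω hY.1 hYK g
  have h1 := hY.topEntropy_le_lwEntropy_restrictMap hd hω hK hYK
  have h2 := lwEntropy_le_topEntropy (act := restrictMap K hK) (σ := σ) (ω := ω) hd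
    (Measure.dirac (haarProb K.toSubgroup))
  have h3 := topEntropy_restrictMap_le (σ := σ) (ω := ω) K hK
  -- The inequalities close a circle: local weak* entropy on K ≤ topological entropy of K ≤
  -- topological entropy of X ≤ local weak* entropy on K.
  refine ⟨K, hK, hYK, ?_, le_antisymm (h2.trans h3) h1, le_antisymm h3 (h1.trans h2)⟩
  rw [← hY.lwEntropy_eq hd hω, map_haarOn_of_ae_eq_const hd hω hYK]
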